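/- Let $n\ge 3$, $0<\theta_1<\theta_2<\pi$, let $e\in\mathbb R^n$ be a unit vector and let $\theta(x)$ denote the angle between $x$ and $e$. Let $\Omega\subset\mathbb R^n$ be a regularized cone: a connected open set with smooth boundary which outside the open unit ball $B_1(0)$ coincides with $\{\theta_1<\theta<\theta_2\}$. Let $r\in C^\infty(\mathbb R^n)$ be positive with $r(x)=|x|$ for $|x|\ge 1$. Let $\phi$ be a function smooth up to $\partial\Omega$, positive in $\Omega$, vanishing with nonzero gradient on $\partial\Omega$, whose superlevel sets are conical outside $B_1(0)$ (that is, $\phi(cx)=\phi(x)$ for $x\in\Omega$, $|x|\ge1$, $c\ge 1$), and which outside $B_1(0)$ equals $\theta-\theta_1$ near the cone $\{\theta=\theta_1\}$ and $\theta_2-\theta$ near the cone $\{\theta=\theta_2\}$. Let $N\ge 1$ be an integer and $\rho=\phi^{2N}$. For a vector field $Z$ let $\mathcal D(Z)(V,W)=D_VZ\cdot W+D_WZ\cdot V$ be the Killing operator of the Euclidean metric. For a vector field or tensor $f$ put $\|f\|_{0,-s,\rho}^2=\int_\Omega |f|^2r^{-n+2s}\rho\,dx$ and, for a vector field, $\|Z\|_{1,-q,\rho}^2=\|Z\|_{0,-q,\rho}^2+\|\nabla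 Z\|_{0,-q-1,\rho}^2$; let $\mathcal X_{1,-q,\rho}$ be the completion in $\|\cdot\|_{1,-q,\rho}$ of the smooth vector fields in $\Omega$ with bounded support and finite norm (no condition on $\partial\Omega$). (1) For every real $q$ with $0<q<\frac{n-2}{2}$ there is a constant $C>0$ such that $$\int_\Omega|\nabla Z|^2r^{2-n+2q}\rho\,dx\le C\int_\Omega|\mathcal D(Z)|^2r^{2-n+2q}\rho\,dx$$ for every smooth vector field $Z$ in $\Omega$ with bounded support (no condition on $\partial\Omega$; the integrals take values in $[0,\infty]$). (2) For every $p\in(\frac{n-2}{2},n-2)$ there is a constant $C>0$ such that $$\|Z\|_{1,-n+p+2,\rho}\le C\,\|\mathcal D(Z)\|_{0,-n+p+1,\rho}\qquad\text{for all } Z\in\mathcal X_{1,-n+p+2,\rho}.$$ -/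

import Mathlib

open MeasureTheory Filter Topology
open scoped ContDiff

noncomputable section

/-- A set with smooth boundary: near each boundary point it is the positivity set of a smooth
function with nonvanishing differential there. -/
def HasSmoothBoundary {n : ℕ} (Ω : Set (EuclideanSpace ℝ (Fin n))) : Prop :=
  ∀ x ∈ frontier Ω, ∃ U : Set (EuclideanSpace ℝ (Fin n)), IsOpen U ∧ x ∈ U ∧
    ∃ f : EuclideanSpace ℝ (Fin n) → ℝ,
      ContDiffOn ℝ ∞ f U ∧ fderiv ℝ f x ≠ 0 ∧ Ω ∩ U = {y ∈ U | 0 < f y}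

/-- The regularized conical region between the two cones of angles `θ₁ < θ₂` around the axis
direction `e` (the vector pointing from the vertex, placed at the origin, into the cones):
a smooth domain which outside the open unit ball is exactly `{θ₁ < θ < θ₂}`, where `θ` is the
angle with `e`. Inside the unit ball it may be any smooth modification. -/
structure IsRegularizedCone {n : ℕ} (e : EuclideanSpace ℝ (Fin n)) (θ₁ θ₂ : ℝ)
    (Ω : Set (EuclideanSpace ℝ (Fin n))) : Prop where
  isOpen : IsOpen Ω
  isConnected : IsConnected Ω
  smooth_boundary : HasSmoothBoundary Ω
  conical : ∀ x, 1 ≤ ‖x‖ →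
    (x ∈ Ω ↔ θ₁ < InnerProductGeometry.angle e x ∧ InnerProductGeometry.angle e x < θ₂)

/-- The radial weight: smooth, positive, equal to the Euclidean norm outside the unit ball. -/
structure IsRadialWeight {n : ℕ} (r : EuclideanSpace ℝ (Fin n) → ℝ) : Prop where
  smooth : ContDiff ℝ ∞ r
  pos : ∀ x, 0 < r x
  eq_norm : ∀ x, 1 ≤ ‖x‖ → r x = ‖x‖

/-- The angular weight `φ`: smooth up to the boundary, positive in `Ω`, vanishing with nonzero
gradient on the boundary, equal to `θ - θ₁` resp. `θ₂ - θ` near the two boundary cones, and with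
superlevel sets which are conical outside the unit ball (that is, `φ` is constant along rays
there). -/
structure IsAngularWeight {n : ℕ} (e : EuclideanSpace ℝ (Fin n)) (θ₁ θ₂ : ℝ)
    (Ω : Set (EuclideanSpace ℝ (Fin n))) (φ : EuclideanSpace ℝ (Fin n) → ℝ) : Prop where
  smooth : ∀ x ∈ closure Ω, ContDiffAt ℝ ∞ φ x
  pos : ∀ x ∈ Ω, 0 < φ x
  eq_zero : ∀ x ∈ frontier Ω, φ x = 0
  grad_ne_zero : ∀ x ∈ frontier Ω, fderiv ℝ φ x ≠ 0
  near_inner : ∃ ε : ℝ, 0 < ε ∧ ∀ x ∈ Ω, 1 ≤ ‖x‖ →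
    InnerProductGeometry.angle e x < θ₁ + ε → φ x = InnerProductGeometry.angle e x - θ₁
  near_outer : ∃ ε : ℝ, 0 < ε ∧ ∀ x ∈ Ω, 1 ≤ ‖x‖ →
    θ₂ - ε < InnerProductGeometry.angle e x → φ x = θ₂ - InnerProductGeometry.angle e x
  conical : ∀ x ∈ Ω, 1 ≤ ‖x‖ → ∀ c : ℝ, 1 ≤ c → φ (c • x) = φ x

/-- A smooth vector field in the open set `Ω` whose support in `Ω` is bounded; nothing is required
at the boundary of `Ω`. -/
def IsSmoothBddSupp {n : ℕ} (Ω : Set (EuclideanSpace ℝ (Fin n)))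
    (Z : EuclideanSpace ℝ (Fin n) → EuclideanSpace ℝ (Fin n)) : Prop :=
  ContDiffOn ℝ ∞ Z Ω ∧ Bornology.IsBounded (Ω ∩ Function.support Z)

/-- The squared Euclidean norm `∑ i j, B(e_i, e_j)²` of a `2`-tensor. -/
def tensorNormSq {n : ℕ}
    (B : EuclideanSpace ℝ (Fin n) → EuclideanSpace ℝ (Fin n) → ℝ) : ℝ :=
  ∑ i : Fin n, ∑ j : Fin n, B (EuclideanSpace.single i 1) (EuclideanSpace.single j 1) ^ 2

/-- `|∇Z|²` as a function of the derivative `A = DZ(x)`, `A V = D_V Z`. -/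
def gradNormSq {n : ℕ} (A : EuclideanSpace ℝ (Fin n) →L[ℝ] EuclideanSpace ℝ (Fin n)) : ℝ :=
  tensorNormSq fun V W => inner ℝ (A V) W

/-- The Killing operator `𝒟(Z)(V, W) = D_V Z · W + D_W Z · V` as a function of `A = DZ(x)`. -/
def killing {n : ℕ} (A : EuclideanSpace ℝ (Fin n) →L[ℝ] EuclideanSpace ℝ (Fin n))
    (V W : EuclideanSpace ℝ (Fin n)) : ℝ :=
  inner ℝ (A V) W + inner ℝ (A W) V

/-- `|𝒟(Z)|²` as a function of `A = DZ(x)`. -/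
def killingNormSq {n : ℕ} (A : EuclideanSpace ℝ (Fin n) →L[ℝ] EuclideanSpace ℝ (Fin n)) : ℝ :=
  tensorNormSq (killing A)

/-- The squared norm of `ℋ_{0,-s,ρ}(Ω)`, that is `∫_Ω |f|² r^{-n+2s} ρ ∈ [0, ∞]`, as a function
of the pointwise squared length `F = |f|²`. -/
def weightedSq {n : ℕ} (Ω : Set (EuclideanSpace ℝ (Fin n)))
    (r ρ : EuclideanSpace ℝ (Fin n) → ℝ) (s : ℝ) (F : EuclideanSpace ℝ (Fin n) → ℝ) : ENNReal :=
  ∫⁻ x in Ω, ENNReal.ofReal (F x * r x ^ (-(n : ℝ) + 2 * s) * ρ x)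

/-- The norm of `ℋ_{1,-q,ρ}(Ω)` of a vector field `Z` with derivative `G`. -/
def sobolevNorm {n : ℕ} (Ω : Set (EuclideanSpace ℝ (Fin n)))
    (r ρ : EuclideanSpace ℝ (Fin n) → ℝ) (q : ℝ)
    (Z : EuclideanSpace ℝ (Fin n) → EuclideanSpace ℝ (Fin n))
    (G : EuclideanSpace ℝ (Fin n) → EuclideanSpace ℝ (Fin n) →L[ℝ] EuclideanSpace ℝ (Fin n)) :
    ENNReal :=
  (weightedSq Ω r ρ q (fun x => ‖Z x‖ ^ 2) +
    weightedSq Ω r ρ (q + 1) (fun x => gradNormSq (G x))) ^ (1 / 2 : ℝ)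

/-- The norm in `ℋ_{0,-s,ρ}(Ω)` of the Killing tensor `𝒟(Z)` of a field with derivative `G`. -/
def killingNorm {n : ℕ} (Ω : Set (EuclideanSpace ℝ (Fin n)))
    (r ρ : EuclideanSpace ℝ (Fin n) → ℝ) (s : ℝ)
    (G : EuclideanSpace ℝ (Fin n) → EuclideanSpace ℝ (Fin n) →L[ℝ] EuclideanSpace ℝ (Fin n)) :
    ENNReal :=
  weightedSq Ω r ρ s (fun x => killingNormSq (G x)) ^ (1 / 2 : ℝ)

/-- `Z` belongs to the space of vector fields of class `ℋ_{1,-q,ρ}(Ω)`, the completion in the norm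
of `ℋ_{1,-q,ρ}` of the smooth fields with bounded support and finite norm, and `G` is its
derivative: `(Z, G)` is the limit of `(Z_k, DZ_k)` for a sequence of such fields. When the weights
are positive and continuous on the open set `Ω` the convergence holds in `L²_loc(Ω)`, so that `G`
is the weak derivative of `Z`, determined by `Z` almost everywhere. -/
def MemSobolev {n : ℕ} (Ω : Set (EuclideanSpace ℝ (Fin n)))
    (r ρ : EuclideanSpace ℝ (Fin n) → ℝ) (q : ℝ)
    (Z : EuclideanSpace ℝ (Fin n) → EuclideanSpace ℝ (Fin n))
    (G : EuclideanSpace ℝ (Fin n) → EuclideanSpace ℝ (Fin n) →L[ℝ] EuclideanSpace ℝ (Fin n)) :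
    Prop :=
  AEStronglyMeasurable Z (volume.restrict Ω) ∧ AEStronglyMeasurable G (volume.restrict Ω) ∧
    ∃ Zk : ℕ → EuclideanSpace ℝ (Fin n) → EuclideanSpace ℝ (Fin n),
      (∀ k, IsSmoothBddSupp Ω (Zk k) ∧ sobolevNorm Ω r ρ q (Zk k) (fderiv ℝ (Zk k)) < ⊤) ∧
      Tendsto (fun k => sobolevNorm Ω r ρ q (fun x => Zk k x - Z x)
        (fun x => fderiv ℝ (Zk k) x - G x)) atTop (𝓝 0)

end

/-! On the whole space and for compactly supported fields, Korn's first inequality rests on one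
identity: two integrations by parts turn the cross term of |𝒟(Y)|² into (div Y)² ≥ 0
(`korn_of_hasCompactSupport`). The rest of the argument makes room for the weights and for the
absence of a boundary condition. Write β = -n + 2q and N = m + 1.

Korn with a lower order term. Multiply Z by the square root u of the weight r^(β+2) φ^(2m+2), cut
off near φ = 0. The product extends by zero to the whole space, and |∇u|² is at most a constant
times r^β φ^(2m), uniformly in the cutoff level. So ∇Z is controlled by 𝒟(Z) plus the integral of
|Z|² r^β φ^(2m) (`exists_weighted_korn`).

Hardy at the boundary. For a field W transversal to the boundary, the divergence of φ^(2m+1) r^(β+1)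
⟨Z,W⟩² W contains the positive term (2m+1) φ^(2m) r^(β+1) ⟨Z,W⟩² ∂_Wφ, and it contains derivatives
of Z only through ⟨D_W Z, W⟩, which is half of 𝒟(Z)(W,W). No boundary term appears because the
weight vanishes there. Small constant perturbations of W recover every component of Z. Thus the
lower order term is bounded by 𝒟(Z) and by |Z|² on an interior region φ ≥ s'
(`exists_weighted_hardy`).

Interior region. On compact subsets of a connected open set, Z is L²-close to an affine field with
an error governed by 𝒟(Z): on a ball this follows by averaging ⟨Z x - Z y, x - y⟩, and balls are
then chained. An affine field on a fixed shell S is bounded by its values on the dilate 2^L S with a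
constant C₀ independent of L. Hence the dyadic energies I_j = 2^(2qj) ∫_S |Z(2^j x)|² dx satisfy I_j
≤ 4 C₀ 2^(-2qL) I_(j+L) + g_j. Since q > 0, a large L makes the factor at most 1/2. Bounded support
makes the sum finite, so it can be absorbed, and by scaling the g_j add up to the weighted Killing
energy (`exists_lintegral_level_le`). The connected shell needed here exists because n ≥ 3.

These estimates combine in `exists_weighted_hardy_korn`, which gives (1); with q = n - p - 2 > 0 and
a passage to the limit in the completion it gives (2). -/

/-! ### Pointwise algebra of the gradient and Killing norms -/

section TensorAlgebra

variable {n : ℕ}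

lemma inner_single_one (x : EuclideanSpace ℝ (Fin n)) (j : Fin n) :
    inner ℝ x (EuclideanSpace.single j 1) = x j := by
  simp [EuclideanSpace.inner_single_right]

lemma gradNormSq_eq_sum (A : EuclideanSpace ℝ (Fin n) →L[ℝ] EuclideanSpace ℝ (Fin n)) :
    gradNormSq A = ∑ i, ∑ j, (A (EuclideanSpace.single i 1) j) ^ 2 := by
  simp only [gradNormSq, tensorNormSq, inner_single_one]

lemma killingNormSq_eq_sum (A : EuclideanSpace ℝ (Fin n) →L[ℝ] EuclideanSpace ℝ (Fin n)) :
    killingNormSq A = ∑ i, ∑ j, (A (EuclideanSpace.single i 1) j +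
      A (EuclideanSpace.single j 1) i) ^ 2 := by
  simp only [killingNormSq, killing, tensorNormSq, inner_single_one]

lemma gradNormSq_nonneg (A : EuclideanSpace ℝ (Fin n) →L[ℝ] EuclideanSpace ℝ (Fin n)) :
    0 ≤ gradNormSq A := by
  rw [gradNormSq_eq_sum]; positivity

lemma killingNormSq_nonneg (A : EuclideanSpace ℝ (Fin n) →L[ℝ] EuclideanSpace ℝ (Fin n)) :
    0 ≤ killingNormSq A := by
  rw [killingNormSq_eq_sum]; positivity

lemma gradNormSq_add_le (A B : EuclideanSpace ℝ (Fin n) →L[ℝ] EuclideanSpace ℝ (Fin n)) :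
    gradNormSq (A + B) ≤ 2 * gradNormSq A + 2 * gradNormSq B := by
  simp only [gradNormSq_eq_sum, Finset.mul_sum, ← Finset.sum_add_distrib]
  gcongr with i _ j _
  simp only [add_apply, PiLp.add_apply]
  nlinarith [sq_nonneg (A (EuclideanSpace.single i 1) j - B (EuclideanSpace.single i 1) j)]

lemma killingNormSq_add_le (A B : EuclideanSpace ℝ (Fin n) →L[ℝ] EuclideanSpace ℝ (Fin n)) :
    killingNormSq (A + B) ≤ 2 * killingNormSq A + 2 * killingNormSq B := by
  simp only [killingNormSq_eq_sum, Finset.mul_sum, ← Finset.sum_add_distrib]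
  gcongr with i _ j _
  simp only [add_apply, PiLp.add_apply]
  nlinarith [sq_nonneg ((A (EuclideanSpace.single i 1) j + A (EuclideanSpace.single j 1) i) -
    (B (EuclideanSpace.single i 1) j + B (EuclideanSpace.single j 1) i))]

lemma gradNormSq_neg (A : EuclideanSpace ℝ (Fin n) →L[ℝ] EuclideanSpace ℝ (Fin n)) :
    gradNormSq (-A) = gradNormSq A := by
  simp [gradNormSq_eq_sum]

lemma gradNormSq_smul (c : ℝ) (A : EuclideanSpace ℝ (Fin n) →L[ℝ] EuclideanSpace ℝ (Fin n)) :
    gradNormSq (c • A) = c ^ 2 * gradNormSq A := by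
  simp only [gradNormSq_eq_sum, Finset.mul_sum, smul_apply, PiLp.smul_apply,
    smul_eq_mul, mul_pow]

lemma killingNormSq_smul (c : ℝ) (A : EuclideanSpace ℝ (Fin n) →L[ℝ] EuclideanSpace ℝ (Fin n)) :
    killingNormSq (c • A) = c ^ 2 * killingNormSq A := by
  simp only [killingNormSq_eq_sum, Finset.mul_sum, smul_apply,
    PiLp.smul_apply, smul_eq_mul, ← mul_add, mul_pow]

lemma killingNormSq_le (A : EuclideanSpace ℝ (Fin n) →L[ℝ] EuclideanSpace ℝ (Fin n)) :
    killingNormSq A ≤ 4 * gradNormSq A := by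
  have h : killingNormSq A ≤ 2 * gradNormSq A + 2 * gradNormSq A := by
    conv_rhs => rw [gradNormSq_eq_sum]; arg 2; rw [Finset.sum_comm]
    rw [killingNormSq_eq_sum]
    simp only [Finset.mul_sum, ← Finset.sum_add_distrib]
    gcongr with i _ j _
    nlinarith [sq_nonneg (A (EuclideanSpace.single i 1) j - A (EuclideanSpace.single j 1) i)]
  linarith

/-- The cross term is isolated because its integral is the integral of the squared divergence when A
is the derivative of a compactly supported field. -/
lemma killingNormSq_eq (A : EuclideanSpace ℝ (Fin n) →L[ℝ] EuclideanSpace ℝ (Fin n)) :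
    killingNormSq A = 2 * gradNormSq A +
      2 * ∑ i, ∑ j, A (EuclideanSpace.single i 1) j * A (EuclideanSpace.single j 1) i := by
  have h : killingNormSq A = gradNormSq A + gradNormSq A +
      2 * ∑ i, ∑ j, A (EuclideanSpace.single i 1) j * A (EuclideanSpace.single j 1) i := by
    conv_rhs => rw [gradNormSq_eq_sum]; arg 1; arg 2; rw [Finset.sum_comm]
    rw [killingNormSq_eq_sum]
    simp only [Finset.mul_sum, ← Finset.sum_add_distrib]
    refine Finset.sum_congr rfl fun i _ => Finset.sum_congr rfl fun j _ => ?_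
    ring
  linarith

lemma gradNormSq_smulRight (l : EuclideanSpace ℝ (Fin n) →L[ℝ] ℝ)
    (z : EuclideanSpace ℝ (Fin n)) : gradNormSq (l.smulRight z) = ‖l‖ ^ 2 * ‖z‖ ^ 2 := by
  obtain ⟨v, rfl⟩ := (InnerProductSpace.toDual ℝ (EuclideanSpace ℝ (Fin n))).surjective l
  simp only [gradNormSq_eq_sum, ContinuousLinearMap.smulRight_apply, PiLp.smul_apply,
    InnerProductSpace.toDual_apply_apply, inner_single_one, smul_eq_mul, mul_pow,
    LinearIsometryEquiv.norm_map, EuclideanSpace.norm_sq_eq, Real.norm_eq_abs, sq_abs]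
  rw [Finset.sum_mul_sum]

lemma apply_eq_sum_single {F : Type*} [AddCommGroup F] [Module ℝ F] [TopologicalSpace F]
    (A : EuclideanSpace ℝ (Fin n) →L[ℝ] F) (v : EuclideanSpace ℝ (Fin n)) :
    A v = ∑ i, v i • A (EuclideanSpace.single i 1) := by
  conv_lhs => rw [← (EuclideanSpace.basisFun (Fin n) ℝ).sum_repr v]
  simp

lemma killing_eq_sum (A : EuclideanSpace ℝ (Fin n) →L[ℝ] EuclideanSpace ℝ (Fin n))
    (v w : EuclideanSpace ℝ (Fin n)) :
    killing A v w = ∑ i, ∑ j, (A (EuclideanSpace.single i 1) j +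
      A (EuclideanSpace.single j 1) i) * (v i * w j) := by
  have h : ∀ v w : EuclideanSpace ℝ (Fin n), inner ℝ (A v) w =
      ∑ i, ∑ j, A (EuclideanSpace.single i 1) j * (v i * w j) := by
    intro v w
    rw [apply_eq_sum_single A v, sum_inner]
    refine Finset.sum_congr rfl fun i _ => ?_
    rw [real_inner_smul_left, PiLp.inner_apply, Finset.mul_sum]
    refine Finset.sum_congr rfl fun j _ => ?_
    simp only [RCLike.inner_apply, conj_trivial]
    ring
  rw [killing, h, h, Finset.sum_comm (f := fun i j => A (EuclideanSpace.single i 1) j * (w i * v j)),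
    ← Finset.sum_add_distrib]
  refine Finset.sum_congr rfl fun i _ => ?_
  rw [← Finset.sum_add_distrib]
  refine Finset.sum_congr rfl fun j _ => ?_
  ring

/-- Cauchy–Schwarz over pairs of indices. -/
lemma killing_sq_le (A : EuclideanSpace ℝ (Fin n) →L[ℝ] EuclideanSpace ℝ (Fin n))
    (v w : EuclideanSpace ℝ (Fin n)) :
    killing A v w ^ 2 ≤ killingNormSq A * (‖v‖ ^ 2 * ‖w‖ ^ 2) := by
  rw [killing_eq_sum, killingNormSq_eq_sum, EuclideanSpace.norm_sq_eq, EuclideanSpace.norm_sq_eq,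
    Finset.sum_mul_sum]
  simp only [← Finset.sum_product', Real.norm_eq_abs, sq_abs, ← mul_pow]
  exact Finset.sum_mul_sq_le_sq_mul_sq _ _ _

lemma continuous_gradNormSq :
    Continuous (gradNormSq : (EuclideanSpace ℝ (Fin n) →L[ℝ] EuclideanSpace ℝ (Fin n)) → ℝ) := by
  unfold gradNormSq tensorNormSq
  fun_prop

lemma continuous_killingNormSq :
    Continuous
      (killingNormSq : (EuclideanSpace ℝ (Fin n) →L[ℝ] EuclideanSpace ℝ (Fin n)) → ℝ) := by
  unfold killingNormSq killing tensorNormSq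
  fun_prop

end TensorAlgebra

/-! ### Integration by parts for compactly supported functions -/

section CompactSupport

variable {E : Type*} [NormedAddCommGroup E] [NormedSpace ℝ E] [FiniteDimensional ℝ E]
  [MeasurableSpace E] [BorelSpace E]

lemma integral_fderiv_eq_zero_of_hasCompactSupport (μ : Measure E) [μ.IsAddHaarMeasure]
    {f : E → ℝ} (hf : ContDiff ℝ 1 f) (hc : HasCompactSupport f) (v : E) :
    ∫ x, fderiv ℝ f x v ∂μ = 0 := by
  have hd : Continuous fun x => fderiv ℝ f x v := (hf.continuous_fderiv one_ne_zero).clm_apply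
    continuous_const
  have h1 : Integrable (fun x => fderiv ℝ f x v) μ :=
    hd.integrable_of_hasCompactSupport (hc.fderiv_apply ℝ v)
  have h2 : Integrable f μ := hf.continuous.integrable_of_hasCompactSupport hc
  have h := integral_mul_fderiv_eq_neg_fderiv_mul_of_integrable (μ := μ) (f := fun _ : E => (1 : ℝ))
    (g := f) (v := v) (by simp) (by simpa using h1) (by simpa using h2)
    (fun x _ => by fun_prop) (fun x _ => (hf.differentiable one_ne_zero) x)
  simpa using h

/-- Both sides equal minus the integral of f times the mixed second derivative of g, which is
symmetric in v and w. -/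
lemma integral_fderiv_mul_fderiv_comm (μ : Measure E) [μ.IsAddHaarMeasure]
    {f g : E → ℝ} (hf : ContDiff ℝ 2 f) (hg : ContDiff ℝ 2 g) (hfc : HasCompactSupport f)
    (v w : E) :
    ∫ x, fderiv ℝ f x v * fderiv ℝ g x w ∂μ = ∫ x, fderiv ℝ f x w * fderiv ℝ g x v ∂μ := by
  have key : ∀ v w : E, ∫ x, fderiv ℝ f x v * fderiv ℝ g x w ∂μ =
      - ∫ x, f x * fderiv ℝ (fderiv ℝ g) x v w ∂μ := by
    intro v w
    have hg1 : ContDiff ℝ 1 (fderiv ℝ g) := hg.fderiv_right (by norm_num)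
    have hgw : ContDiff ℝ 1 (fun x => fderiv ℝ g x w) := hg1.clm_apply contDiff_const
    have hder : ∀ x, fderiv ℝ (fun x => fderiv ℝ g x w) x v = fderiv ℝ (fderiv ℝ g) x v w := by
      intro x
      rw [fderiv_clm_apply ((hg1.differentiable one_ne_zero) x) (by fun_prop)]
      simp
    have c1 : Continuous fun x => fderiv ℝ f x v :=
      ((hf.of_le one_le_two).continuous_fderiv one_ne_zero).clm_apply continuous_const
    have c2 : Continuous fun x => fderiv ℝ (fderiv ℝ g) x v w :=
      ((hg1.continuous_fderiv one_ne_zero).clm_apply continuous_const).clm_apply continuous_const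
    have hint : Integrable (fun x => f x * fderiv ℝ (fderiv ℝ g) x v w) μ :=
      (hf.continuous.mul c2).integrable_of_hasCompactSupport hfc.mul_right
    have h := integral_mul_fderiv_eq_neg_fderiv_mul_of_integrable (μ := μ) (f := f)
      (g := fun x => fderiv ℝ g x w) (v := v)
      ((c1.mul hgw.continuous).integrable_of_hasCompactSupport ((hfc.fderiv_apply ℝ v).mul_right))
      (by simpa only [hder] using hint)
      ((hf.continuous.mul hgw.continuous).integrable_of_hasCompactSupport hfc.mul_right)
      (fun x _ => (hf.differentiable two_ne_zero) x) (fun x _ => (hgw.differentiable one_ne_zero) x)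
    simp only [hder] at h
    rw [h, neg_neg]
  rw [key v w, key w v]
  congr 2
  ext x
  rw [(hg.contDiffAt.isSymmSndFDerivAt (by simp)).eq]

end CompactSupport

/-! ### Korn's first inequality on the whole space -/

section Korn

variable {n : ℕ}

lemma fderiv_euclidean_apply {Y : EuclideanSpace ℝ (Fin n) → EuclideanSpace ℝ (Fin n)}
    {x : EuclideanSpace ℝ (Fin n)} (hY : DifferentiableAt ℝ Y x) (v : EuclideanSpace ℝ (Fin n))
    (j : Fin n) : fderiv ℝ Y x v j = fderiv ℝ (fun z => Y z j) x v := by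
  have h := ((EuclideanSpace.proj (𝕜 := ℝ) j).hasFDerivAt (x := Y x)).comp x hY.hasFDerivAt
  have h2 : fderiv ℝ (fun z => Y z j) x = (EuclideanSpace.proj (𝕜 := ℝ) j).comp (fderiv ℝ Y x) :=
    h.fderiv
  rw [h2]; rfl

/-- **Korn's first inequality** for compactly supported fields. -/
lemma korn_of_hasCompactSupport {Y : EuclideanSpace ℝ (Fin n) → EuclideanSpace ℝ (Fin n)}
    (hY : ContDiff ℝ 2 Y) (hc : HasCompactSupport Y) :
    2 * ∫ x, gradNormSq (fderiv ℝ Y x) ≤ ∫ x, killingNormSq (fderiv ℝ Y x) := by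
  have hcd : Continuous (fderiv ℝ Y) := (hY.of_le one_le_two).continuous_fderiv one_ne_zero
  have hYj : ∀ j, ContDiff ℝ 2 fun z => Y z j := fun j =>
    (EuclideanSpace.proj (𝕜 := ℝ) j).contDiff.comp hY
  have hcj : ∀ j, HasCompactSupport fun z => Y z j := fun j =>
    hc.comp_left (g := fun z : EuclideanSpace ℝ (Fin n) => z j) rfl
  have hfd : ∀ x (i j : Fin n), fderiv ℝ Y x (EuclideanSpace.single i 1) j =
      fderiv ℝ (fun z => Y z j) x (EuclideanSpace.single i 1) := fun x i j =>
    fderiv_euclidean_apply ((hY.differentiable two_ne_zero) x) _ _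
  have hcont : ∀ i j, Continuous fun x =>
      fderiv ℝ (fun z => Y z j) x (EuclideanSpace.single i 1) := fun i j =>
    (((hYj j).of_le one_le_two).continuous_fderiv one_ne_zero).clm_apply continuous_const
  have hprod : ∀ i j k l : Fin n, Integrable fun x =>
      fderiv ℝ (fun z => Y z j) x (EuclideanSpace.single i 1) *
        fderiv ℝ (fun z => Y z l) x (EuclideanSpace.single k 1) := fun i j k l =>
    ((hcont i j).mul (hcont k l)).integrable_of_hasCompactSupport
      (((hcj j).fderiv_apply ℝ _).mul_right)
  have hg : Integrable fun x => gradNormSq (fderiv ℝ Y x) :=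
    (continuous_gradNormSq.comp hcd).integrable_of_hasCompactSupport
      ((hc.fderiv ℝ).comp_left (by simp [gradNormSq_eq_sum]))
  -- Exchanging the two differentiations turns ∂ᵢYⱼ ∂ⱼYᵢ into ∂ⱼYⱼ ∂ᵢYᵢ under the integral, and the
  -- double sum of the latter is (div Y)².
  have hcross : 0 ≤ ∫ x, ∑ i : Fin n, ∑ j : Fin n,
      fderiv ℝ (fun z => Y z j) x (EuclideanSpace.single i 1) *
        fderiv ℝ (fun z => Y z i) x (EuclideanSpace.single j 1) := by
    rw [integral_finsetSum _ fun i _ => integrable_finsetSum _ fun j _ => hprod i j j i]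
    have : ∀ i : Fin n, ∫ x, ∑ j : Fin n,
        fderiv ℝ (fun z => Y z j) x (EuclideanSpace.single i 1) *
          fderiv ℝ (fun z => Y z i) x (EuclideanSpace.single j 1) =
        ∫ x, ∑ j : Fin n, fderiv ℝ (fun z => Y z j) x (EuclideanSpace.single j 1) *
          fderiv ℝ (fun z => Y z i) x (EuclideanSpace.single i 1) := by
      intro i
      rw [integral_finsetSum _ fun j _ => hprod i j j i,
        integral_finsetSum _ fun j _ => hprod j j i i]
      exact Finset.sum_congr rfl fun j _ =>
        integral_fderiv_mul_fderiv_comm volume (hYj j) (hYj i) (hcj j) _ _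
    rw [Finset.sum_congr rfl fun i _ => this i,
      ← integral_finsetSum _ fun i _ => integrable_finsetSum _ fun j _ => hprod j j i i]
    refine integral_nonneg fun x => ?_
    simp only [Pi.zero_apply]
    rw [Finset.sum_comm, ← Finset.sum_mul_sum]
    exact mul_self_nonneg _
  simp only [killingNormSq_eq, hfd]
  rw [integral_add (hg.const_mul 2), integral_const_mul, integral_const_mul]
  · linarith
  · exact (integrable_finsetSum _ fun i _ => integrable_finsetSum _ fun j _ =>
      hprod i j j i).const_mul 2

end Korn

/-! ### Cauchy–Schwarz and averages over segments -/

section LIntegral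

lemma lintegral_sq_le {α : Type*} [MeasurableSpace α] (μ : Measure α) {f : α → ENNReal}
    (hf : AEMeasurable f μ) : (∫⁻ x, f x ∂μ) ^ 2 ≤ μ Set.univ * ∫⁻ x, f x ^ 2 ∂μ := by
  have h := ENNReal.lintegral_mul_le_Lp_mul_Lq μ Real.HolderConjugate.two_two hf
    (aemeasurable_const (b := (1 : ENNReal)))
  have h2 := pow_le_pow_left₀ zero_le h 2
  simp only [Pi.mul_apply, mul_one, ENNReal.one_rpow, lintegral_const, one_mul, mul_pow] at h2
  simp only [← ENNReal.rpow_natCast, ← ENNReal.rpow_mul] at h2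
  norm_num at h2
  simpa only [mul_comm] using h2

variable {E : Type*} [NormedAddCommGroup E] [NormedSpace ℝ E] [FiniteDimensional ℝ E]
  [MeasurableSpace E] [BorelSpace E]

lemma lintegral_comp_smul_add (μ : Measure E) [μ.IsAddHaarMeasure] {G : E → ENNReal}
    (hG : Measurable G) {r : ℝ} (hr : r ≠ 0) (c : E) :
    ∫⁻ x, G (r • x + c) ∂μ = ENNReal.ofReal |(r ^ Module.finrank ℝ E)⁻¹| * ∫⁻ x, G x ∂μ := by
  have hm : Measurable fun x : E => G (x + c) := hG.comp (measurable_add_const c)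
  have h : ∫⁻ x, G (r • x + c) ∂μ = ∫⁻ x, G (x + c) ∂(Measure.map (r • ·) μ) :=
    (lintegral_map hm (measurable_const_smul r)).symm
  rw [h, Measure.map_addHaar_smul μ hr, lintegral_smul_measure, lintegral_add_right_eq_self,
    smul_eq_mul]

/-- Change of variables: the Jacobian r⁻ᵈ is at most 2ᵈ since r ≥ 1/2, and the image of B stays in
B. -/
lemma setLIntegral_comp_smul_add_le (μ : Measure E) [μ.IsAddHaarMeasure] {G : E → ENNReal}
    (hG : Measurable G) {B : Set E} (hB : MeasurableSet B) {r : ℝ} (hr : 1 / 2 ≤ r) {c : E}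
    (hc : ∀ x ∈ B, r • x + c ∈ B) :
    ∫⁻ x in B, G (r • x + c) ∂μ ≤ 2 ^ Module.finrank ℝ E * ∫⁻ x in B, G x ∂μ := by
  have hr0 : 0 < r := by linarith
  calc ∫⁻ x in B, G (r • x + c) ∂μ = ∫⁻ x, B.indicator (fun x => G (r • x + c)) x ∂μ :=
        (lintegral_indicator hB _).symm
    _ ≤ ∫⁻ x, B.indicator G (r • x + c) ∂μ := by
        refine lintegral_mono fun x => ?_
        by_cases hx : x ∈ B
        · simp [hx, hc x hx]
        · simp [hx]
    _ = ENNReal.ofReal |(r ^ Module.finrank ℝ E)⁻¹| * ∫⁻ x, B.indicator G x ∂μ :=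
        lintegral_comp_smul_add μ (hG.indicator hB) hr0.ne' c
    _ ≤ 2 ^ Module.finrank ℝ E * ∫⁻ x in B, G x ∂μ := by
        rw [lintegral_indicator hB]
        gcongr
        rw [abs_of_pos (by positivity), ← inv_pow, ENNReal.ofReal_pow (by positivity)]
        gcongr
        rw [← ENNReal.ofReal_ofNat 2]
        apply ENNReal.ofReal_le_ofReal
        rw [inv_le_comm₀ hr0 two_pos]
        linarith

/-- The average of a function over all segments of a convex set is bounded by its integral. -/
lemma lintegral_segment_le (μ : Measure E) [μ.IsAddHaarMeasure] {G : E → ENNReal}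
    (hG : Measurable G) {B : Set E} (hB : MeasurableSet B) (hBc : Convex ℝ B) :
    ∫⁻ x in B, ∫⁻ y in B, (∫⁻ s in Set.Ioo (0 : ℝ) 1, G (y + s • (x - y))) ∂μ ∂μ ≤
      2 ^ Module.finrank ℝ E * μ B * ∫⁻ x in B, G x ∂μ := by
  have hswap : ∫⁻ x in B, ∫⁻ y in B, (∫⁻ s in Set.Ioo (0 : ℝ) 1, G (y + s • (x - y))) ∂μ ∂μ =
      ∫⁻ s in Set.Ioo (0 : ℝ) 1, (∫⁻ x in B, ∫⁻ y in B, G (y + s • (x - y)) ∂μ ∂μ) := by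
    have h1 : ∀ x, ∫⁻ y in B, (∫⁻ s in Set.Ioo (0 : ℝ) 1, G (y + s • (x - y))) ∂μ =
        ∫⁻ s in Set.Ioo (0 : ℝ) 1, (∫⁻ y in B, G (y + s • (x - y)) ∂μ) := fun x =>
      lintegral_lintegral_swap (f := fun (y : E) (s : ℝ) => G (y + s • (x - y)))
        (hG.comp (Continuous.measurable
          (by fun_prop : Continuous fun p : E × ℝ => p.1 + p.2 • (x - p.1)))).aemeasurable
    simp only [h1]
    refine lintegral_lintegral_swap (f := fun (x : E) (s : ℝ) =>
      ∫⁻ y in B, G (y + s • (x - y)) ∂μ) (Measurable.aemeasurable ?_)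
    refine Measurable.lintegral_prod_right'
        (f := fun q : (E × ℝ) × E => G (q.2 + q.1.2 • (q.1.1 - q.2))) ?_
    exact hG.comp (Continuous.measurable (by fun_prop))
  rw [hswap]
  calc _ ≤ ∫⁻ _ in Set.Ioo (0 : ℝ) 1, 2 ^ Module.finrank ℝ E * μ B * ∫⁻ x in B, G x ∂μ := by
        refine setLIntegral_mono_ae' measurableSet_Ioo (.of_forall fun s hs => ?_)
        have hmem : ∀ x ∈ B, ∀ y ∈ B, y + s • (x - y) ∈ B := fun x hx y hy =>
          hBc.add_smul_sub_mem hy hx ⟨hs.1.le, hs.2.le⟩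
        -- The point y + s(x - y) is a dilate of y by 1 - s and of x by s. Whichever ratio is at
        -- least 1/2 decides the variable to integrate first.
        rcases le_total s (1 / 2) with h | h
        · calc _ ≤ ∫⁻ x in B, 2 ^ Module.finrank ℝ E * ∫⁻ x in B, G x ∂μ ∂μ := by
                refine setLIntegral_mono_ae' hB (.of_forall fun x hx => ?_)
                have h1 : ∀ y, y + s • (x - y) = (1 - s) • y + s • x := fun y => by module
                simp only [h1]
                refine setLIntegral_comp_smul_add_le μ hG hB (by linarith) fun y hy => ?_
                rw [← h1]; exact hmem x hx y hy
            _ = _ := by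
                rw [setLIntegral_const]; ring
        · rw [lintegral_lintegral_swap (f := fun x y : E => G (y + s • (x - y))) (hG.comp (Continuous.measurable
            (by fun_prop : Continuous fun p : E × E => p.2 + s • (p.1 - p.2)))).aemeasurable]
          calc _ ≤ ∫⁻ y in B, 2 ^ Module.finrank ℝ E * ∫⁻ x in B, G x ∂μ ∂μ := by
                refine setLIntegral_mono_ae' hB (.of_forall fun y hy => ?_)
                have h1 : ∀ x, y + s • (x - y) = s • x + (1 - s) • y := fun x => by module
                simp only [h1]
                refine setLIntegral_comp_smul_add_le μ hG hB h fun x hx => ?_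
                rw [← h1]; exact hmem x hx y hy
            _ = _ := by
                rw [setLIntegral_const]; ring
    _ = _ := by simp

end LIntegral

/-! ### Approximation by affine fields on a ball -/

section Ball

variable {n : ℕ}

lemma killing_self (A : EuclideanSpace ℝ (Fin n) →L[ℝ] EuclideanSpace ℝ (Fin n))
    (v : EuclideanSpace ℝ (Fin n)) : killing A v v = 2 * inner ℝ (A v) v := by
  rw [killing]; ring

lemma measurable_ofReal_killingNormSq_fderiv
    (Z : EuclideanSpace ℝ (Fin n) → EuclideanSpace ℝ (Fin n)) :
    Measurable fun x => ENNReal.ofReal (killingNormSq (fderiv ℝ Z x)) :=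
  (continuous_killingNormSq.measurable.comp (measurable_fderiv ℝ Z)).ennreal_ofReal

/-- The fundamental theorem of calculus along the segment from y to x: the derivative of ⟨Z, x - y⟩
there is ⟨D_(x-y) Z, x - y⟩, half of the Killing tensor, so the antisymmetric part of DZ never
enters. -/
lemma enorm_inner_sub_sq_le {U : Set (EuclideanSpace ℝ (Fin n))} (hU : IsOpen U)
    (hc : Convex ℝ U) {Z : EuclideanSpace ℝ (Fin n) → EuclideanSpace ℝ (Fin n)}
    (hZ : ContDiffOn ℝ 1 Z U) {x y : EuclideanSpace ℝ (Fin n)} (hx : x ∈ U) (hy : y ∈ U) :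
    ‖(inner ℝ (Z x - Z y) (x - y) : ℝ)‖ₑ ^ 2 ≤ ENNReal.ofReal (‖x - y‖ ^ 4) *
      ∫⁻ s in Set.Ioo (0 : ℝ) 1, ENNReal.ofReal (killingNormSq (fderiv ℝ Z (y + s • (x - y)))) := by
  set g' : ℝ → ℝ := fun s => inner ℝ (fderiv ℝ Z (y + s • (x - y)) (x - y)) (x - y) with hg'
  have hmem : ∀ s ∈ Set.Icc (0 : ℝ) 1, y + s • (x - y) ∈ U := fun s hs =>
    hc.add_smul_sub_mem hy hx hs
  have hder : ∀ s ∈ Set.uIcc (0 : ℝ) 1,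
      HasDerivAt (fun s : ℝ => (inner ℝ (Z (y + s • (x - y))) (x - y) : ℝ)) (g' s) s := by
    intro s hs
    rw [Set.uIcc_of_le zero_le_one] at hs
    have h1 : HasFDerivAt Z (fderiv ℝ Z (y + s • (x - y))) (y + s • (x - y)) :=
      ((hZ.differentiableOn one_ne_zero).differentiableAt (hU.mem_nhds (hmem s hs))).hasFDerivAt
    have h2 : HasDerivAt (fun s : ℝ => y + s • (x - y)) (x - y) s := by
      simpa using ((hasDerivAt_id s).smul_const (x - y)).const_add y
    have h3 := (h1.comp_hasDerivAt s h2).inner ℝ (hasDerivAt_const s (x - y))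
    rw [inner_zero_right, zero_add] at h3
    exact h3
  have hcont : ContinuousOn g' (Set.uIcc 0 1) := by
    rw [Set.uIcc_of_le zero_le_one]
    have h1 : ContinuousOn (fderiv ℝ Z) U := hZ.continuousOn_fderiv_of_isOpen hU le_rfl
    have h2 : ContinuousOn (fun s : ℝ => fderiv ℝ Z (y + s • (x - y))) (Set.Icc 0 1) :=
      h1.comp (by fun_prop) hmem
    exact (h2.clm_apply continuousOn_const).inner continuousOn_const
  have hint := intervalIntegral.integral_eq_sub_of_hasDerivAt hder hcont.intervalIntegrable
  have heq : (inner ℝ (Z x - Z y) (x - y) : ℝ) = ∫ s in Set.Ioo (0 : ℝ) 1, g' s := by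
    rw [← integral_Ioc_eq_integral_Ioo, ← intervalIntegral.integral_of_le zero_le_one, hint]
    simp [inner_sub_left]
  have hmeas : AEMeasurable (fun s => ‖g' s‖ₑ) (volume.restrict (Set.Ioo (0 : ℝ) 1)) := by
    rw [Set.uIcc_of_le zero_le_one] at hcont
    exact ((hcont.mono Set.Ioo_subset_Icc_self).aestronglyMeasurable measurableSet_Ioo).enorm
  calc ‖(inner ℝ (Z x - Z y) (x - y) : ℝ)‖ₑ ^ 2
      ≤ (∫⁻ s in Set.Ioo (0 : ℝ) 1, ‖g' s‖ₑ) ^ 2 := by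
        rw [heq]
        gcongr
        exact enorm_integral_le_lintegral_enorm _
    _ ≤ ∫⁻ s in Set.Ioo (0 : ℝ) 1, ‖g' s‖ₑ ^ 2 := by
        refine (lintegral_sq_le _ hmeas).trans_eq ?_
        simp
    _ ≤ ∫⁻ s in Set.Ioo (0 : ℝ) 1, ENNReal.ofReal (‖x - y‖ ^ 4) *
          ENNReal.ofReal (killingNormSq (fderiv ℝ Z (y + s • (x - y)))) := by
        refine lintegral_mono fun s => ?_
        rw [← ofReal_norm, ← ENNReal.ofReal_pow (norm_nonneg _),
          ← ENNReal.ofReal_mul (by positivity)]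
        apply ENNReal.ofReal_le_ofReal
        have h := killing_sq_le (fderiv ℝ Z (y + s • (x - y))) (x - y) (x - y)
        rw [killing_self] at h
        rw [Real.norm_eq_abs, sq_abs]
        change (inner ℝ (fderiv ℝ Z (y + s • (x - y)) (x - y)) (x - y) : ℝ) ^ 2 ≤ _
        nlinarith [sq_nonneg (inner ℝ (fderiv ℝ Z (y + s • (x - y)) (x - y)) (x - y) : ℝ)]
    _ = _ := by
        rw [lintegral_const_mul]
        exact (measurable_ofReal_killingNormSq_fderiv Z).comp
          (Continuous.measurable (by fun_prop))

/-- Testing a linear function against a derivative of a bump of mass one reads off a component. This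
is how Z x is extracted from ⟨Z x - Z y, x - y⟩. -/
lemma integral_fderiv_mul_inner {η : EuclideanSpace ℝ (Fin n) → ℝ} (hη : ContDiff ℝ 1 η)
    (hc : HasCompactSupport η) (hη1 : ∫ x, η x = 1) (z w : EuclideanSpace ℝ (Fin n)) :
    ∫ y, fderiv ℝ η y w * inner ℝ z y = - inner ℝ z w := by
  have hd : Continuous fun x => fderiv ℝ η x w := (hη.continuous_fderiv one_ne_zero).clm_apply
    continuous_const
  have hf : ∀ y, fderiv ℝ (fun y => (inner ℝ z y : ℝ)) y w = inner ℝ z w := fun y => by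
    have := (innerSL ℝ z).hasFDerivAt (x := y)
    have h2 : fderiv ℝ (fun y => (inner ℝ z y : ℝ)) y = innerSL ℝ z := this.fderiv
    rw [h2, innerSL_apply_apply]
  have h1 : Integrable fun y => fderiv ℝ η y w * inner ℝ z y :=
    (hd.mul (by fun_prop)).integrable_of_hasCompactSupport (hc.fderiv_apply ℝ w).mul_right
  have h2 : Integrable η := hη.continuous.integrable_of_hasCompactSupport hc
  have h3 : Integrable fun y => η y * inner ℝ z y :=
    (hη.continuous.mul (by fun_prop)).integrable_of_hasCompactSupport hc.mul_right
  have h := integral_mul_fderiv_eq_neg_fderiv_mul_of_integrable (μ := volume) (f := η)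
    (g := fun y => (inner ℝ z y : ℝ)) (v := w) h1 (by simpa only [hf] using h2.mul_const _) h3
    (fun x _ => (hη.differentiable one_ne_zero) x)
    (fun x _ => (innerSL ℝ z).differentiableAt)
  simp only [hf, integral_mul_const, hη1, one_mul] at h
  rw [h, neg_neg]

/-- On a ball a vector field is, up to an affine field, controlled in `L²` by its Killing tensor. -/
lemma exists_affine_approx_ball (x₀ : EuclideanSpace ℝ (Fin n)) {δ : ℝ} (hδ : 0 < δ) :
    ∃ C : NNReal, ∀ Z : EuclideanSpace ℝ (Fin n) → EuclideanSpace ℝ (Fin n),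
      ContDiffOn ℝ 1 Z (Metric.ball x₀ δ) →
      ∃ (a : EuclideanSpace ℝ (Fin n))
        (B : EuclideanSpace ℝ (Fin n) →L[ℝ] EuclideanSpace ℝ (Fin n)),
        ∫⁻ x in Metric.ball x₀ δ, ‖Z x - (a + B x)‖ₑ ^ 2 ≤
          C * ∫⁻ x in Metric.ball x₀ δ, ENNReal.ofReal (killingNormSq (fderiv ℝ Z x)) := by
  set U := Metric.ball x₀ δ with hU
  let b : ContDiffBump x₀ := ⟨δ / 4, δ / 2, by positivity, by linarith⟩
  set η : EuclideanSpace ℝ (Fin n) → ℝ := b.normed volume with hη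
  have hηs : ContDiff ℝ 1 η := b.contDiff_normed (n := 1)
  have hηc : HasCompactSupport η := b.hasCompactSupport_normed
  have hη1 : ∫ x, η x = 1 := b.integral_normed
  have hηsub : tsupport η ⊆ U := by
    rw [hη, b.tsupport_normed_eq]
    exact Metric.closedBall_subset_ball (by change δ / 2 < δ; linarith)
  set ηd : Fin n → EuclideanSpace ℝ (Fin n) → ℝ := fun i y =>
    fderiv ℝ η y (EuclideanSpace.single i 1) with hηd
  have hdc : ∀ i, Continuous (ηd i) := fun i =>
    (hηs.continuous_fderiv one_ne_zero).clm_apply continuous_const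
  have hdcs : ∀ i, HasCompactSupport (ηd i) := fun i => hηc.fderiv_apply ℝ _
  have hdsub : ∀ i, tsupport (ηd i) ⊆ U := fun i =>
    (tsupport_fderiv_apply_subset ℝ _).trans hηsub
  obtain ⟨M, hM⟩ : ∃ M : ℝ, ∀ i y, |ηd i y| ≤ M := by
    have : ∀ i, ∃ M : ℝ, ∀ y, ‖ηd i y‖ ≤ M := fun i =>
      (hdcs i).exists_bound_of_continuous (hdc i)
    choose M hM using this
    refine ⟨∑ i, |M i|, fun i y => (hM i y).trans ((le_abs_self _).trans ?_)⟩
    exact Finset.single_le_sum (f := fun i => |M i|) (fun _ _ => abs_nonneg _) (Finset.mem_univ i)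
  have hvol : volume U ≠ ⊤ := measure_ball_lt_top.ne
  set c : ENNReal := ENNReal.ofReal (M ^ 2) * volume U * ENNReal.ofReal ((2 * δ) ^ 4) *
    (2 ^ n * volume U) with hcdef
  have hctop : c ≠ ⊤ := by
    simp only [hcdef]
    finiteness
  refine ⟨(n * c).toNNReal, fun Z hZ => ?_⟩
  rw [ENNReal.coe_toNNReal (by finiteness)]
  -- Z is only known to be continuous on the ball, but near any point outside the support of `ηd i`
  -- the product vanishes identically.
  have hZint : ∀ i, Integrable fun y => ηd i y • Z y := by
    intro i
    have hcont : Continuous fun y => ηd i y • Z y := by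
      rw [continuous_iff_continuousAt]
      intro y
      by_cases hy : y ∈ tsupport (ηd i)
      · exact (hdc i).continuousAt.smul
          (hZ.continuousOn.continuousAt (Metric.isOpen_ball.mem_nhds (hdsub i hy)))
      · have : (fun y => ηd i y • Z y) =ᶠ[𝓝 y] fun _ => 0 := by
          filter_upwards [(isClosed_tsupport (ηd i)).isOpen_compl.mem_nhds hy] with z hz
          rw [image_eq_zero_of_notMem_tsupport hz, zero_smul]
        exact continuousAt_const.congr this.symm
    exact hcont.integrable_of_hasCompactSupport (hdcs i).smul_right
  have hZint2 : ∀ i, Integrable fun y => ηd i y * inner ℝ (Z y) y := by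
    intro i
    have hcont : Continuous fun y => ηd i y * inner ℝ (Z y) y := by
      rw [continuous_iff_continuousAt]
      intro y
      by_cases hy : y ∈ tsupport (ηd i)
      · exact (hdc i).continuousAt.mul
          ((hZ.continuousOn.continuousAt (Metric.isOpen_ball.mem_nhds (hdsub i hy))).inner
            continuousAt_id)
      · have : (fun y => ηd i y * inner ℝ (Z y) y) =ᶠ[𝓝 y] fun _ => 0 := by
          filter_upwards [(isClosed_tsupport (ηd i)).isOpen_compl.mem_nhds hy] with z hz
          rw [image_eq_zero_of_notMem_tsupport hz, zero_mul]
        exact continuousAt_const.congr this.symm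
    exact hcont.integrable_of_hasCompactSupport (hdcs i).mul_right
  -- Expand ∫ ∂ᵢη(y) ⟨Z x - Z y, x - y⟩ dy: the ⟨Z x, x⟩ term drops out because ∂ᵢη has mean zero,
  -- the ⟨Z x, y⟩ term gives the i-th component of Z x, and the two remaining terms are affine in x.
  -- They define the witness, up to sign.
  refine ⟨-∑ i, (∫ y, ηd i y * inner ℝ (Z y) y) • EuclideanSpace.single i (1 : ℝ),
    ∑ i, (innerSL ℝ (∫ y, ηd i y • Z y)).smulRight (EuclideanSpace.single i (1 : ℝ)), ?_⟩
  have hcomp : ∀ x i, (Z x - (-∑ i, (∫ y, ηd i y * inner ℝ (Z y) y) •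
      EuclideanSpace.single i (1 : ℝ) +
      (∑ i, (innerSL ℝ (∫ y, ηd i y • Z y)).smulRight (EuclideanSpace.single i (1 : ℝ))) x)) i =
      ∫ y, ηd i y * inner ℝ (Z x - Z y) (x - y) := by
    intro x i
    have e1 : ∫ y, ηd i y * inner ℝ (Z x - Z y) (x - y) =
        (∫ y, ηd i y) * inner ℝ (Z x) x - (∫ y, ηd i y * inner ℝ (Z x) y)
          - inner ℝ (∫ y, ηd i y • Z y) x + ∫ y, ηd i y * inner ℝ (Z y) y := by
      have i1 : Integrable fun y => ηd i y * inner ℝ (Z x) x :=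
        ((hdc i).integrable_of_hasCompactSupport (hdcs i)).mul_const _
      have i2 : Integrable fun y => ηd i y * inner ℝ (Z x) y :=
        ((hdc i).mul (by fun_prop)).integrable_of_hasCompactSupport (hdcs i).mul_right
      have i3 : Integrable fun y => inner ℝ x (ηd i y • Z y) := (hZint i).const_inner x
      rw [real_inner_comm x (∫ y, ηd i y • Z y), ← integral_inner (hZint i), ← integral_mul_const,
        ← integral_sub i1 i2, ← integral_sub (by exact i1.sub i2) i3,
        ← integral_add (by exact (i1.sub i2).sub i3) (hZint2 i)]
      refine integral_congr_ae (.of_forall fun y => ?_)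
      simp only [inner_sub_left, inner_sub_right, real_inner_smul_right,
        real_inner_comm x (Z y)]
      ring
    rw [e1, integral_fderiv_eq_zero_of_hasCompactSupport volume hηs hηc,
      integral_fderiv_mul_inner hηs hηc hη1, inner_single_one]
    simp only [PiLp.sub_apply, PiLp.add_apply, PiLp.neg_apply, WithLp.ofLp_sum, Finset.sum_apply,
      PiLp.smul_apply, smul_eq_mul, sum_apply,
      ContinuousLinearMap.smulRight_apply, innerSL_apply_apply, PiLp.single_apply]
    simp
    ring
  set R : EuclideanSpace ℝ (Fin n) → EuclideanSpace ℝ (Fin n) := fun x =>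
    Z x - (-∑ i, (∫ y, ηd i y * inner ℝ (Z y) y) • EuclideanSpace.single i (1 : ℝ) +
      (∑ i, (innerSL ℝ (∫ y, ηd i y • Z y)).smulRight (EuclideanSpace.single i (1 : ℝ))) x) with hR
  have hpt : ∀ x ∈ U, ∀ i, ‖R x i‖ₑ ^ 2 ≤ ENNReal.ofReal (M ^ 2) * volume U *
      ENNReal.ofReal ((2 * δ) ^ 4) * ∫⁻ y in U, ∫⁻ s in Set.Ioo (0 : ℝ) 1,
        ENNReal.ofReal (killingNormSq (fderiv ℝ Z (y + s • (x - y)))) := by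
    intro x hx i
    have hmeas : AEMeasurable (fun y => ‖ηd i y * inner ℝ (Z x - Z y) (x - y)‖ₑ)
        (volume.restrict U) := by
      refine (ContinuousOn.aestronglyMeasurable ?_ Metric.isOpen_ball.measurableSet).enorm
      exact (hdc i).continuousOn.mul ((continuousOn_const.sub hZ.continuousOn).inner (by fun_prop))
    have hsupp : ∫ y, ηd i y * inner ℝ (Z x - Z y) (x - y) =
        ∫ y in U, ηd i y * inner ℝ (Z x - Z y) (x - y) := by
      refine (setIntegral_eq_integral_of_forall_compl_eq_zero fun y hy => ?_).symm
      rw [image_eq_zero_of_notMem_tsupport (fun h => hy (hdsub i h)), zero_mul]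
    calc ‖R x i‖ₑ ^ 2 ≤ (∫⁻ y in U, ‖ηd i y * inner ℝ (Z x - Z y) (x - y)‖ₑ) ^ 2 := by
          rw [hR, hcomp x i, hsupp]
          gcongr
          exact enorm_integral_le_lintegral_enorm _
      _ ≤ volume U * ∫⁻ y in U, ‖ηd i y * inner ℝ (Z x - Z y) (x - y)‖ₑ ^ 2 := by
          refine (lintegral_sq_le _ hmeas).trans_eq ?_
          simp
      _ ≤ volume U * ∫⁻ y in U, ENNReal.ofReal (M ^ 2) * ENNReal.ofReal ((2 * δ) ^ 4) *
            ∫⁻ s in Set.Ioo (0 : ℝ) 1,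
              ENNReal.ofReal (killingNormSq (fderiv ℝ Z (y + s • (x - y)))) := by
          gcongr volume U * ?_
          refine setLIntegral_mono_ae' Metric.isOpen_ball.measurableSet
            (.of_forall fun y hy => ?_)
          rw [enorm_mul, mul_pow, mul_assoc]
          gcongr ?_ * ?_
          · rw [← ofReal_norm, ← ENNReal.ofReal_pow (norm_nonneg _), Real.norm_eq_abs]
            exact ENNReal.ofReal_le_ofReal (pow_le_pow_left₀ (abs_nonneg _) (hM i y) 2)
          · refine (enorm_inner_sub_sq_le Metric.isOpen_ball (convex_ball x₀ δ) hZ hx hy).trans ?_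
            gcongr
            have h1 : dist x x₀ < δ := hx
            have h2 : dist y x₀ < δ := hy
            have h3 := dist_triangle_right x y x₀
            rw [dist_eq_norm] at h3
            linarith
      _ = _ := by
          rw [lintegral_const_mul' _ _ (by finiteness)]
          ring
  have hsumsq : ∀ x, ‖R x‖ₑ ^ 2 = ∑ i, ‖R x i‖ₑ ^ 2 := by
    intro x
    simp only [← ofReal_norm, ← ENNReal.ofReal_pow (norm_nonneg _)]
    rw [← ENNReal.ofReal_sum_of_nonneg (fun _ _ => by positivity), EuclideanSpace.norm_sq_eq]
  calc ∫⁻ x in U, ‖R x‖ₑ ^ 2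
      ≤ ∫⁻ x in U, n * (ENNReal.ofReal (M ^ 2) * volume U *
      ENNReal.ofReal ((2 * δ) ^ 4) * ∫⁻ y in U, ∫⁻ s in Set.Ioo (0 : ℝ) 1,
        ENNReal.ofReal (killingNormSq (fderiv ℝ Z (y + s • (x - y))))) := by
        refine setLIntegral_mono_ae' Metric.isOpen_ball.measurableSet
            (.of_forall fun x hx => ?_)
        rw [hsumsq]
        refine (Finset.sum_le_sum fun i _ => hpt x hx i).trans_eq ?_
        simp
    _ = n * (ENNReal.ofReal (M ^ 2) * volume U * ENNReal.ofReal ((2 * δ) ^ 4)) *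
        ∫⁻ x in U, ∫⁻ y in U, ∫⁻ s in Set.Ioo (0 : ℝ) 1,
          ENNReal.ofReal (killingNormSq (fderiv ℝ Z (y + s • (x - y)))) := by
        simp only [← mul_assoc]
        rw [lintegral_const_mul' _ _ (by finiteness)]
    _ ≤ n * (ENNReal.ofReal (M ^ 2) * volume U * ENNReal.ofReal ((2 * δ) ^ 4)) *
        (2 ^ n * volume U * ∫⁻ x in U, ENNReal.ofReal (killingNormSq (fderiv ℝ Z x))) := by
        gcongr
        have := lintegral_segment_le volume (measurable_ofReal_killingNormSq_fderiv Z)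
          (Metric.isOpen_ball (x := x₀) (ε := δ)).measurableSet (convex_ball x₀ δ)
        rwa [finrank_euclideanSpace_fin] at this
    _ = _ := by rw [hcdef]; ring

end Ball

/-! ### Comparison of L² norms of affine fields -/

section Affine

variable {n : ℕ}

lemma enorm_add_sq_le {F : Type*} [SeminormedAddCommGroup F] (u v : F) :
    ‖u + v‖ₑ ^ 2 ≤ 2 * ‖u‖ₑ ^ 2 + 2 * ‖v‖ₑ ^ 2 := by
  have h : ‖u + v‖ ^ 2 ≤ 2 * ‖u‖ ^ 2 + 2 * ‖v‖ ^ 2 := by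
    nlinarith [norm_add_le u v, norm_nonneg (u + v), sq_nonneg (‖u‖ - ‖v‖), norm_nonneg u,
      norm_nonneg v]
  have h2 := ENNReal.ofReal_le_ofReal h
  rwa [ENNReal.ofReal_add (by positivity) (by positivity), ENNReal.ofReal_mul (by positivity),
    ENNReal.ofReal_mul (by positivity), ENNReal.ofReal_ofNat, ENNReal.ofReal_pow (norm_nonneg _),
    ENNReal.ofReal_pow (norm_nonneg _), ENNReal.ofReal_pow (norm_nonneg _), ofReal_norm,
    ofReal_norm, ofReal_norm] at h2

lemma exists_lintegral_affine_le {P : Set (EuclideanSpace ℝ (Fin n))}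
    (hP : Bornology.IsBounded P) :
    ∃ C : NNReal, ∀ (a : EuclideanSpace ℝ (Fin n))
      (B : EuclideanSpace ℝ (Fin n) →L[ℝ] EuclideanSpace ℝ (Fin n)),
      ∫⁻ x in P, ‖a + B x‖ₑ ^ 2 ≤ C * ‖(a, B)‖ₑ ^ 2 := by
  obtain ⟨R, hR, hPR⟩ : ∃ R : ℝ, 0 < R ∧ P ⊆ Metric.closedBall 0 R := by
    obtain ⟨R, hR⟩ := hP.subset_closedBall 0
    exact ⟨max R 1, by positivity, hR.trans (Metric.closedBall_subset_closedBall (le_max_left _ _))⟩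
  have hv : volume (Metric.closedBall (0 : EuclideanSpace ℝ (Fin n)) R) ≠ ⊤ :=
    measure_closedBall_lt_top.ne
  refine ⟨(ENNReal.ofReal ((1 + R) ^ 2) *
    volume (Metric.closedBall (0 : EuclideanSpace ℝ (Fin n)) R)).toNNReal, fun a B => ?_⟩
  rw [ENNReal.coe_toNNReal (by finiteness)]
  calc ∫⁻ x in P, ‖a + B x‖ₑ ^ 2 ≤ ∫⁻ x in Metric.closedBall 0 R, ‖a + B x‖ₑ ^ 2 :=
        lintegral_mono_set hPR
    _ ≤ ∫⁻ x in Metric.closedBall (0 : EuclideanSpace ℝ (Fin n)) R,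
          ENNReal.ofReal ((1 + R) ^ 2) * ‖(a, B)‖ₑ ^ 2 := by
        refine setLIntegral_mono_ae' Metric.isClosed_closedBall.measurableSet
          (.of_forall fun x hx => ?_)
        have hx' : ‖x‖ ≤ R := by simpa using hx
        rw [← ofReal_norm, ← ofReal_norm, ← ENNReal.ofReal_pow (norm_nonneg _),
          ← ENNReal.ofReal_pow (norm_nonneg _), ← ENNReal.ofReal_mul (by positivity), ← mul_pow]
        apply ENNReal.ofReal_le_ofReal
        gcongr
        have h1 : ‖a‖ ≤ ‖(a, B)‖ := norm_fst_le (a, B)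
        have h2 : ‖B‖ ≤ ‖(a, B)‖ := norm_snd_le (a, B)
        calc ‖a + B x‖ ≤ ‖a‖ + ‖B‖ * ‖x‖ := (norm_add_le _ _).trans (by gcongr; exact B.le_opNorm x)
          _ ≤ ‖(a, B)‖ + ‖(a, B)‖ * R := by gcongr
          _ = (1 + R) * ‖(a, B)‖ := by ring
    _ = _ := by rw [setLIntegral_const]; ring

/-- The integral over a closed ball in V is continuous, homogeneous of degree two in (a, B), and
positive for (a, B) ≠ 0, since an affine field vanishing on a ball is zero. It therefore has a
positive lower bound on the unit sphere of the finite-dimensional space of pairs. -/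
lemma exists_affine_le_lintegral {V : Set (EuclideanSpace ℝ (Fin n))}
    (hV : IsOpen V) (hne : V.Nonempty) :
    ∃ C : NNReal, ∀ (a : EuclideanSpace ℝ (Fin n))
      (B : EuclideanSpace ℝ (Fin n) →L[ℝ] EuclideanSpace ℝ (Fin n)),
      ‖(a, B)‖ₑ ^ 2 ≤ C * ∫⁻ x in V, ‖a + B x‖ₑ ^ 2 := by
  obtain ⟨x₀, hx₀⟩ := hne
  obtain ⟨δ, hδ, hball⟩ := Metric.nhds_basis_closedBall.mem_iff.1 (hV.mem_nhds hx₀)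
  set S := Metric.closedBall x₀ δ
  have hS : IsCompact S := isCompact_closedBall x₀ δ
  let F : EuclideanSpace ℝ (Fin n) × (EuclideanSpace ℝ (Fin n) →L[ℝ] EuclideanSpace ℝ (Fin n)) → ℝ :=
    fun p => ∫ x in S, ‖p.1 + p.2 x‖ ^ 2
  have hF : Continuous F := continuous_parametric_integral_of_continuous
    (f := fun (p : EuclideanSpace ℝ (Fin n) ×
      (EuclideanSpace ℝ (Fin n) →L[ℝ] EuclideanSpace ℝ (Fin n))) x => ‖p.1 + p.2 x‖ ^ 2)
    (by fun_prop) hS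
  have hint : ∀ p : EuclideanSpace ℝ (Fin n) ×
      (EuclideanSpace ℝ (Fin n) →L[ℝ] EuclideanSpace ℝ (Fin n)),
      IntegrableOn (fun x => ‖p.1 + p.2 x‖ ^ 2) S := fun p =>
    (Continuous.continuousOn (by fun_prop)).integrableOn_compact hS
  have hpos : ∀ p, p ≠ 0 → 0 < F p := by
    intro p hp
    have hcont : Continuous fun x => ‖p.1 + p.2 x‖ ^ 2 := by fun_prop
    rw [setIntegral_pos_iff_support_of_nonneg_ae (.of_forall fun x => by positivity) (hint p)]
    have hopen : IsOpen (Function.support fun x => ‖p.1 + p.2 x‖ ^ 2) := hcont.isOpen_support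
    have hne : ((Function.support fun x => ‖p.1 + p.2 x‖ ^ 2) ∩ Metric.ball x₀ δ).Nonempty := by
      by_contra hcon
      rw [Set.not_nonempty_iff_eq_empty] at hcon
      have hz : ∀ x ∈ Metric.ball x₀ δ, p.1 + p.2 x = 0 := by
        intro x hx
        by_contra h
        have : x ∈ (Function.support fun x => ‖p.1 + p.2 x‖ ^ 2) ∩ Metric.ball x₀ δ :=
          ⟨by simpa using h, hx⟩
        rw [hcon] at this
        exact this
      have h0 := hz x₀ (Metric.mem_ball_self hδ)
      have hB : p.2 = 0 := by
        ext1 v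
        by_cases hv : v = 0
        · simp [hv]
        have hvn : 0 < ‖v‖ := norm_pos_iff.2 hv
        have h1 := hz (x₀ + (δ / (2 * ‖v‖)) • v) (by
          rw [Metric.mem_ball, dist_eq_norm, add_sub_cancel_left, norm_smul, Real.norm_eq_abs,
            abs_of_pos (by positivity)]
          field_simp
          linarith)
        rw [map_add, ← add_assoc, h0, zero_add, map_smul] at h1
        simpa [hδ.ne', hvn.ne'] using h1
      have ha : p.1 = 0 := by simpa [hB] using h0
      exact hp (Prod.ext ha hB)
    exact ((hopen.inter Metric.isOpen_ball).measure_pos volume hne).trans_le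
      (measure_mono (Set.inter_subset_inter_right _ Metric.ball_subset_closedBall))
  obtain ⟨c, hc, hcF⟩ : ∃ c : ℝ, 0 < c ∧ ∀ p, ‖p‖ = 1 → c ≤ F p := by
    -- The sphere is empty in dimension zero, where any positive constant serves.
    rcases (Metric.sphere (0 : EuclideanSpace ℝ (Fin n) ×
        (EuclideanSpace ℝ (Fin n) →L[ℝ] EuclideanSpace ℝ (Fin n))) 1).eq_empty_or_nonempty
        with h | h
    · refine ⟨1, one_pos, fun p hp => ?_⟩
      have : p ∈ Metric.sphere (0 : EuclideanSpace ℝ (Fin n) ×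
        (EuclideanSpace ℝ (Fin n) →L[ℝ] EuclideanSpace ℝ (Fin n))) 1 := by simpa using hp
      rw [h] at this
      exact this.elim
    · obtain ⟨p, hp, hmin⟩ := (isCompact_sphere _ 1).exists_isMinOn h hF.continuousOn
      refine ⟨F p, hpos p ?_, fun q hq => hmin (by simpa using hq)⟩
      rintro rfl
      simp at hp
  refine ⟨(Real.toNNReal c⁻¹), fun a B => ?_⟩
  have key : c * ‖(a, B)‖ ^ 2 ≤ ∫ x in S, ‖a + B x‖ ^ 2 := by
    by_cases h0 : (a, B) = 0
    · rw [h0, norm_zero]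
      have : 0 ≤ ∫ x in S, ‖a + B x‖ ^ 2 := integral_nonneg fun x => by positivity
      simpa using this
    · have hn : 0 < ‖(a, B)‖ := norm_pos_iff.2 h0
      have h1 := hcF (‖(a, B)‖⁻¹ • (a, B)) (by
        rw [norm_smul, norm_inv, norm_norm, inv_mul_cancel₀ hn.ne'])
      have h2 : F (‖(a, B)‖⁻¹ • (a, B)) = (‖(a, B)‖⁻¹) ^ 2 * ∫ x in S, ‖a + B x‖ ^ 2 := by
        simp only [F]
        rw [← integral_const_mul]
        refine integral_congr_ae (.of_forall fun x => ?_)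
        simp only [Prod.smul_fst, Prod.smul_snd, smul_apply, ← smul_add]
        rw [norm_smul, mul_pow, norm_inv, norm_norm]
      rw [h2, inv_pow, inv_mul_eq_div, le_div_iff₀ (by positivity)] at h1
      exact h1
  have h3 : ∫⁻ x in S, ‖a + B x‖ₑ ^ 2 = ENNReal.ofReal (∫ x in S, ‖a + B x‖ ^ 2) := by
    rw [ofReal_integral_eq_lintegral_ofReal (hint (a, B)) (.of_forall fun x => by positivity)]
    simp only [ENNReal.ofReal_pow (norm_nonneg _), ofReal_norm]
  calc ‖(a, B)‖ₑ ^ 2 = ENNReal.ofReal (‖(a, B)‖ ^ 2) := by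
        rw [ENNReal.ofReal_pow (norm_nonneg _), ofReal_norm]
    _ ≤ ENNReal.ofReal (c⁻¹ * ∫ x in S, ‖a + B x‖ ^ 2) := by
        apply ENNReal.ofReal_le_ofReal
        rw [inv_mul_eq_div, le_div_iff₀ hc]
        linarith
    _ = (Real.toNNReal c⁻¹) * ∫⁻ x in S, ‖a + B x‖ₑ ^ 2 := by
        rw [ENNReal.ofReal_mul (by positivity), h3]; rfl
    _ ≤ _ := by gcongr

/-- Integrals of squared affine fields over bounded sets are comparable, uniformly under dilations. -/
lemma exists_lintegral_affine_comparison {P V : Set (EuclideanSpace ℝ (Fin n))}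
    (hP : Bornology.IsBounded P) (hV : IsOpen V) (hne : V.Nonempty) :
    ∃ C : NNReal, ∀ (t : ℝ), 1 ≤ t → ∀ (a : EuclideanSpace ℝ (Fin n))
      (B : EuclideanSpace ℝ (Fin n) →L[ℝ] EuclideanSpace ℝ (Fin n)),
      ∫⁻ x in P, ‖a + B x‖ₑ ^ 2 ≤ C * ∫⁻ x in V, ‖a + B (t • x)‖ₑ ^ 2 := by
  obtain ⟨C₁, h₁⟩ := exists_lintegral_affine_le hP
  obtain ⟨C₂, h₂⟩ := exists_affine_le_lintegral hV hne
  refine ⟨C₁ * C₂, fun t ht a B => ?_⟩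
  -- Dilating by t ≥ 1 only enlarges the linear part; this is why the constant does not depend on t.
  have h : ‖(a, B)‖ₑ ≤ ‖(a, t • B)‖ₑ := by
    rw [← ofReal_norm, ← ofReal_norm]
    apply ENNReal.ofReal_le_ofReal
    rw [Prod.norm_def, Prod.norm_def]
    apply max_le_max le_rfl
    simp only [norm_smul, Real.norm_eq_abs, abs_of_pos (zero_lt_one.trans_le ht)]
    exact le_mul_of_one_le_left (norm_nonneg _) ht
  calc ∫⁻ x in P, ‖a + B x‖ₑ ^ 2 ≤ C₁ * ‖(a, B)‖ₑ ^ 2 := h₁ a B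
    _ ≤ C₁ * ‖(a, t • B)‖ₑ ^ 2 := by gcongr
    _ ≤ C₁ * (C₂ * ∫⁻ x in V, ‖a + (t • B) x‖ₑ ^ 2) := by gcongr; exact h₂ a (t • B)
    _ = _ := by
        rw [← mul_assoc]
        simp only [smul_apply, map_smul, ENNReal.coe_mul]

end Affine

/-! ### Chaining affine approximations along a connected open set -/

section Chain

variable {n : ℕ}

/-- On `P`, fields of class `C¹` in `W` are controlled up to affine fields by the Killing tensor
on a compact subset of `W`. -/
def HasAffineApprox (W P : Set (EuclideanSpace ℝ (Fin n))) : Prop :=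
  ∃ (C : NNReal) (Q : Set (EuclideanSpace ℝ (Fin n))), IsCompact Q ∧ Q ⊆ W ∧
    ∀ Z : EuclideanSpace ℝ (Fin n) → EuclideanSpace ℝ (Fin n), ContDiffOn ℝ 1 Z W →
      ∃ (a : EuclideanSpace ℝ (Fin n))
        (B : EuclideanSpace ℝ (Fin n) →L[ℝ] EuclideanSpace ℝ (Fin n)),
        ∫⁻ x in P, ‖Z x - (a + B x)‖ₑ ^ 2 ≤
          C * ∫⁻ x in Q, ENNReal.ofReal (killingNormSq (fderiv ℝ Z x))

lemma HasAffineApprox.mono {W P P' : Set (EuclideanSpace ℝ (Fin n))} (h : HasAffineApprox W P)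
    (hP : P' ⊆ P) : HasAffineApprox W P' := by
  obtain ⟨C, Q, hQ, hQW, hC⟩ := h
  refine ⟨C, Q, hQ, hQW, fun Z hZ => ?_⟩
  obtain ⟨a, B, hab⟩ := hC Z hZ
  exact ⟨a, B, (lintegral_mono_set hP).trans hab⟩

lemma hasAffineApprox_ball {W : Set (EuclideanSpace ℝ (Fin n))} {x : EuclideanSpace ℝ (Fin n)}
    {δ : ℝ} (hδ : 0 < δ) (h : Metric.closedBall x δ ⊆ W) :
    HasAffineApprox W (Metric.ball x δ) := by
  obtain ⟨C, hC⟩ := exists_affine_approx_ball x hδ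
  refine ⟨C, _, isCompact_closedBall x δ, h, fun Z hZ => ?_⟩
  obtain ⟨a, B, hab⟩ := hC Z (hZ.mono (Metric.ball_subset_closedBall.trans h))
  exact ⟨a, B, hab.trans (by gcongr; exact Metric.ball_subset_closedBall)⟩

/-- On the overlap V both affine fields are close to Z, hence to each other. Affine fields being
determined by their values on V, they are then close on P₂ as well, and the first field serves for
the union. -/
lemma HasAffineApprox.union {W P₁ P₂ V : Set (EuclideanSpace ℝ (Fin n))}
    (h₁ : HasAffineApprox W P₁) (h₂ : HasAffineApprox W P₂) (hb : Bornology.IsBounded P₂)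
    (hV : IsOpen V) (hne : V.Nonempty) (hV₁ : V ⊆ P₁) (hV₂ : V ⊆ P₂) (hVW : V ⊆ W) :
    HasAffineApprox W (P₁ ∪ P₂) := by
  obtain ⟨C₁, Q₁, hQ₁, hQW₁, h₁⟩ := h₁
  obtain ⟨C₂, Q₂, hQ₂, hQW₂, h₂⟩ := h₂
  obtain ⟨C, hC⟩ := exists_lintegral_affine_comparison hb hV hne
  refine ⟨C₁ + (2 * C₂ + 2 * C * (2 * C₁ + 2 * C₂)), Q₁ ∪ Q₂, hQ₁.union hQ₂,
    Set.union_subset hQW₁ hQW₂, fun Z hZ => ?_⟩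
  obtain ⟨a₁, B₁, k₁⟩ := h₁ Z hZ
  obtain ⟨a₂, B₂, k₂⟩ := h₂ Z hZ
  refine ⟨a₁, B₁, ?_⟩
  set D := ∫⁻ x in Q₁ ∪ Q₂, ENNReal.ofReal (killingNormSq (fderiv ℝ Z x))
  replace k₁ : ∫⁻ x in P₁, ‖Z x - (a₁ + B₁ x)‖ₑ ^ 2 ≤ C₁ * D :=
    k₁.trans (by gcongr C₁ * ?_; exact lintegral_mono_set Set.subset_union_left)
  replace k₂ : ∫⁻ x in P₂, ‖Z x - (a₂ + B₂ x)‖ₑ ^ 2 ≤ C₂ * D :=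
    k₂.trans (by gcongr C₂ * ?_; exact lintegral_mono_set Set.subset_union_right)
  have hV' : ∫⁻ x in V, ‖(a₂ - a₁) + (B₂ - B₁) x‖ₑ ^ 2 ≤ (2 * C₁ + 2 * C₂) * D := by
    have hm : AEMeasurable (fun x => 2 * ‖Z x - (a₁ + B₁ x)‖ₑ ^ 2) (volume.restrict V) := by
      have hc : ContinuousOn (fun x => Z x - (a₁ + B₁ x)) V :=
        (hZ.continuousOn.mono hVW).sub (by fun_prop)
      exact ((hc.aestronglyMeasurable hV.measurableSet).enorm.pow_const 2).const_mul 2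
    calc ∫⁻ x in V, ‖(a₂ - a₁) + (B₂ - B₁) x‖ₑ ^ 2
        ≤ ∫⁻ x in V, (2 * ‖Z x - (a₁ + B₁ x)‖ₑ ^ 2 + 2 * ‖Z x - (a₂ + B₂ x)‖ₑ ^ 2) := by
          refine lintegral_mono fun x => ?_
          have e : (a₂ - a₁) + (B₂ - B₁) x = (Z x - (a₁ + B₁ x)) + -(Z x - (a₂ + B₂ x)) := by
            rw [sub_apply]; abel
          rw [e]
          refine (enorm_add_sq_le _ _).trans_eq ?_
          rw [enorm_neg]
      _ = 2 * (∫⁻ x in V, ‖Z x - (a₁ + B₁ x)‖ₑ ^ 2) + 2 * ∫⁻ x in V, ‖Z x - (a₂ + B₂ x)‖ₑ ^ 2 := by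
          rw [lintegral_add_left' hm, lintegral_const_mul' _ _ (by finiteness),
            lintegral_const_mul' _ _ (by finiteness)]
      _ ≤ 2 * (C₁ * D) + 2 * (C₂ * D) := by
          gcongr
          · exact (lintegral_mono_set hV₁).trans k₁
          · exact (lintegral_mono_set hV₂).trans k₂
      _ = _ := by ring
  have hP₂ : ∫⁻ x in P₂, ‖Z x - (a₁ + B₁ x)‖ₑ ^ 2 ≤
      (2 * C₂ + 2 * C * (2 * C₁ + 2 * C₂)) * D := by
    calc ∫⁻ x in P₂, ‖Z x - (a₁ + B₁ x)‖ₑ ^ 2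
        ≤ ∫⁻ x in P₂, (2 * ‖Z x - (a₂ + B₂ x)‖ₑ ^ 2 + 2 * ‖(a₂ - a₁) + (B₂ - B₁) x‖ₑ ^ 2) := by
          refine lintegral_mono fun x => ?_
          have e : Z x - (a₁ + B₁ x) = (Z x - (a₂ + B₂ x)) + ((a₂ - a₁) + (B₂ - B₁) x) := by
            rw [sub_apply]; abel
          rw [e]
          exact enorm_add_sq_le _ _
      _ = 2 * (∫⁻ x in P₂, ‖Z x - (a₂ + B₂ x)‖ₑ ^ 2) +
            2 * ∫⁻ x in P₂, ‖(a₂ - a₁) + (B₂ - B₁) x‖ₑ ^ 2 := by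
          rw [lintegral_add_right _ (((Continuous.measurable (by fun_prop :
              Continuous fun x => (a₂ - a₁) + (B₂ - B₁) x)).enorm.pow_const 2).const_mul 2),
            lintegral_const_mul' _ _ (by finiteness), lintegral_const_mul' _ _ (by finiteness)]
      _ ≤ 2 * (C₂ * D) + 2 * (C * ((2 * C₁ + 2 * C₂) * D)) := by
          gcongr
          refine (hC 1 le_rfl _ _).trans ?_
          simp only [one_smul]
          gcongr
      _ = _ := by ring
  calc _ ≤ _ := lintegral_union_le _ _ _
    _ ≤ C₁ * D + (2 * C₂ + 2 * C * (2 * C₁ + 2 * C₂)) * D := by gcongr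
    _ = _ := by push_cast; ring

/-- The set of points linked to x₀ by such a P is open and relatively closed in W: a ball around a
limit point overlaps one of the sets P and can be joined to it. -/
lemma exists_hasAffineApprox_of_mem {W : Set (EuclideanSpace ℝ (Fin n))} (hW : IsOpen W)
    (hc : IsPreconnected W) {x₀ : EuclideanSpace ℝ (Fin n)} (hx₀ : x₀ ∈ W)
    {x : EuclideanSpace ℝ (Fin n)} (hx : x ∈ W) :
    ∃ P, IsOpen P ∧ Bornology.IsBounded P ∧ P ⊆ W ∧ x₀ ∈ P ∧ x ∈ P ∧ HasAffineApprox W P := by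
  set T := {x | ∃ P, IsOpen P ∧ Bornology.IsBounded P ∧ P ⊆ W ∧ x₀ ∈ P ∧ x ∈ P ∧
    HasAffineApprox W P} with hT
  have hball : ∀ x ∈ W, ∃ δ, 0 < δ ∧ Metric.closedBall x δ ⊆ W := fun x hx =>
    Metric.nhds_basis_closedBall.mem_iff.1 (hW.mem_nhds hx)
  have hTopen : IsOpen T := by
    rw [isOpen_iff_mem_nhds]
    rintro x ⟨P, hP, hPb, hPW, h0, hxP, hg⟩
    filter_upwards [hP.mem_nhds hxP] with y hy
    exact ⟨P, hP, hPb, hPW, h0, hy, hg⟩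
  refine hc.subset_of_closure_inter_subset hTopen ⟨x₀, hx₀, ?_⟩ ?_ hx
  · obtain ⟨δ, hδ, h⟩ := hball x₀ hx₀
    exact ⟨_, Metric.isOpen_ball, Metric.isBounded_ball, Metric.ball_subset_closedBall.trans h,
      Metric.mem_ball_self hδ, Metric.mem_ball_self hδ, hasAffineApprox_ball hδ h⟩
  · rintro x ⟨hxT, hxW⟩
    obtain ⟨δ, hδ, h⟩ := hball x hxW
    obtain ⟨t, ht, P, hP, hPb, hPW, h0, htP, hg⟩ := mem_closure_iff_nhds.1 hxT _
      (Metric.ball_mem_nhds x hδ)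
    have hBW := Metric.ball_subset_closedBall.trans h
    exact ⟨P ∪ Metric.ball x δ, hP.union Metric.isOpen_ball, hPb.union Metric.isBounded_ball,
      Set.union_subset hPW hBW, .inl h0, .inr (Metric.mem_ball_self hδ),
      hg.union (hasAffineApprox_ball hδ h) Metric.isBounded_ball (hP.inter Metric.isOpen_ball)
        ⟨t, htP, ht⟩ Set.inter_subset_left Set.inter_subset_right
        (Set.inter_subset_left.trans hPW)⟩

/-- A finite union of the sets attached to the points of H. All of them contain the base point x₀,
which supplies the overlaps. -/
lemma hasAffineApprox_of_isCompact {W H : Set (EuclideanSpace ℝ (Fin n))} (hW : IsOpen W)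
    (hc : IsConnected W) (hH : IsCompact H) (hHW : H ⊆ W) : HasAffineApprox W H := by
  obtain ⟨x₀, hx₀⟩ := hc.nonempty
  have key : ∃ P, IsOpen P ∧ Bornology.IsBounded P ∧ P ⊆ W ∧ x₀ ∈ P ∧ H ⊆ P ∧
      HasAffineApprox W P := by
    refine hH.induction_on (p := fun H => ∃ P, IsOpen P ∧ Bornology.IsBounded P ∧ P ⊆ W ∧ x₀ ∈ P ∧
      H ⊆ P ∧ HasAffineApprox W P) ?_ ?_ ?_ ?_
    · obtain ⟨P, h1, h2, h3, h4, -, h6⟩ := exists_hasAffineApprox_of_mem hW hc.isPreconnected hx₀ hx₀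
      exact ⟨P, h1, h2, h3, h4, Set.empty_subset _, h6⟩
    · rintro s t hst ⟨P, h1, h2, h3, h4, h5, h6⟩
      exact ⟨P, h1, h2, h3, h4, hst.trans h5, h6⟩
    · rintro s t ⟨P, h1, h2, h3, h4, h5, h6⟩ ⟨P', h1', h2', h3', h4', h5', h6'⟩
      exact ⟨P ∪ P', h1.union h1', h2.union h2', Set.union_subset h3 h3', .inl h4,
        Set.union_subset_union h5 h5', h6.union h6' h2' (h1.inter h1') ⟨x₀, h4, h4'⟩
        Set.inter_subset_left Set.inter_subset_right (Set.inter_subset_left.trans h3)⟩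
    · intro x hx
      obtain ⟨P, h1, h2, h3, h4, h5, h6⟩ :=
        exists_hasAffineApprox_of_mem hW hc.isPreconnected hx₀ (hHW hx)
      exact ⟨P, mem_nhdsWithin_of_mem_nhds (h1.mem_nhds h5), P, h1, h2, h3, h4, le_rfl, h6⟩
  obtain ⟨P, -, -, -, -, h, hP⟩ := key
  exact hP.mono h

end Chain

/-! ### Connectedness of the conical shell -/

section ConicalShell

/-- In polar coordinates the shell is the image of (1, ∞) × (θ₁, θ₂) × the unit sphere of e^⊥. That
sphere is connected because e^⊥ has dimension n - 1 ≥ 2. -/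
lemma isConnected_conicalShell {n : ℕ} (hn : 3 ≤ n) {e : EuclideanSpace ℝ (Fin n)} (he : ‖e‖ = 1)
    {θ₁ θ₂ : ℝ} (hθ₁ : 0 < θ₁) (hθ₁₂ : θ₁ < θ₂) (hθ₂ : θ₂ < Real.pi) :
    IsConnected {x : EuclideanSpace ℝ (Fin n) | 1 < ‖x‖ ∧
      θ₁ < InnerProductGeometry.angle e x ∧ InnerProductGeometry.angle e x < θ₂} := by
  set S : Submodule ℝ (EuclideanSpace ℝ (Fin n)) := (Submodule.span ℝ {e})ᗮ with hS
  have he0 : e ≠ 0 := by rintro rfl; simp at he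
  have hrank : 1 < Module.rank ℝ S := by
    apply Module.lt_rank_of_lt_finrank
    have : Fact (Module.finrank ℝ (EuclideanSpace ℝ (Fin n)) = (n - 1) + 1) :=
      ⟨by rw [finrank_euclideanSpace_fin]; omega⟩
    have h := Submodule.finrank_orthogonal_span_singleton (𝕜 := ℝ) (n := n - 1) he0
    rw [← hS] at h
    omega
  have hsph : IsConnected (Metric.sphere (0 : S) 1) := isConnected_sphere hrank 0 zero_le_one
  have hprod : IsConnected (Set.Ioi (1 : ℝ) ×ˢ (Set.Ioo θ₁ θ₂ ×ˢ Metric.sphere (0 : S) 1)) :=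
    isConnected_Ioi.prod ((isConnected_Ioo hθ₁₂).prod hsph)
  let f : ℝ × (ℝ × S) → EuclideanSpace ℝ (Fin n) := fun p =>
    p.1 • (Real.cos p.2.1 • e + Real.sin p.2.1 • (p.2.2 : EuclideanSpace ℝ (Fin n)))
  have hf : Continuous f := by fun_prop
  have horth : ∀ u : S, inner ℝ e (u : EuclideanSpace ℝ (Fin n)) = (0 : ℝ) := fun u =>
    Submodule.mem_orthogonal_singleton_iff_inner_right.1 u.2
  convert hprod.image f hf.continuousOn using 1
  ext x
  simp only [Set.mem_ofPred_eq, Set.mem_image, Set.mem_prod, Set.mem_Ioi, Set.mem_Ioo, Prod.exists]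
  constructor
  · rintro ⟨hx, h1, h2⟩
    have hx0 : 0 < ‖x‖ := zero_lt_one.trans hx
    set α := InnerProductGeometry.angle e x with hα
    have hsin : 0 < Real.sin α := Real.sin_pos_of_pos_of_lt_pi (hθ₁.trans h1) (h2.trans hθ₂)
    have hcos : inner ℝ e x = Real.cos α * ‖x‖ := by
      rw [← InnerProductGeometry.cos_angle_mul_norm_mul_norm, he, one_mul]
    -- The unit vector in the direction of the component of x orthogonal to e.
    set w : EuclideanSpace ℝ (Fin n) := (‖x‖ * Real.sin α)⁻¹ • (x - (Real.cos α * ‖x‖) • e) with hw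
    have hwS : w ∈ S := by
      rw [hS, Submodule.mem_orthogonal_singleton_iff_inner_right, hw, real_inner_smul_right,
        inner_sub_right, real_inner_smul_right, real_inner_self_eq_norm_sq, he, hcos]
      ring
    have hwn : ‖x - (Real.cos α * ‖x‖) • e‖ = ‖x‖ * Real.sin α := by
      rw [← sq_eq_sq₀ (norm_nonneg _) (by positivity), norm_sub_sq_real, real_inner_smul_right,
        real_inner_comm, hcos, norm_smul, he, Real.norm_eq_abs, mul_one, sq_abs, mul_pow,
        mul_pow, Real.sin_sq]
      ring
    refine ⟨‖x‖, α, ⟨w, hwS⟩, ⟨hx, ⟨h1, h2⟩, ?_⟩, ?_⟩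
    · simp only [mem_sphere_iff_norm, sub_zero]
      change ‖w‖ = 1
      rw [hw, norm_smul, hwn, norm_inv, Real.norm_eq_abs, abs_of_pos (by positivity)]
      exact inv_mul_cancel₀ (by positivity)
    · simp only [f, hw, smul_add, smul_smul]
      rw [mul_inv_cancel₀ (by positivity), one_smul, mul_comm]
      abel
  · rintro ⟨t, α, u, ⟨ht, ⟨h1, h2⟩, hu⟩, rfl⟩
    have ht0 : 0 < t := zero_lt_one.trans ht
    have hun : ‖(u : EuclideanSpace ℝ (Fin n))‖ = 1 := by simpa using hu
    have hn1 : ‖Real.cos α • e + Real.sin α • (u : EuclideanSpace ℝ (Fin n))‖ = 1 := by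
      rw [← sq_eq_sq₀ (norm_nonneg _) zero_le_one, norm_add_sq_real, real_inner_smul_left,
        real_inner_smul_right, horth, norm_smul, norm_smul, he, hun]
      simp
    have hn2 : ‖f (t, α, u)‖ = t := by
      simp only [f]
      rw [norm_smul, hn1, Real.norm_eq_abs, abs_of_pos ht0, mul_one]
    have hang : InnerProductGeometry.angle e (f (t, α, u)) = α := by
      simp only [f]
      rw [InnerProductGeometry.angle_smul_right_of_pos _ _ ht0, InnerProductGeometry.angle, hn1, he,
        inner_add_right, real_inner_smul_right, real_inner_smul_right, horth,
        real_inner_self_eq_norm_sq, he]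
      simp only [one_pow, mul_one, mul_zero, add_zero, div_one]
      exact Real.arccos_cos (hθ₁.trans h1).le (h2.trans hθ₂).le
    exact ⟨by rw [hn2]; exact ht, by rw [hang]; exact h1, by rw [hang]; exact h2⟩

end ConicalShell

/-! ### Cutoffs of the angular weight -/

section Cutoff

/-- A smooth nondecreasing cutoff vanishing on `(-∞, τ]` and equal to `1` on `[2τ, ∞)`. -/
noncomputable def levelCutoff (τ t : ℝ) : ℝ := Real.smoothTransition (t / τ - 1)

lemma levelCutoff_nonneg (τ t : ℝ) : 0 ≤ levelCutoff τ t := Real.smoothTransition.nonneg _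

lemma levelCutoff_le_one (τ t : ℝ) : levelCutoff τ t ≤ 1 := Real.smoothTransition.le_one _

lemma levelCutoff_eq_zero {τ t : ℝ} (hτ : 0 < τ) (h : t ≤ τ) : levelCutoff τ t = 0 := by
  refine Real.smoothTransition.zero_of_nonpos ?_
  rw [sub_nonpos, div_le_one hτ]; exact h

lemma levelCutoff_eq_one {τ t : ℝ} (hτ : 0 < τ) (h : 2 * τ ≤ t) : levelCutoff τ t = 1 := by
  refine Real.smoothTransition.one_of_one_le ?_
  rw [le_sub_iff_add_le, le_div_iff₀ hτ]; linarith

lemma contDiff_levelCutoff (τ : ℝ) : ContDiff ℝ ∞ (levelCutoff τ) := by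
  unfold levelCutoff
  exact Real.smoothTransition.contDiff.comp ((contDiff_id.div_const τ).sub contDiff_const)

lemma deriv_levelCutoff_nonneg {τ : ℝ} (hτ : 0 < τ) (t : ℝ) : 0 ≤ deriv (levelCutoff τ) t := by
  refine Monotone.deriv_nonneg fun a b hab => Real.smoothTransition.monotone ?_
  gcongr

lemma deriv_levelCutoff_eq_zero {τ t : ℝ} (hτ : 0 < τ) (h : 2 * τ ≤ t) :
    deriv (levelCutoff τ) t = 0 := by
  refine IsLocalMax.deriv_eq_zero (.of_forall fun x => ?_)
  rw [levelCutoff_eq_one hτ h]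
  exact levelCutoff_le_one τ x

/-- The derivative has size 1/τ and lives on [τ, 2τ], so t times it is bounded uniformly in τ.
Multiplied by a power of φ, the cutoff thus costs no more than differentiating φ itself. -/
lemma exists_mul_deriv_levelCutoff_le : ∃ M : ℝ, 0 ≤ M ∧ ∀ τ t : ℝ, 0 < τ → 0 < t →
    t * deriv (levelCutoff τ) t ≤ M := by
  have hcont : Continuous (deriv Real.smoothTransition) :=
    (Real.smoothTransition.contDiff (n := 1)).continuous_deriv le_rfl
  obtain ⟨M, hM⟩ := isCompact_Icc.exists_bound_of_continuousOn (s := Set.Icc (0 : ℝ) 1)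
    hcont.continuousOn
  have hM0 : 0 ≤ M := (norm_nonneg _).trans (hM 0 (by simp))
  refine ⟨2 * M, by positivity, fun τ t hτ ht => ?_⟩
  rcases le_or_gt (2 * τ) t with h | h
  · rw [deriv_levelCutoff_eq_zero hτ h]; simpa using hM0
  rcases le_or_gt τ t with h' | h'
  · have hd : deriv (levelCutoff τ) t = deriv Real.smoothTransition (t / τ - 1) * (1 / τ) := by
      have h1 : HasDerivAt (fun t : ℝ => t / τ - 1) (1 / τ) t :=
        ((hasDerivAt_id t).div_const τ).sub_const 1
      exact (((Real.smoothTransition.contDiff (n := 1)).differentiable one_ne_zero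
        (t / τ - 1)).hasDerivAt.comp t h1).deriv
    have h2 := (le_abs_self _).trans (hM (t / τ - 1) ⟨by
      rw [sub_nonneg, one_le_div hτ]; exact h', by
      rw [sub_le_iff_le_add, div_le_iff₀ hτ]; linarith⟩)
    rw [hd, show t * (deriv Real.smoothTransition (t / τ - 1) * (1 / τ)) =
      t / τ * deriv Real.smoothTransition (t / τ - 1) by ring]
    have h3 : t / τ ≤ 2 := by rw [div_le_iff₀ hτ]; linarith
    have h4 : 0 ≤ t / τ := by positivity
    calc t / τ * deriv Real.smoothTransition (t / τ - 1) ≤ t / τ * M := by gcongr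
      _ ≤ 2 * M := by gcongr
  · have : deriv (levelCutoff τ) t = 0 := by
      refine IsLocalMin.deriv_eq_zero (.of_forall fun x => ?_)
      rw [levelCutoff_eq_zero hτ h'.le]
      exact levelCutoff_nonneg τ x
    rw [this]; simpa using hM0

end Cutoff

/-! ### Extension by zero of functions vanishing near the boundary -/

section ExtensionByZero

lemma indicator_eventuallyEq_zero {E F : Type*} [TopologicalSpace E] [Zero F] {Ω H : Set E}
    {f : E → F} (hH : IsClosed H)
    (hz : ∀ x ∈ Ω, x ∉ H → f x = 0) {x : E} (hx : x ∉ H) : Ω.indicator f =ᶠ[𝓝 x] fun _ => 0 := by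
  filter_upwards [hH.isOpen_compl.mem_nhds hx] with y hy
  by_cases hyΩ : y ∈ Ω
  · rw [Set.indicator_of_mem hyΩ, hz y hyΩ hy]
  · exact Set.indicator_of_notMem hyΩ f

lemma hasCompactSupport_indicator {E F : Type*} [TopologicalSpace E] [T2Space E]
    [Zero F] {Ω H : Set E} {f : E → F} (hH : IsCompact H)
    (hz : ∀ x ∈ Ω, x ∉ H → f x = 0) : HasCompactSupport (Ω.indicator f) := by
  refine HasCompactSupport.intro' hH hH.isClosed fun x hx => ?_
  exact (indicator_eventuallyEq_zero hH.isClosed hz hx).eq_of_nhds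

variable {E F : Type*} [NormedAddCommGroup E] [NormedSpace ℝ E] [NormedAddCommGroup F]
  [NormedSpace ℝ F]

lemma contDiff_indicator {Ω H : Set E} {f : E → F} {m : WithTop ℕ∞} (hΩ : IsOpen Ω)
    (hH : IsClosed H) (hHΩ : H ⊆ Ω) (hz : ∀ x ∈ Ω, x ∉ H → f x = 0) (hf : ContDiffOn ℝ m f Ω) :
    ContDiff ℝ m (Ω.indicator f) := by
  rw [contDiff_iff_contDiffAt]
  intro x
  by_cases hx : x ∈ H
  · refine (hf.contDiffAt (hΩ.mem_nhds (hHΩ hx))).congr_of_eventuallyEq ?_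
    filter_upwards [hΩ.mem_nhds (hHΩ hx)] with y hy
    exact Set.indicator_of_mem hy f
  · exact contDiffAt_const.congr_of_eventuallyEq (indicator_eventuallyEq_zero hH hz hx)

lemma fderiv_indicator_of_mem {Ω : Set E} {f : E → F} (hΩ : IsOpen Ω) {x : E} (hx : x ∈ Ω) :
    fderiv ℝ (Ω.indicator f) x = fderiv ℝ f x := by
  refine Filter.EventuallyEq.fderiv_eq ?_
  filter_upwards [hΩ.mem_nhds hx] with y hy
  exact Set.indicator_of_mem hy f

lemma fderiv_indicator_of_notMem {Ω H : Set E} {f : E → F} (hH : IsClosed H)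
    (hz : ∀ x ∈ Ω, x ∉ H → f x = 0) {x : E} (hx : x ∉ H) :
    fderiv ℝ (Ω.indicator f) x = 0 := by
  rw [(indicator_eventuallyEq_zero hH hz hx).fderiv_eq]
  exact fderiv_const_apply 0

end ExtensionByZero

/-! ### The divergence theorem and Korn's inequality in integral form -/

section Integrals

/-- If Q has infinite integral there is nothing to prove; otherwise Q is integrable and the
mean-zero term G disappears. -/
lemma lintegral_le_of_le_add {α : Type*} [MeasurableSpace α] {μ : Measure α} {G P Q : α → ℝ}
    (hG : Integrable G μ) (hG0 : ∫ x, G x ∂μ = 0) (hP : ∀ᵐ x ∂μ, 0 ≤ P x)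
    (hQ : ∀ᵐ x ∂μ, 0 ≤ Q x) (hQm : AEStronglyMeasurable Q μ) (h : ∀ᵐ x ∂μ, P x ≤ G x + Q x) :
    ∫⁻ x, ENNReal.ofReal (P x) ∂μ ≤ ∫⁻ x, ENNReal.ofReal (Q x) ∂μ := by
  by_cases hfin : ∫⁻ x, ENNReal.ofReal (Q x) ∂μ = ⊤
  · rw [hfin]; exact le_top
  have hQi : Integrable Q μ :=
    (lintegral_ofReal_ne_top_iff_integrable hQm hQ).1 hfin
  calc ∫⁻ x, ENNReal.ofReal (P x) ∂μ ≤ ∫⁻ x, ENNReal.ofReal (G x + Q x) ∂μ := by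
        refine lintegral_mono_ae ?_
        filter_upwards [h] with x hx
        exact ENNReal.ofReal_le_ofReal hx
    _ = ENNReal.ofReal (∫ x, (G x + Q x) ∂μ) := by
        rw [ofReal_integral_eq_lintegral_ofReal (by exact hG.add hQi)]
        filter_upwards [hP, h] with x h1 h2
        exact h1.trans h2
    _ = ENNReal.ofReal (∫ x, Q x ∂μ) := by rw [integral_add hG hQi, hG0, zero_add]
    _ = _ := ofReal_integral_eq_lintegral_ofReal hQi hQ

variable {n : ℕ}

/-- The divergence of a vector field. -/
noncomputable def euclideanDiv (Y : EuclideanSpace ℝ (Fin n) → EuclideanSpace ℝ (Fin n))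
    (x : EuclideanSpace ℝ (Fin n)) : ℝ := ∑ i, fderiv ℝ Y x (EuclideanSpace.single i 1) i

lemma integral_euclideanDiv {Y : EuclideanSpace ℝ (Fin n) → EuclideanSpace ℝ (Fin n)}
    (hY : ContDiff ℝ 1 Y) (hc : HasCompactSupport Y) :
    Integrable (euclideanDiv Y) ∧ ∫ x, euclideanDiv Y x = 0 := by
  have hYj : ∀ j, ContDiff ℝ 1 fun z => Y z j := fun j =>
    (EuclideanSpace.proj (𝕜 := ℝ) j).contDiff.comp hY
  have hcj : ∀ j, HasCompactSupport fun z => Y z j := fun j =>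
    hc.comp_left (g := fun z : EuclideanSpace ℝ (Fin n) => z j) rfl
  have heq : euclideanDiv Y = fun x => ∑ i, fderiv ℝ (fun z => Y z i) x
      (EuclideanSpace.single i 1) := by
    ext x
    exact Finset.sum_congr rfl fun i _ =>
      fderiv_euclidean_apply ((hY.differentiable one_ne_zero) x) _ _
  have hint : ∀ i : Fin n, Integrable fun x => fderiv ℝ (fun z => Y z i) x
      (EuclideanSpace.single i 1) := fun i =>
    (((hYj i).continuous_fderiv one_ne_zero).clm_apply
      continuous_const).integrable_of_hasCompactSupport ((hcj i).fderiv_apply ℝ _)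
  rw [heq]
  refine ⟨integrable_finsetSum _ fun i _ => hint i, ?_⟩
  rw [integral_finsetSum _ fun i _ => hint i]
  exact Finset.sum_eq_zero fun i _ =>
    integral_fderiv_eq_zero_of_hasCompactSupport volume (hYj i) (hcj i) _

lemma euclideanDiv_smul {f : EuclideanSpace ℝ (Fin n) → ℝ}
    {X : EuclideanSpace ℝ (Fin n) → EuclideanSpace ℝ (Fin n)} {x : EuclideanSpace ℝ (Fin n)}
    (hf : DifferentiableAt ℝ f x) (hX : DifferentiableAt ℝ X x) :
    euclideanDiv (fun y => f y • X y) x = f x * euclideanDiv X x + fderiv ℝ f x (X x) := by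
  have h : fderiv ℝ (fun y => f y • X y) x = f x • fderiv ℝ X x + (fderiv ℝ f x).smulRight (X x) :=
    fderiv_fun_smul hf hX
  rw [euclideanDiv, h, apply_eq_sum_single (fderiv ℝ f x) (X x), euclideanDiv, Finset.mul_sum,
    ← Finset.sum_add_distrib]
  refine Finset.sum_congr rfl fun i _ => ?_
  simp [mul_comm]

lemma abs_euclideanDiv_le (X : EuclideanSpace ℝ (Fin n) → EuclideanSpace ℝ (Fin n))
    (x : EuclideanSpace ℝ (Fin n)) : |euclideanDiv X x| ≤ n * ‖fderiv ℝ X x‖ := by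
  have h : ∀ i : Fin n, |fderiv ℝ X x (EuclideanSpace.single i 1) i| ≤ ‖fderiv ℝ X x‖ := by
    intro i
    refine (PiLp.norm_apply_le (fderiv ℝ X x (EuclideanSpace.single i 1)) i).trans ?_
    refine ((fderiv ℝ X x).le_opNorm _).trans ?_
    simp
  calc |euclideanDiv X x| ≤ ∑ i : Fin n, |fderiv ℝ X x (EuclideanSpace.single i 1) i| :=
        Finset.abs_sum_le_sum_abs _ _
    _ ≤ ∑ _i : Fin n, ‖fderiv ℝ X x‖ := Finset.sum_le_sum fun i _ => h i
    _ = _ := by simp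

lemma lintegral_korn_of_hasCompactSupport
    {Y : EuclideanSpace ℝ (Fin n) → EuclideanSpace ℝ (Fin n)}
    (hY : ContDiff ℝ 2 Y) (hc : HasCompactSupport Y) :
    ∫⁻ x, ENNReal.ofReal (gradNormSq (fderiv ℝ Y x)) ≤
      ∫⁻ x, ENNReal.ofReal (killingNormSq (fderiv ℝ Y x)) := by
  have hcd : Continuous (fderiv ℝ Y) := (hY.of_le one_le_two).continuous_fderiv one_ne_zero
  have hg : Integrable fun x => gradNormSq (fderiv ℝ Y x) :=
    (continuous_gradNormSq.comp hcd).integrable_of_hasCompactSupport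
      ((hc.fderiv ℝ).comp_left (by simp [gradNormSq_eq_sum]))
  have hk : Integrable fun x => killingNormSq (fderiv ℝ Y x) :=
    (continuous_killingNormSq.comp hcd).integrable_of_hasCompactSupport
      ((hc.fderiv ℝ).comp_left (by simp [killingNormSq_eq_sum]))
  rw [← ofReal_integral_eq_lintegral_ofReal hg (.of_forall fun x => gradNormSq_nonneg _),
    ← ofReal_integral_eq_lintegral_ofReal hk (.of_forall fun x => killingNormSq_nonneg _)]
  apply ENNReal.ofReal_le_ofReal
  have h1 := korn_of_hasCompactSupport hY hc
  have h2 : 0 ≤ ∫ x, gradNormSq (fderiv ℝ Y x) := integral_nonneg fun x => gradNormSq_nonneg _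
  linarith

end Integrals

/-! ### Scale-invariant bounds for the weights -/

section Bounds

variable {n : ℕ}

/-- Scale-invariant bounds for a weight `φ` of degree `0`, a radius `r` of degree `1` and a field
`X` of degree `0` which is transversal to the boundary of `Ω`. -/
structure HasScaleBounds (Ω : Set (EuclideanSpace ℝ (Fin n))) (r φ : EuclideanSpace ℝ (Fin n) → ℝ)
    (X : EuclideanSpace ℝ (Fin n) → EuclideanSpace ℝ (Fin n)) (C s : ℝ) : Prop where
  isOpen : IsOpen Ω
  C_pos : 0 < C
  s_pos : 0 < s
  r_pos : ∀ x ∈ Ω, 0 < r x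
  φ_pos : ∀ x ∈ Ω, 0 < φ x
  r_smooth : ContDiffOn ℝ ∞ r Ω
  φ_smooth : ContDiffOn ℝ ∞ φ Ω
  X_smooth : ContDiffOn ℝ ∞ X Ω
  φ_le : ∀ x ∈ Ω, φ x ≤ C
  fderiv_φ_le : ∀ x ∈ Ω, r x * ‖fderiv ℝ φ x‖ ≤ C
  fderiv_r_le : ∀ x ∈ Ω, ‖fderiv ℝ r x‖ ≤ C
  X_le : ∀ x ∈ Ω, ‖X x‖ ≤ C
  fderiv_X_le : ∀ x ∈ Ω, r x * ‖fderiv ℝ X x‖ ≤ C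
  le_fderiv_φ : ∀ x ∈ Ω, φ x < s → s ≤ r x * fderiv ℝ φ x (X x)
  isCompact : ∀ τ R : ℝ, 0 < τ → IsCompact {x | x ∈ Ω ∧ τ ≤ φ x ∧ ‖x‖ ≤ R}

lemma IsRegularizedCone.smul_mem {e : EuclideanSpace ℝ (Fin n)} {θ₁ θ₂ : ℝ}
    {Ω : Set (EuclideanSpace ℝ (Fin n))} (hΩ : IsRegularizedCone e θ₁ θ₂ Ω)
    {x : EuclideanSpace ℝ (Fin n)} {c : ℝ} (hx : 1 ≤ ‖x‖) (hc : 0 < c) (hcx : 1 ≤ ‖c • x‖) :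
    c • x ∈ Ω ↔ x ∈ Ω := by
  rw [hΩ.conical _ hcx, hΩ.conical _ hx, InnerProductGeometry.angle_smul_right_of_pos _ _ hc]

lemma IsRadialWeight.smul {r : EuclideanSpace ℝ (Fin n) → ℝ} (hr : IsRadialWeight r)
    {x : EuclideanSpace ℝ (Fin n)} {c : ℝ} (hx : 1 ≤ ‖x‖) (hc : 1 ≤ c) :
    r (c • x) = c * r x := by
  have h : ‖c • x‖ = c * ‖x‖ := by rw [norm_smul, Real.norm_eq_abs, abs_of_pos (by linarith)]
  rw [hr.eq_norm _ hx, hr.eq_norm _ (by rw [h]; nlinarith), h]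

/-- φ vanishes on the boundary, so a positive lower bound on φ keeps limit points inside Ω. -/
lemma isCompact_levelSet {Ω : Set (EuclideanSpace ℝ (Fin n))} {φ : EuclideanSpace ℝ (Fin n) → ℝ}
    (hc : ∀ x ∈ closure Ω, ContinuousAt φ x) (h0 : ∀ x ∈ frontier Ω, φ x = 0)
    (hΩ : IsOpen Ω) {τ R : ℝ} (hτ : 0 < τ) :
    IsCompact {x | x ∈ Ω ∧ τ ≤ φ x ∧ ‖x‖ ≤ R} := by
  have heq : {x | x ∈ Ω ∧ τ ≤ φ x ∧ ‖x‖ ≤ R} =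
      (closure Ω ∩ φ ⁻¹' Set.Ici τ) ∩ Metric.closedBall 0 R := by
    ext x
    simp only [Set.mem_ofPred_eq, Set.mem_inter_iff, Set.mem_preimage, Set.mem_Ici,
      mem_closedBall_zero_iff, and_assoc]
    refine ⟨fun h => ⟨subset_closure h.1, h.2⟩, fun h => ⟨?_, h.2⟩⟩
    by_contra hx
    have hf : x ∈ frontier Ω := by rw [hΩ.frontier_eq]; exact ⟨h.1, hx⟩
    have := h0 x hf
    linarith [h.2.1]
  rw [heq]
  have hcl : IsClosed (closure Ω ∩ φ ⁻¹' Set.Ici τ) :=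
    ContinuousOn.preimage_isClosed_of_isClosed (fun x hx => (hc x hx).continuousWithinAt)
      isClosed_closure isClosed_Ici
  exact (isCompact_closedBall 0 R).inter_left hcl

/-- A property which is invariant under dilations away from the unit ball holds on the whole
domain once it holds in the ball of radius `2`. -/
lemma IsRegularizedCone.forall_of_scaling {e : EuclideanSpace ℝ (Fin n)} {θ₁ θ₂ : ℝ}
    {Ω : Set (EuclideanSpace ℝ (Fin n))} (hΩ : IsRegularizedCone e θ₁ θ₂ Ω)
    {p : EuclideanSpace ℝ (Fin n) → Prop} (h : ∀ x ∈ Ω, ‖x‖ ≤ 2 → p x)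
    (hs : ∀ x ∈ Ω, 1 < ‖x‖ → ∀ c : ℝ, 1 ≤ c → p x → p (c • x)) : ∀ x ∈ Ω, p x := by
  intro x hx
  rcases le_or_gt ‖x‖ 2 with h2 | h2
  · exact h x hx h2
  have hx0 : 0 < ‖x‖ := by linarith
  have hn : ‖(2 / ‖x‖) • x‖ = 2 := by
    rw [norm_smul, Real.norm_eq_abs, abs_of_pos (by positivity)]
    field_simp
  have hy : (2 / ‖x‖) • x ∈ Ω :=
    (hΩ.smul_mem (by linarith) (by positivity) (by rw [hn]; norm_num)).2 hx
  -- Pull x back along its ray to norm 2, then dilate by ‖x‖/2.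
  have h3 := hs _ hy (by rw [hn]; norm_num) (‖x‖ / 2) (by linarith) (h _ hy hn.le)
  rwa [smul_smul, show ‖x‖ / 2 * (2 / ‖x‖) = 1 by field_simp, one_smul] at h3

/-- Differentiating the homogeneity relation, which holds near x because Ω and the exterior of the
unit ball are open. -/
lemma fderiv_smul_of_homogeneous {V : Type*} [NormedAddCommGroup V] [NormedSpace ℝ V]
    {Ω : Set (EuclideanSpace ℝ (Fin n))} (hΩ : IsOpen Ω) {F : EuclideanSpace ℝ (Fin n) → V} {d : ℕ}
    (hF : ∀ x ∈ Ω, 1 < ‖x‖ → ∀ c : ℝ, 1 ≤ c → F (c • x) = c ^ d • F x)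
    {x : EuclideanSpace ℝ (Fin n)} (hx : x ∈ Ω) (h1 : 1 < ‖x‖) {c : ℝ} (hc : 1 ≤ c)
    (hd : DifferentiableAt ℝ F x) :
    c • fderiv ℝ F (c • x) = c ^ d • fderiv ℝ F x := by
  rw [← fderiv_comp_smul]
  have h : (fun y => F (c • y)) =ᶠ[𝓝 x] fun y => c ^ d • F y := by
    filter_upwards [hΩ.mem_nhds hx, continuous_norm.continuousAt.eventually (lt_mem_nhds h1)]
      with y hy hy1 using hF y hy hy1 c hc
  rw [h.fderiv_eq, fderiv_fun_const_smul hd]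

/-- The angular and the radial weight satisfy scale-invariant bounds, the transversal field being
`r ∇φ`. -/
lemma exists_hasScaleBounds {e : EuclideanSpace ℝ (Fin n)} {θ₁ θ₂ : ℝ}
    {Ω : Set (EuclideanSpace ℝ (Fin n))} (hΩ : IsRegularizedCone e θ₁ θ₂ Ω)
    {r : EuclideanSpace ℝ (Fin n) → ℝ} (hr : IsRadialWeight r)
    {φ : EuclideanSpace ℝ (Fin n) → ℝ} (hφ : IsAngularWeight e θ₁ θ₂ Ω φ) :
    ∃ X C s, HasScaleBounds Ω r φ X C s := by
  set X : EuclideanSpace ℝ (Fin n) → EuclideanSpace ℝ (Fin n) := fun x => r x • gradient φ x with hX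
  have hXs : ∀ x ∈ closure Ω, ContDiffAt ℝ ∞ X x := fun x hx =>
    hr.smooth.contDiffAt.smul ((InnerProductSpace.toDual ℝ
      (EuclideanSpace ℝ (Fin n))).symm.contDiff.contDiffAt.comp x
        ((hφ.smooth x hx).fderiv_right (m := ∞) (by simp)))
  have hφX : ∀ x, fderiv ℝ φ x (X x) = r x * ‖fderiv ℝ φ x‖ ^ 2 := by
    intro x
    have h1 : fderiv ℝ φ x = InnerProductSpace.toDual ℝ _ (gradient φ x) := by
      simp [gradient]
    conv_lhs => rw [h1]
    conv_rhs => rw [h1]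
    rw [LinearIsometryEquiv.norm_map, InnerProductSpace.toDual_apply_apply, hX,
      real_inner_smul_right, real_inner_self_eq_norm_sq]
  have hφh : ∀ x ∈ Ω, 1 < ‖x‖ → ∀ c : ℝ, 1 ≤ c → φ (c • x) = c ^ 0 • φ x := fun x hx h1 c hc => by
    rw [hφ.conical x hx h1.le c hc, pow_zero, one_smul]
  have hrh : ∀ x ∈ Ω, 1 < ‖x‖ → ∀ c : ℝ, 1 ≤ c → r (c • x) = c ^ 1 • r x := fun x _ h1 c hc => by
    rw [hr.smul h1.le hc, pow_one, smul_eq_mul]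
  have hdφ : ∀ x ∈ Ω, 1 < ‖x‖ → ∀ c : ℝ, 1 ≤ c → c • fderiv ℝ φ (c • x) = fderiv ℝ φ x := by
    intro x hx h1 c hc
    have h := fderiv_smul_of_homogeneous hΩ.isOpen hφh hx h1 hc
      ((hφ.smooth x (subset_closure hx)).differentiableAt (by simp))
    rwa [pow_zero, one_smul] at h
  have hXh : ∀ x ∈ Ω, 1 < ‖x‖ → ∀ c : ℝ, 1 ≤ c → X (c • x) = c ^ 0 • X x := by
    intro x hx h1 c hc
    rw [hX, pow_zero, one_smul]
    simp only [gradient]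
    rw [hr.smul h1.le hc, ← hdφ x hx h1 c hc, map_smul, smul_smul, mul_comm]
  have hdX : ∀ x ∈ Ω, 1 < ‖x‖ → ∀ c : ℝ, 1 ≤ c → c • fderiv ℝ X (c • x) = fderiv ℝ X x := by
    intro x hx h1 c hc
    have h := fderiv_smul_of_homogeneous hΩ.isOpen hXh hx h1 hc
      ((hXs x (subset_closure hx)).differentiableAt (by simp))
    rwa [pow_zero, one_smul] at h
  have hdr : ∀ x ∈ Ω, 1 < ‖x‖ → ∀ c : ℝ, 1 ≤ c → fderiv ℝ r (c • x) = fderiv ℝ r x := by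
    intro x hx h1 c hc
    have h := fderiv_smul_of_homogeneous hΩ.isOpen hrh hx h1 hc
      (hr.smooth.contDiffAt.differentiableAt (by simp))
    rw [pow_one] at h
    exact smul_right_injective _ (by linarith : c ≠ 0) h
  set K := closure Ω ∩ Metric.closedBall (0 : EuclideanSpace ℝ (Fin n)) 2 with hK
  have hKc : IsCompact K := (isCompact_closedBall 0 2).inter_left isClosed_closure
  have hKΩ : ∀ x ∈ Ω, ‖x‖ ≤ 2 → x ∈ K := fun x hx h2 => ⟨subset_closure hx, by simpa using h2⟩
  -- Dilation-invariant functions continuous up to the boundary are bounded by compactness of K.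
  have bound : ∀ f : EuclideanSpace ℝ (Fin n) → ℝ, (∀ x ∈ closure Ω, ContinuousAt f x) →
      (∀ x ∈ Ω, 1 < ‖x‖ → ∀ c : ℝ, 1 ≤ c → f (c • x) = f x) → ∃ C, ∀ x ∈ Ω, f x ≤ C := by
    intro f hf hfs
    obtain ⟨C, hC⟩ := hKc.exists_bound_of_continuousOn
      (fun x hx => (hf x hx.1).continuousWithinAt : ContinuousOn f K)
    refine ⟨C, hΩ.forall_of_scaling (fun x hx h2 => (le_abs_self _).trans (hC x (hKΩ x hx h2))) ?_⟩
    intro x hx h1 c hc h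
    rwa [hfs x hx h1 c hc]
  have hφd : ∀ x ∈ closure Ω, ContinuousAt (fun x => ‖fderiv ℝ φ x‖) x := fun x hx =>
    ((hφ.smooth x hx).continuousAt_fderiv (by simp)).norm
  have hrc : ∀ x, ContinuousAt r x := fun x => hr.smooth.continuous.continuousAt
  have hns : ∀ {V : Type} [NormedAddCommGroup V] [NormedSpace ℝ V] (A B : V) (x) (c : ℝ), 1 ≤ c →
      1 < ‖x‖ → c • A = B → r (c • x) * ‖A‖ = r x * ‖B‖ := by
    intro V _ _ A B x c hc h1 h
    rw [hr.smul h1.le hc, ← h, norm_smul, Real.norm_eq_abs, abs_of_pos (by linarith)]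
    ring
  obtain ⟨C₁, h₁⟩ := bound φ (fun x hx => (hφ.smooth x hx).continuousAt)
    (fun x hx h1 c hc => hφ.conical x hx h1.le c hc)
  obtain ⟨C₂, h₂⟩ := bound (fun x => r x * ‖fderiv ℝ φ x‖) (fun x hx => (hrc x).mul (hφd x hx))
    (fun x hx h1 c hc => hns _ _ x c hc h1 (hdφ x hx h1 c hc))
  obtain ⟨C₃, h₃⟩ := bound (fun x => ‖fderiv ℝ r x‖)
    (fun x hx => (hr.smooth.contDiffAt.continuousAt_fderiv (by simp)).norm)
    (fun x hx h1 c hc => by rw [hdr x hx h1 c hc])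
  obtain ⟨C₄, h₄⟩ := bound (fun x => ‖X x‖) (fun x hx => (hXs x hx).continuousAt.norm)
    (fun x hx h1 c hc => by rw [hXh x hx h1 c hc, pow_zero, one_smul])
  obtain ⟨C₅, h₅⟩ := bound (fun x => r x * ‖fderiv ℝ X x‖)
    (fun x hx => (hrc x).mul ((hXs x hx).continuousAt_fderiv (by simp)).norm)
    (fun x hx h1 c hc => hns _ _ x c hc h1 (hdX x hx h1 c hc))
  -- The sum is positive on K: inside Ω because φ > 0, on the boundary because the gradient does not
  -- vanish. Half of its minimum is s, so that φ < s forces (r |∇φ|)² ≥ s, which is the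
  -- transversality of r ∇φ.
  obtain ⟨s, hs, hsK⟩ : ∃ s : ℝ, 0 < s ∧ ∀ x ∈ K, 2 * s ≤ φ x + (r x * ‖fderiv ℝ φ x‖) ^ 2 := by
    rcases K.eq_empty_or_nonempty with h | h
    · exact ⟨1, one_pos, fun x hx => by rw [h] at hx; exact hx.elim⟩
    have hcont : ContinuousOn (fun x => φ x + (r x * ‖fderiv ℝ φ x‖) ^ 2) K := fun x hx =>
      ((hφ.smooth x hx.1).continuousAt.add
        (((hrc x).mul (hφd x hx.1)).pow 2)).continuousWithinAt
    obtain ⟨x, hx, hmin⟩ := hKc.exists_isMinOn h hcont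
    refine ⟨(φ x + (r x * ‖fderiv ℝ φ x‖) ^ 2) / 2, ?_, fun y hy => ?_⟩
    · by_cases hxΩ : x ∈ Ω
      · have := hφ.pos x hxΩ
        positivity
      · have hf : x ∈ frontier Ω := by rw [hΩ.isOpen.frontier_eq]; exact ⟨hx.1, hxΩ⟩
        have h1 := hφ.eq_zero x hf
        have h2 : 0 < ‖fderiv ℝ φ x‖ := norm_pos_iff.2 (hφ.grad_ne_zero x hf)
        have h3 := hr.pos x
        rw [h1]; positivity
    · have : φ x + (r x * ‖fderiv ℝ φ x‖) ^ 2 ≤ φ y + (r y * ‖fderiv ℝ φ y‖) ^ 2 := hmin hy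
      linarith
  have hsΩ : ∀ x ∈ Ω, 2 * s ≤ φ x + (r x * ‖fderiv ℝ φ x‖) ^ 2 := by
    refine hΩ.forall_of_scaling (fun x hx h2 => hsK x (hKΩ x hx h2)) fun x hx h1 c hc h => ?_
    rwa [hφ.conical x hx h1.le c hc, hns _ _ x c hc h1 (hdφ x hx h1 c hc)]
  have hCle : ∀ a ∈ [C₁, C₂, C₃, C₄, C₅], a ≤ 1 + |C₁| + |C₂| + |C₃| + |C₄| + |C₅| := by
    intro a ha
    have i1 := abs_nonneg C₁
    have i2 := abs_nonneg C₂
    have i3 := abs_nonneg C₃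
    have i4 := abs_nonneg C₄
    have i5 := abs_nonneg C₅
    have := le_abs_self a
    simp only [List.mem_cons, List.not_mem_nil, or_false] at ha
    rcases ha with rfl | rfl | rfl | rfl | rfl <;> linarith
  refine ⟨X, 1 + |C₁| + |C₂| + |C₃| + |C₄| + |C₅|, s, hΩ.isOpen, by positivity, hs,
    fun x _ => hr.pos x, hφ.pos, hr.smooth.contDiffOn,
    fun x hx => (hφ.smooth x (subset_closure hx)).contDiffWithinAt,
    fun x hx => (hXs x (subset_closure hx)).contDiffWithinAt,
    fun x hx => (h₁ x hx).trans (hCle _ (by simp)), fun x hx => (h₂ x hx).trans (hCle _ (by simp)),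
    fun x hx => (h₃ x hx).trans (hCle _ (by simp)), fun x hx => (h₄ x hx).trans (hCle _ (by simp)),
    fun x hx => (h₅ x hx).trans (hCle _ (by simp)), fun x hx hxs => ?_,
    fun τ R hτ => isCompact_levelSet (fun x hx => (hφ.smooth x hx).continuousAt) hφ.eq_zero
      hΩ.isOpen hτ⟩
  have := hsΩ x hx
  rw [hφX]
  nlinarith

end Bounds

/-! ### Weighted Korn inequality with a lower order term -/

section WeightedKorn

lemma ofReal_le_two_mul_add {a b c d : ℝ} (hb : 0 ≤ b) (hc : 0 ≤ c) (hd : 0 ≤ d)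
    (h : a ≤ 2 * b + c * d) : ENNReal.ofReal a ≤
      2 * ENNReal.ofReal b + ENNReal.ofReal c * ENNReal.ofReal d := by
  rw [← ENNReal.ofReal_ofNat 2, ← ENNReal.ofReal_mul (by positivity), ← ENNReal.ofReal_mul hc,
    ← ENNReal.ofReal_add (by positivity) (by positivity)]
  exact ENNReal.ofReal_le_ofReal h

variable {n : ℕ} {Ω : Set (EuclideanSpace ℝ (Fin n))} {r φ : EuclideanSpace ℝ (Fin n) → ℝ}
  {X : EuclideanSpace ℝ (Fin n) → EuclideanSpace ℝ (Fin n)} {C s : ℝ}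

namespace HasScaleBounds

lemma measurableSet_level (h : HasScaleBounds Ω r φ X C s) {τ : ℝ} (hτ : 0 < τ) :
    MeasurableSet {x | x ∈ Ω ∧ τ ≤ φ x} := by
  have : {x | x ∈ Ω ∧ τ ≤ φ x} = ⋃ k : ℕ, {x | x ∈ Ω ∧ τ ≤ φ x ∧ ‖x‖ ≤ k} := by
    ext x
    simp only [Set.mem_ofPred_eq, Set.mem_iUnion, exists_and_left]
    exact ⟨fun hx => ⟨hx.1, hx.2, exists_nat_ge _⟩, fun hx => ⟨hx.1, hx.2.1⟩⟩
  rw [this]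
  exact MeasurableSet.iUnion fun k => (h.isCompact τ k hτ).measurableSet

/-- Monotone convergence over the levels 1/(k+1). It allows each estimate to be proved with a
cutoff, as long as the bound is uniform in the level, and requires no finiteness. -/
lemma lintegral_le_of_level (h : HasScaleBounds Ω r φ X C s)
    {f : EuclideanSpace ℝ (Fin n) → ENNReal} {R : ENNReal}
    (hR : ∀ τ : ℝ, 0 < τ → ∫⁻ x in {x | x ∈ Ω ∧ τ ≤ φ x}, f x ≤ R) : ∫⁻ x in Ω, f x ≤ R := by
  have hU : Ω = ⋃ k : ℕ, {x | x ∈ Ω ∧ 1 / ((k : ℝ) + 1) ≤ φ x} := by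
    ext x
    simp only [Set.mem_iUnion, Set.mem_ofPred_eq, exists_and_left, iff_self_and]
    intro hx
    obtain ⟨k, hk⟩ := exists_nat_one_div_lt (h.φ_pos x hx)
    exact ⟨k, hk.le⟩
  have hd : Directed (· ⊆ ·) fun k : ℕ => {x | x ∈ Ω ∧ 1 / ((k : ℝ) + 1) ≤ φ x} := by
    refine directed_of_isDirected_le fun i j hij x hx => ⟨hx.1, le_trans ?_ hx.2⟩
    exact one_div_le_one_div_of_le (by positivity) (by gcongr)
  rw [hU, setLIntegral_iUnion_of_directed f hd]
  exact iSup_le fun k => hR _ (by positivity)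

lemma isCompact_support (h : HasScaleBounds Ω r φ X C s) {τ : ℝ} (hτ : 0 < τ)
    {Z : EuclideanSpace ℝ (Fin n) → EuclideanSpace ℝ (Fin n)} (hZ : IsSmoothBddSupp Ω Z) :
    ∃ H, IsCompact H ∧ H ⊆ Ω ∧ ∀ x ∈ Ω, x ∉ H → φ x < τ ∨ Z x = 0 := by
  obtain ⟨R, hR⟩ := hZ.2.subset_closedBall 0
  refine ⟨_, h.isCompact τ R hτ, fun x hx => hx.1, fun x hx hxH => ?_⟩
  by_contra! hcon
  refine hxH ⟨hx, hcon.1, ?_⟩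
  simpa using hR ⟨hx, hcon.2⟩

lemma hasFDerivAt_weight (h : HasScaleBounds Ω r φ X C s) {x : EuclideanSpace ℝ (Fin n)}
    (hx : x ∈ Ω) (k : ℕ) (τ b : ℝ) :
    HasFDerivAt (fun x => φ x ^ (k + 1) * levelCutoff τ (φ x) * r x ^ b)
      ((φ x ^ (k + 1) * levelCutoff τ (φ x)) • (b * r x ^ (b - 1)) • fderiv ℝ r x +
        r x ^ b • ((k + 1) * φ x ^ k * levelCutoff τ (φ x) +
          φ x ^ (k + 1) * deriv (levelCutoff τ) (φ x)) • fderiv ℝ φ x) x := by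
  have hφ : HasFDerivAt φ (fderiv ℝ φ x) x :=
    ((h.φ_smooth.differentiableOn (by simp)).differentiableAt (h.isOpen.mem_nhds hx)).hasFDerivAt
  have hr : HasFDerivAt r (fderiv ℝ r x) x :=
    ((h.r_smooth.differentiableOn (by simp)).differentiableAt (h.isOpen.mem_nhds hx)).hasFDerivAt
  have hk : HasDerivAt (levelCutoff τ) (deriv (levelCutoff τ) (φ x)) (φ x) :=
    ((contDiff_levelCutoff τ).differentiable (by simp) (φ x)).hasDerivAt
  have hg : HasDerivAt (fun t => t ^ (k + 1) * levelCutoff τ t)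
      ((k + 1) * φ x ^ k * levelCutoff τ (φ x) +
          φ x ^ (k + 1) * deriv (levelCutoff τ) (φ x)) (φ x) := by
    have := (hasDerivAt_pow (k + 1) (φ x)).mul hk
    simp only [Nat.cast_add, Nat.cast_one, Nat.add_sub_cancel] at this
    exact this
  exact (hg.comp_hasFDerivAt x hφ).mul (hr.rpow_const (p := b) (.inl (h.r_pos x hx).ne'))

lemma contDiffOn_weight (h : HasScaleBounds Ω r φ X C s) (k : ℕ) (τ b : ℝ) :
    ContDiffOn ℝ ∞ (fun x => φ x ^ k * levelCutoff τ (φ x) * r x ^ b) Ω :=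
  ((h.φ_smooth.pow k).mul ((contDiff_levelCutoff τ).comp_contDiffOn h.φ_smooth)).mul
    (h.r_smooth.rpow_const_of_ne fun x hx => (h.r_pos x hx).ne')

/-- One derivative lowers the powers of φ and r by one each. The constant is uniform in τ because t
times the derivative of the cutoff is. -/
lemma exists_norm_fderiv_weight_le (h : HasScaleBounds Ω r φ X C s) (k : ℕ) (b : ℝ) :
    ∃ C' : ℝ, 0 ≤ C' ∧ ∀ τ : ℝ, 0 < τ → ∀ x ∈ Ω,
      ‖fderiv ℝ (fun x => φ x ^ (k + 1) * levelCutoff τ (φ x) * r x ^ b) x‖ ≤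
        C' * (φ x ^ k * r x ^ (b - 1)) := by
  obtain ⟨M, hM0, hM⟩ := exists_mul_deriv_levelCutoff_le
  have hC := h.C_pos
  refine ⟨C * |b| * C + (k + 1 + M) * C, by positivity, fun τ hτ x hx => ?_⟩
  rw [(h.hasFDerivAt_weight hx k τ b).fderiv]
  have hr := h.r_pos x hx
  have hφ := h.φ_pos x hx
  have k0 := levelCutoff_nonneg τ (φ x)
  have k1 := levelCutoff_le_one τ (φ x)
  have d0 := deriv_levelCutoff_nonneg hτ (φ x)
  have hφk : 0 ≤ φ x ^ k := by positivity
  have hrb : 0 ≤ r x ^ (b - 1) := by positivity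
  have e1 : ‖(φ x ^ (k + 1) * levelCutoff τ (φ x)) • (b * r x ^ (b - 1)) • fderiv ℝ r x‖ ≤
      C * |b| * C * (φ x ^ k * r x ^ (b - 1)) := by
    rw [norm_smul, norm_smul, norm_mul, norm_mul, Real.norm_eq_abs, Real.norm_eq_abs,
      Real.norm_eq_abs, Real.norm_eq_abs, abs_of_nonneg k0, abs_of_nonneg hrb,
      abs_of_nonneg (by positivity : 0 ≤ φ x ^ (k + 1)), pow_succ]
    calc φ x ^ k * φ x * levelCutoff τ (φ x) * (|b| * r x ^ (b - 1) * ‖fderiv ℝ r x‖)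
        ≤ φ x ^ k * C * 1 * (|b| * r x ^ (b - 1) * C) := by
          gcongr
          · exact h.φ_le x hx
          · exact h.fderiv_r_le x hx
      _ = _ := by ring
  have e2 : ‖r x ^ b • ((k + 1) * φ x ^ k * levelCutoff τ (φ x) +
          φ x ^ (k + 1) * deriv (levelCutoff τ) (φ x)) • fderiv ℝ φ x‖ ≤
      (k + 1 + M) * C * (φ x ^ k * r x ^ (b - 1)) := by
    have hrb1 : r x ^ b = r x ^ (b - 1) * r x := by
      rw [Real.rpow_sub_one hr.ne']; field_simp
    have hsum : (k + 1) * φ x ^ k * levelCutoff τ (φ x) +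
        φ x ^ (k + 1) * deriv (levelCutoff τ) (φ x) ≤ φ x ^ k * (k + 1 + M) := by
      calc (k + 1) * φ x ^ k * levelCutoff τ (φ x) + φ x ^ (k + 1) * deriv (levelCutoff τ) (φ x)
          = φ x ^ k * ((k + 1) * levelCutoff τ (φ x) +
            φ x * deriv (levelCutoff τ) (φ x)) := by ring
        _ ≤ φ x ^ k * ((k + 1) * 1 + M) := by
            gcongr
            exact hM τ (φ x) hτ hφ
        _ = _ := by ring
    rw [norm_smul, norm_smul, Real.norm_eq_abs, Real.norm_eq_abs, abs_of_nonneg (by positivity),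
      abs_of_nonneg (by positivity), hrb1]
    calc _ ≤ r x ^ (b - 1) * r x * (φ x ^ k * (k + 1 + M) * ‖fderiv ℝ φ x‖) := by gcongr
      _ = r x ^ (b - 1) * φ x ^ k * (k + 1 + M) * (r x * ‖fderiv ℝ φ x‖) := by ring
      _ ≤ r x ^ (b - 1) * φ x ^ k * (k + 1 + M) * C := by
          gcongr
          exact h.fderiv_φ_le x hx
      _ = _ := by ring
  refine (norm_add_le _ _).trans ((add_le_add e1 e2).trans_eq ?_)
  ring

/-- Weighted Korn inequality with a lower order term. -/
lemma exists_weighted_korn (h : HasScaleBounds Ω r φ X C s) (m : ℕ) (β : ℝ) :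
    ∃ C' : NNReal, ∀ Z : EuclideanSpace ℝ (Fin n) → EuclideanSpace ℝ (Fin n),
      IsSmoothBddSupp Ω Z →
      ∫⁻ x in Ω, ENNReal.ofReal (gradNormSq (fderiv ℝ Z x) * r x ^ (β + 2) * φ x ^ (2 * m + 2)) ≤
        C' * ((∫⁻ x in Ω, ENNReal.ofReal
            (killingNormSq (fderiv ℝ Z x) * r x ^ (β + 2) * φ x ^ (2 * m + 2))) +
          ∫⁻ x in Ω, ENNReal.ofReal (‖Z x‖ ^ 2 * r x ^ β * φ x ^ (2 * m))) := by
  obtain ⟨C', hC'0, hC'⟩ := h.exists_norm_fderiv_weight_le m ((β + 2) / 2)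
  -- The final bound is 2(2 ID + 8C'² IZ) + 2C'² IZ = 4 ID + 18C'² IZ.
  set A : ℝ := max 4 (18 * C' ^ 2) with hA
  refine ⟨A.toNNReal, fun Z hZ => h.lintegral_le_of_level fun τ' hτ' => ?_⟩
  obtain ⟨τ, hτ, rfl⟩ : ∃ τ, 0 < τ ∧ τ' = 2 * τ := ⟨τ' / 2, by positivity, by ring⟩
  obtain ⟨H, hHc, hHΩ, hH⟩ := h.isCompact_support hτ hZ
  -- The square root of the weight, cut off so that `u • Z` has compact support in Ω and extends by
  -- zero.
  set u : EuclideanSpace ℝ (Fin n) → ℝ :=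
    fun x => φ x ^ (m + 1) * levelCutoff τ (φ x) * r x ^ ((β + 2) / 2) with hu
  have hus : ContDiffOn ℝ ∞ u Ω := h.contDiffOn_weight (m + 1) τ ((β + 2) / 2)
  set Y : EuclideanSpace ℝ (Fin n) → EuclideanSpace ℝ (Fin n) := fun x => u x • Z x with hY
  have hYs : ContDiffOn ℝ ∞ Y Ω := hus.smul hZ.1
  have hYz : ∀ x ∈ Ω, x ∉ H → Y x = 0 := by
    intro x hx hxH
    rcases hH x hx hxH with h1 | h1
    · simp only [hY, hu, levelCutoff_eq_zero hτ h1.le, mul_zero, zero_mul, zero_smul]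
    · simp only [hY, h1, smul_zero]
  have hkorn := lintegral_korn_of_hasCompactSupport
    (contDiff_infty.1 (contDiff_indicator h.isOpen hHc.isClosed hHΩ hYz hYs) 2)
    (hasCompactSupport_indicator hHc hYz)
  have hfd : ∀ x ∈ Ω, fderiv ℝ (Ω.indicator Y) x =
      u x • fderiv ℝ Z x + (fderiv ℝ u x).smulRight (Z x) := by
    intro x hx
    rw [fderiv_indicator_of_mem h.isOpen hx]
    exact fderiv_fun_smul
      ((hus.differentiableOn (by simp)).differentiableAt (h.isOpen.mem_nhds hx))
      ((hZ.1.differentiableOn (by simp)).differentiableAt (h.isOpen.mem_nhds hx))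
  have hsq : ∀ x ∈ Ω, u x ^ 2 ≤ r x ^ (β + 2) * φ x ^ (2 * m + 2) := by
    intro x hx
    have e : u x ^ 2 = r x ^ (β + 2) * φ x ^ (2 * m + 2) * levelCutoff τ (φ x) ^ 2 := by
      have : (r x ^ ((β + 2) / 2)) ^ 2 = r x ^ (β + 2) := by
        rw [← Real.rpow_natCast, ← Real.rpow_mul (h.r_pos x hx).le]
        norm_num
      simp only [hu, mul_pow, this]; ring
    have hr := h.r_pos x hx
    have hφ := h.φ_pos x hx
    rw [e]
    exact mul_le_of_le_one_right (by positivity)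
      (pow_le_one₀ (levelCutoff_nonneg _ _) (levelCutoff_le_one _ _))
  have hdu : ∀ x ∈ Ω, ‖fderiv ℝ u x‖ ^ 2 ≤ C' ^ 2 * (r x ^ β * φ x ^ (2 * m)) := by
    intro x hx
    have h1 := hC' τ hτ x hx
    have h2 : (r x ^ ((β + 2) / 2 - 1)) ^ 2 = r x ^ β := by
      rw [← Real.rpow_natCast, ← Real.rpow_mul (h.r_pos x hx).le]
      congr 1; push_cast; ring
    calc ‖fderiv ℝ u x‖ ^ 2 ≤ (C' * (φ x ^ m * r x ^ ((β + 2) / 2 - 1))) ^ 2 := by gcongr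
      _ = _ := by rw [mul_pow, mul_pow, h2]; ring
  have hpt : ∀ x ∈ Ω, killingNormSq (fderiv ℝ (Ω.indicator Y) x) ≤
      2 * (killingNormSq (fderiv ℝ Z x) * r x ^ (β + 2) * φ x ^ (2 * m + 2)) +
        8 * C' ^ 2 * (‖Z x‖ ^ 2 * r x ^ β * φ x ^ (2 * m)) := by
    intro x hx
    rw [hfd x hx]
    have h1 := killingNormSq_add_le (u x • fderiv ℝ Z x) ((fderiv ℝ u x).smulRight (Z x))
    have h2 := killingNormSq_le ((fderiv ℝ u x).smulRight (Z x))
    rw [gradNormSq_smulRight] at h2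
    rw [killingNormSq_smul] at h1
    have h3 := mul_le_mul_of_nonneg_right (hsq x hx) (killingNormSq_nonneg (fderiv ℝ Z x))
    have h4 := mul_le_mul_of_nonneg_right (hdu x hx) (sq_nonneg ‖Z x‖)
    linarith
  have hKY : ∫⁻ x, ENNReal.ofReal (killingNormSq (fderiv ℝ (Ω.indicator Y) x)) ≤
      ∫⁻ x in Ω, ENNReal.ofReal (killingNormSq (fderiv ℝ (Ω.indicator Y) x)) := by
    rw [← lintegral_indicator h.isOpen.measurableSet]
    refine lintegral_mono fun x => ?_
    by_cases hx : x ∈ Ω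
    · rw [Set.indicator_of_mem hx]
    · rw [fderiv_indicator_of_notMem hHc.isClosed hYz (fun hxH => hx (hHΩ hxH))]
      simp [killingNormSq_eq_sum]
  have hm2 : AEMeasurable (fun x => ENNReal.ofReal (8 * C' ^ 2) * ENNReal.ofReal
      (‖Z x‖ ^ 2 * r x ^ β * φ x ^ (2 * m))) (volume.restrict Ω) := by
    have : ContinuousOn (fun x => ‖Z x‖ ^ 2 * r x ^ β * φ x ^ (2 * m)) Ω :=
      ((hZ.1.continuousOn.norm.pow 2).mul (h.r_smooth.continuousOn.rpow_const
        fun x hx => .inl (h.r_pos x hx).ne')).mul (h.φ_smooth.continuousOn.pow _)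
    exact (this.aemeasurable h.isOpen.measurableSet).ennreal_ofReal.const_mul _
  set ID := ∫⁻ x in Ω, ENNReal.ofReal
            (killingNormSq (fderiv ℝ Z x) * r x ^ (β + 2) * φ x ^ (2 * m + 2)) with hID
  set IZ := ∫⁻ x in Ω, ENNReal.ofReal (‖Z x‖ ^ 2 * r x ^ β * φ x ^ (2 * m)) with hIZ
  have hIK : ∫⁻ x, ENNReal.ofReal (killingNormSq (fderiv ℝ (Ω.indicator Y) x)) ≤
      2 * ID + ENNReal.ofReal (8 * C' ^ 2) * IZ := by
    refine hKY.trans ?_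
    rw [hID, hIZ, ← lintegral_const_mul' _ _ (by finiteness),
      ← lintegral_const_mul' _ _ (by finiteness), ← lintegral_add_right' _ hm2]
    refine setLIntegral_mono_ae' h.isOpen.measurableSet (.of_forall fun x hx => ?_)
    have hr := h.r_pos x hx
    have hφ := h.φ_pos x hx
    have hk := killingNormSq_nonneg (fderiv ℝ Z x)
    exact ofReal_le_two_mul_add (by positivity) (by positivity) (by positivity) (hpt x hx)
  -- Where the cutoff equals 1, u² is the full weight and u ∇Z = ∇(uZ) - ∇u ⊗ Z.
  have hg : ∀ x ∈ Ω, 2 * τ ≤ φ x → gradNormSq (fderiv ℝ Z x) * r x ^ (β + 2) * φ x ^ (2 * m + 2) ≤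
      2 * gradNormSq (fderiv ℝ (Ω.indicator Y) x) +
        2 * C' ^ 2 * (‖Z x‖ ^ 2 * r x ^ β * φ x ^ (2 * m)) := by
    intro x hx hxτ
    have e : u x ^ 2 = r x ^ (β + 2) * φ x ^ (2 * m + 2) := by
      have : (r x ^ ((β + 2) / 2)) ^ 2 = r x ^ (β + 2) := by
        rw [← Real.rpow_natCast, ← Real.rpow_mul (h.r_pos x hx).le]
        norm_num
      simp only [hu, mul_pow, this, levelCutoff_eq_one hτ hxτ]; ring
    have h1 := gradNormSq_add_le (fderiv ℝ (Ω.indicator Y) x) (-(fderiv ℝ u x).smulRight (Z x))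
    rw [gradNormSq_neg, gradNormSq_smulRight, hfd x hx, add_neg_cancel_right, gradNormSq_smul, e,
      ← hfd x hx] at h1
    have h4 := mul_le_mul_of_nonneg_right (hdu x hx) (sq_nonneg ‖Z x‖)
    linarith
  have hsub : {x | x ∈ Ω ∧ 2 * τ ≤ φ x} ⊆ Ω := fun x hx => hx.1
  have h4A : (4 : ENNReal) ≤ A.toNNReal := by
    rw [← ENNReal.ofReal_ofNat 4]
    exact ENNReal.ofReal_le_ofReal (le_max_left _ _)
  have h8A : ENNReal.ofReal (18 * C' ^ 2) ≤ A.toNNReal :=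
    ENNReal.ofReal_le_ofReal (le_max_right _ _)
  calc ∫⁻ x in {x | x ∈ Ω ∧ 2 * τ ≤ φ x},
        ENNReal.ofReal (gradNormSq (fderiv ℝ Z x) * r x ^ (β + 2) * φ x ^ (2 * m + 2))
      ≤ ∫⁻ x in {x | x ∈ Ω ∧ 2 * τ ≤ φ x}, (2 * ENNReal.ofReal
            (gradNormSq (fderiv ℝ (Ω.indicator Y) x)) + ENNReal.ofReal (2 * C' ^ 2) *
              ENNReal.ofReal (‖Z x‖ ^ 2 * r x ^ β * φ x ^ (2 * m))) := by
        refine setLIntegral_mono_ae' (h.measurableSet_level (by positivity))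
          (.of_forall fun x hx => ?_)
        have hr := h.r_pos x hx.1
        have hφ := h.φ_pos x hx.1
        have hk := gradNormSq_nonneg (fderiv ℝ (Ω.indicator Y) x)
        exact ofReal_le_two_mul_add hk (by positivity) (by positivity) (hg x hx.1 hx.2)
    _ = 2 * (∫⁻ x in {x | x ∈ Ω ∧ 2 * τ ≤ φ x}, ENNReal.ofReal
            (gradNormSq (fderiv ℝ (Ω.indicator Y) x))) + ENNReal.ofReal (2 * C' ^ 2) *
          ∫⁻ x in {x | x ∈ Ω ∧ 2 * τ ≤ φ x},
              ENNReal.ofReal (‖Z x‖ ^ 2 * r x ^ β * φ x ^ (2 * m)) := by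
        rw [lintegral_add_left, lintegral_const_mul' _ _ (by finiteness),
          lintegral_const_mul' _ _ (by finiteness)]
        exact (continuous_gradNormSq.measurable.comp (measurable_fderiv ℝ _)).ennreal_ofReal.const_mul
          2
    _ ≤ 2 * (2 * ID + ENNReal.ofReal (8 * C' ^ 2) * IZ) + ENNReal.ofReal (2 * C' ^ 2) * IZ := by
        gcongr
        · exact (setLIntegral_le_lintegral _ _).trans (hkorn.trans hIK)
        · exact lintegral_mono_set hsub
    _ = 4 * ID + ENNReal.ofReal (18 * C' ^ 2) * IZ := by
        have e : ENNReal.ofReal (18 * C' ^ 2) =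
            2 * ENNReal.ofReal (8 * C' ^ 2) + ENNReal.ofReal (2 * C' ^ 2) := by
          rw [← ENNReal.ofReal_ofNat 2, ← ENNReal.ofReal_mul (by positivity),
            ← ENNReal.ofReal_add (by positivity) (by positivity)]
          congr 1; ring
        rw [e]; ring
    _ ≤ A.toNNReal * ID + A.toNNReal * IZ := by gcongr
    _ = _ := by ring

end HasScaleBounds

end WeightedKorn

/-! ### Hardy inequality at the boundary through the Killing tensor -/

section WeightedHardy

/-- Algebraic core of the Hardy inequality: a lower bound for the divergence of the test field. -/
lemma hardy_lower_bound {s C C₁ C₂ C₃ C₄ C₅ K K' p A B h z w δ : ℝ} {m : ℕ} (hs : 0 < s)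
    (hC₄ : 0 ≤ C₄) (hC₅ : 0 ≤ C₅) (hK : 0 ≤ K) (hK' : 0 ≤ K')
    (hp : 0 < p) (hpC : p ≤ C) (hz : 0 ≤ z) (hB : |B| ≤ C₁) (hh : |h| ≤ C₂ * z)
    (hw : |w| ≤ C₃ * δ + C₄ * z) (hA : |A| ≤ C₅) (hAs : p < s → s / 2 ≤ A)
    (hKs : s ≤ p → K' = 0) :
    K * (s / 4 * p ^ (2 * m) * h ^ 2 - (C₁ * C₂ ^ 2 + 2 * C₂ * C₄) * p ^ (2 * m + 1) * z ^ 2 -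
        4 * C₃ ^ 2 / s * p ^ (2 * m + 2) * δ ^ 2 -
        ((2 * m + 1) * C₅ + s / 2) * C ^ (2 * m) * C₂ ^ 2 * (if s ≤ p then z ^ 2 else 0)) ≤
      h ^ 2 * (((2 * m : ℕ) + 1) * p ^ (2 * m) * K + p ^ (2 * m + 1) * K') * A +
        h ^ 2 * (p ^ (2 * m + 1) * K * B) + 2 * (p ^ (2 * m + 1) * K) * h * w := by
  -- Intended meaning, with W the test direction: p = φ, K and K' are the cutoff and its derivative
  -- at φ, h = ⟨Z, W⟩, z = |Z|, δ = r |𝒟(Z)|, A = r ∂_Wφ, w = r ∂_W h, and B collects the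
  -- derivatives of r and W.
  have hP : 0 < p ^ (2 * m) := by positivity
  have hPC : p ^ (2 * m) ≤ C ^ (2 * m) := pow_le_pow_left₀ hp.le hpC _
  rw [show p ^ (2 * m + 1) = p ^ (2 * m) * p by ring,
    show p ^ (2 * m + 2) = p ^ (2 * m) * p ^ 2 by ring]
  set P := p ^ (2 * m)
  have hC₁ : 0 ≤ C₁ := (abs_nonneg _).trans hB
  have hh2 : h ^ 2 ≤ C₂ ^ 2 * z ^ 2 := by
    rw [← sq_abs h, ← mul_pow]; exact pow_le_pow_left₀ (abs_nonneg _) hh 2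
  have t2 : -(C₁ * C₂ ^ 2 * z ^ 2) ≤ h ^ 2 * B := by
    have h1 : -(h ^ 2 * C₁) ≤ h ^ 2 * B := by
      have := neg_le_of_abs_le hB
      nlinarith [sq_nonneg h]
    nlinarith
  -- Young's inequality, balanced so that the Killing term consumes only s/4 of the s/2 available
  -- from the main term.
  have t3 : -(s / 4 * h ^ 2 + 4 * C₃ ^ 2 / s * (p * δ) ^ 2 + 2 * C₂ * C₄ * p * z ^ 2) ≤
      2 * p * (h * w) := by
    have h1 : -(|h| * (C₃ * δ + C₄ * z)) ≤ h * w := by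
      have : |h * w| ≤ |h| * (C₃ * δ + C₄ * z) := by
        rw [abs_mul]; exact mul_le_mul_of_nonneg_left hw (abs_nonneg _)
      exact neg_le_of_abs_le this
    have h2 : 2 * p * (|h| * (C₃ * δ)) ≤ s / 4 * h ^ 2 + 4 * C₃ ^ 2 / s * (p * δ) ^ 2 := by
      have h3 : 0 ≤ (s * |h| / 2 - 2 * C₃ * (p * δ)) ^ 2 / s := by positivity
      have h4 : (s * |h| / 2 - 2 * C₃ * (p * δ)) ^ 2 / s =
          s / 4 * h ^ 2 + 4 * C₃ ^ 2 / s * (p * δ) ^ 2 - 2 * p * (|h| * (C₃ * δ)) := by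
        rw [← sq_abs h]; field_simp; ring
      linarith
    have h5 : |h| * (C₄ * z) ≤ C₂ * z * (C₄ * z) :=
      mul_le_mul_of_nonneg_right hh (by positivity)
    have h6 := mul_le_mul_of_nonneg_left h1 (by positivity : 0 ≤ 2 * p)
    have h7 := mul_le_mul_of_nonneg_left h5 (by positivity : 0 ≤ 2 * p)
    linarith
  -- For p < s transversality gives A ≥ s/2 and the derivative of the cutoff contributes with the
  -- good sign. For p ≥ s that derivative vanishes and the whole term is charged to the interior
  -- error.
  have t1 : P * K * (s / 2 * h ^ 2) -
      K * (((2 * m + 1) * C₅ + s / 2) * C ^ (2 * m) * C₂ ^ 2 * (if s ≤ p then z ^ 2 else 0)) ≤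
      h ^ 2 * (((2 * m : ℕ) + 1) * P * K + P * p * K') * A := by
    push_cast
    rcases lt_or_ge p s with hps | hps
    · rw [if_neg (not_le.2 hps)]
      have hA2 := hAs hps
      have h1 : P * K ≤ (2 * m + 1) * P * K + P * p * K' := by
        have : 0 ≤ 2 * (m : ℝ) * P * K + P * p * K' := by positivity
        linarith
      have h2 : h ^ 2 * (P * K) * (s / 2) ≤ h ^ 2 * ((2 * m + 1) * P * K + P * p * K') * A := by
        gcongr
      linarith
    · rw [if_pos hps, hKs hps]
      have h1 : -C₅ ≤ A := neg_le_of_abs_le hA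
      have h2 : (2 * m + 1) * (P * K * h ^ 2) * -C₅ ≤ (2 * m + 1) * (P * K * h ^ 2) * A := by gcongr
      have hC0 : 0 ≤ C ^ (2 * m) := hP.le.trans hPC
      have h3 : P * K * h ^ 2 ≤ C ^ (2 * m) * K * (C₂ ^ 2 * z ^ 2) := by gcongr
      have h4 : ((2 * m + 1) * C₅ + s / 2) * (P * K * h ^ 2) ≤
        ((2 * m + 1) * C₅ + s / 2) * (C ^ (2 * m) * K * (C₂ ^ 2 * z ^ 2)) := by gcongr
      linarith
  have e2 := mul_le_mul_of_nonneg_left t2 (by positivity : 0 ≤ P * p * K)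
  have e3 := mul_le_mul_of_nonneg_left t3 (by positivity : 0 ≤ P * K)
  linarith

variable {n : ℕ} {Ω : Set (EuclideanSpace ℝ (Fin n))} {r φ : EuclideanSpace ℝ (Fin n) → ℝ}
  {X : EuclideanSpace ℝ (Fin n) → EuclideanSpace ℝ (Fin n)} {C s : ℝ}

namespace HasScaleBounds

/-- The test field in the proof of the Hardy inequality. -/
noncomputable def testField (r φ : EuclideanSpace ℝ (Fin n) → ℝ)
    (X Z : EuclideanSpace ℝ (Fin n) → EuclideanSpace ℝ (Fin n)) (m : ℕ) (β τ : ℝ)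
    (v : EuclideanSpace ℝ (Fin n)) (x : EuclideanSpace ℝ (Fin n)) : EuclideanSpace ℝ (Fin n) :=
  ((φ x ^ (2 * m + 1) * levelCutoff τ (φ x) * r x ^ (β + 1)) * inner ℝ (Z x) (X x + v) ^ 2) •
    (X x + v)

lemma contDiffOn_testField (h : HasScaleBounds Ω r φ X C s)
    {Z : EuclideanSpace ℝ (Fin n) → EuclideanSpace ℝ (Fin n)} (hZ : ContDiffOn ℝ ∞ Z Ω) (m : ℕ)
    (β τ : ℝ) (v : EuclideanSpace ℝ (Fin n)) : ContDiffOn ℝ ∞ (testField r φ X Z m β τ v) Ω := by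
  have hX : ContDiffOn ℝ ∞ (fun x => X x + v) Ω := h.X_smooth.add contDiffOn_const
  exact ((h.contDiffOn_weight (2 * m + 1) τ (β + 1)).mul ((hZ.inner ℝ hX).pow 2)).smul hX

/-- The derivative of ⟨Z, W⟩ along W = X + v is ⟨D_W Z, W⟩ + ⟨Z, D_W X⟩: by using W both as
direction and as component, only 𝒟(Z)(W, W) appears. -/
lemma euclideanDiv_testField (h : HasScaleBounds Ω r φ X C s)
    {Z : EuclideanSpace ℝ (Fin n) → EuclideanSpace ℝ (Fin n)} (hZ : ContDiffOn ℝ ∞ Z Ω) (m : ℕ)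
    (β τ : ℝ) (v : EuclideanSpace ℝ (Fin n)) {x : EuclideanSpace ℝ (Fin n)} (hx : x ∈ Ω) :
    euclideanDiv (testField r φ X Z m β τ v) x = r x ^ β *
      (inner ℝ (Z x) (X x + v) ^ 2 * (((2 * m : ℕ) + 1) * φ x ^ (2 * m) * levelCutoff τ (φ x) +
          φ x ^ (2 * m + 1) * deriv (levelCutoff τ) (φ x)) * (r x * fderiv ℝ φ x (X x + v)) +
        inner ℝ (Z x) (X x + v) ^ 2 * (φ x ^ (2 * m + 1) * levelCutoff τ (φ x) *
          ((β + 1) * fderiv ℝ r x (X x + v) + r x * euclideanDiv X x)) +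
        2 * (φ x ^ (2 * m + 1) * levelCutoff τ (φ x)) * inner ℝ (Z x) (X x + v) *
          (r x * (killing (fderiv ℝ Z x) (X x + v) (X x + v) / 2 +
            inner ℝ (Z x) (fderiv ℝ X x (X x + v))))) := by
  have hr := h.r_pos x hx
  have hXd : HasFDerivAt (fun x => X x + v) (fderiv ℝ X x) x :=
    ((h.X_smooth.differentiableOn (by simp)).differentiableAt
      (h.isOpen.mem_nhds hx)).hasFDerivAt.add_const v
  have hZd : HasFDerivAt Z (fderiv ℝ Z x) x :=
    ((hZ.differentiableOn (by simp)).differentiableAt (h.isOpen.mem_nhds hx)).hasFDerivAt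
  have hwt := h.hasFDerivAt_weight hx (2 * m) τ (β + 1)
  have hin := (hZd.inner ℝ hXd).pow 2
  have hF := hwt.mul hin
  have hdivX : euclideanDiv (fun x => X x + v) x = euclideanDiv X x := by
    rw [euclideanDiv, hXd.fderiv]; rfl
  have h1 := euclideanDiv_smul hF.differentiableAt hXd.differentiableAt
  rw [hF.fderiv, hdivX] at h1
  have h2 : euclideanDiv (testField r φ X Z m β τ v) x = _ := h1
  rw [h2]
  have hrβ : r x ^ (β + 1) = r x ^ β * r x := Real.rpow_add_one hr.ne' β
  simp only [add_apply, smul_apply, smul_eq_mul, Pi.mul_apply,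
    ContinuousLinearMap.comp_apply, ContinuousLinearMap.prod_apply, fderivInnerCLM_apply,
    killing_self, hrβ, add_sub_cancel_right, nsmul_eq_mul]
  rw [real_inner_comm (X x + v) (fderiv ℝ Z x (X x + v))]
  push_cast
  ring

/-- Lower bound for the divergence of the test fields. -/
lemma exists_le_euclideanDiv_testField (h : HasScaleBounds Ω r φ X C s) (m : ℕ) (β : ℝ) :
    ∃ c₁ c₂ c₃ : ℝ, 0 ≤ c₁ ∧ 0 ≤ c₂ ∧ 0 ≤ c₃ ∧
      ∀ Z : EuclideanSpace ℝ (Fin n) → EuclideanSpace ℝ (Fin n), ContDiffOn ℝ ∞ Z Ω →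
      ∀ τ : ℝ, 0 < τ → 2 * τ ≤ s → ∀ v : EuclideanSpace ℝ (Fin n), ‖v‖ ≤ s / (2 * C) →
      ∀ x ∈ Ω, r x ^ β * (levelCutoff τ (φ x) *
        (s / 4 * φ x ^ (2 * m) * inner ℝ (Z x) (X x + v) ^ 2 -
          c₁ * φ x ^ (2 * m + 1) * ‖Z x‖ ^ 2 -
          c₂ * φ x ^ (2 * m + 2) * (r x ^ 2 * killingNormSq (fderiv ℝ Z x)) -
          c₃ * (if s ≤ φ x then ‖Z x‖ ^ 2 else 0))) ≤
        euclideanDiv (testField r φ X Z m β τ v) x := by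
  have hC := h.C_pos
  have hs := h.s_pos
  -- The resulting bound for |X + v|.
  set C₂ := C + s / (2 * C) with hC₂
  have hC₂0 : 0 ≤ C₂ := by positivity
  refine ⟨(|β + 1| * (C * C₂) + n * C) * C₂ ^ 2 + 2 * C₂ * (C * C₂), 4 * (C₂ ^ 2 / 2) ^ 2 / s,
    ((2 * m + 1) * (C * C₂) + s / 2) * C ^ (2 * m) * C₂ ^ 2, by positivity, by positivity,
    by positivity, fun Z hZ τ hτ hτs v hv x hx => ?_⟩
  rw [h.euclideanDiv_testField hZ m β τ v hx]
  have hr := h.r_pos x hx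
  refine mul_le_mul_of_nonneg_left ?_ (by positivity)
  have hXv : ‖X x + v‖ ≤ C₂ := (norm_add_le _ _).trans (add_le_add (h.X_le x hx) hv)
  have hop : ∀ {F : Type} [NormedAddCommGroup F] [NormedSpace ℝ F]
      (L : EuclideanSpace ℝ (Fin n) →L[ℝ] F), r x * ‖L‖ ≤ C → r x * ‖L (X x + v)‖ ≤ C * C₂ := by
    intro F _ _ L hL
    calc r x * ‖L (X x + v)‖ ≤ r x * (‖L‖ * ‖X x + v‖) := by gcongr; exact L.le_opNorm _
      _ = (r x * ‖L‖) * ‖X x + v‖ := by ring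
      _ ≤ C * C₂ := by gcongr
  have hδ : (r x * √(killingNormSq (fderiv ℝ Z x))) ^ 2 =
      r x ^ 2 * killingNormSq (fderiv ℝ Z x) := by
    rw [mul_pow, Real.sq_sqrt (killingNormSq_nonneg _)]
  rw [← hδ]
  refine hardy_lower_bound (C₃ := C₂ ^ 2 / 2) (C₄ := C * C₂) (C₅ := C * C₂) hs (by positivity)
    (by positivity) (levelCutoff_nonneg _ _) (deriv_levelCutoff_nonneg hτ _) (h.φ_pos x hx)
    (h.φ_le x hx) (norm_nonneg _) ?_ ?_ ?_ ?_ ?_ ?_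
  · refine (abs_add_le _ _).trans (add_le_add ?_ ?_)
    · rw [abs_mul]
      gcongr
      refine ((fderiv ℝ r x).le_opNorm _).trans ?_
      gcongr
      exact h.fderiv_r_le x hx
    · rw [abs_mul, abs_of_pos hr]
      calc r x * |euclideanDiv X x| ≤ r x * (n * ‖fderiv ℝ X x‖) := by
            gcongr; exact abs_euclideanDiv_le X x
        _ = n * (r x * ‖fderiv ℝ X x‖) := by ring
        _ ≤ n * C := by gcongr; exact h.fderiv_X_le x hx
  · refine (abs_real_inner_le_norm _ _).trans ?_
    rw [mul_comm]; gcongr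
  · rw [abs_mul, abs_of_pos hr]
    have k1 : |killing (fderiv ℝ Z x) (X x + v) (X x + v)| ≤
        √(killingNormSq (fderiv ℝ Z x)) * C₂ ^ 2 := by
      rw [← Real.sqrt_sq_eq_abs]
      calc √(killing (fderiv ℝ Z x) (X x + v) (X x + v) ^ 2)
          ≤ √(killingNormSq (fderiv ℝ Z x) * (C₂ ^ 2) ^ 2) := by
            apply Real.sqrt_le_sqrt
            refine (killing_sq_le _ _ _).trans ?_
            rw [← sq, ← pow_mul, ← pow_mul]
            have := killingNormSq_nonneg (fderiv ℝ Z x)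
            gcongr
        _ = _ := by rw [Real.sqrt_mul (killingNormSq_nonneg _), Real.sqrt_sq (by positivity)]
    have k2 : r x * |inner ℝ (Z x) (fderiv ℝ X x (X x + v))| ≤ C * C₂ * ‖Z x‖ := by
      calc r x * |inner ℝ (Z x) (fderiv ℝ X x (X x + v))|
          ≤ r x * (‖Z x‖ * ‖fderiv ℝ X x (X x + v)‖) := by
            gcongr; exact abs_real_inner_le_norm _ _
        _ = (r x * ‖fderiv ℝ X x (X x + v)‖) * ‖Z x‖ := by ring
        _ ≤ _ := mul_le_mul_of_nonneg_right (hop _ (h.fderiv_X_le x hx)) (norm_nonneg _)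
    calc _ ≤ r x * (|killing (fderiv ℝ Z x) (X x + v) (X x + v)| / 2 +
          |inner ℝ (Z x) (fderiv ℝ X x (X x + v))|) := by
          gcongr
          refine (abs_add_le _ _).trans_eq ?_
          rw [abs_div, abs_two]
      _ = r x * (|killing (fderiv ℝ Z x) (X x + v) (X x + v)| / 2) +
          r x * |inner ℝ (Z x) (fderiv ℝ X x (X x + v))| := by ring
      _ ≤ r x * (√(killingNormSq (fderiv ℝ Z x)) * C₂ ^ 2 / 2) + C * C₂ * ‖Z x‖ := by gcongr
      _ = _ := by ring
  · rw [abs_mul, abs_of_pos hr]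
    exact hop _ (h.fderiv_φ_le x hx)
  -- The perturbation v changes r ∂φ by at most C · s/(2C) = s/2, leaving half of the transversality
  -- of X.
  · intro hφs
    have h1 := h.le_fderiv_φ x hx hφs
    have h2 : r x * |fderiv ℝ φ x v| ≤ s / 2 := by
      calc r x * |fderiv ℝ φ x v| ≤ r x * (‖fderiv ℝ φ x‖ * ‖v‖) := by
            gcongr; exact (fderiv ℝ φ x).le_opNorm v
        _ = (r x * ‖fderiv ℝ φ x‖) * ‖v‖ := by ring
        _ ≤ C * (s / (2 * C)) := by gcongr; exact h.fderiv_φ_le x hx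
        _ = s / 2 := by field_simp
    have h3 : -(r x * |fderiv ℝ φ x v|) ≤ r x * fderiv ℝ φ x v := by
      have := neg_abs_le (fderiv ℝ φ x v)
      nlinarith
    rw [map_add, mul_add]
    linarith
  · exact fun hsφ => deriv_levelCutoff_eq_zero hτ (hτs.trans hsφ)

/-- Weighted Hardy inequality near the boundary, with the Killing tensor in place of the full
gradient. -/
lemma exists_weighted_hardy (h : HasScaleBounds Ω r φ X C s) (m : ℕ) (β : ℝ) :
    ∃ (C' : NNReal) (s' : ℝ), 0 < s' ∧
      ∀ Z : EuclideanSpace ℝ (Fin n) → EuclideanSpace ℝ (Fin n), IsSmoothBddSupp Ω Z →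
      ∫⁻ x in Ω, ENNReal.ofReal (‖Z x‖ ^ 2 * r x ^ β * φ x ^ (2 * m)) ≤
        C' * ((∫⁻ x in Ω, ENNReal.ofReal
            (killingNormSq (fderiv ℝ Z x) * r x ^ (β + 2) * φ x ^ (2 * m + 2))) +
          ∫⁻ x in {x | x ∈ Ω ∧ s' ≤ φ x}, ENNReal.ofReal (‖Z x‖ ^ 2 * r x ^ β)) := by
  obtain ⟨c₁, c₂, c₃, hc₁, hc₂, hc₃, key⟩ := h.exists_le_euclideanDiv_testField m β
  have hC := h.C_pos
  have hs := h.s_pos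
  -- κ is the largest admissible size of v. The main term will be s/4 · κ²/2 = 2c, with c defined
  -- below: one c absorbs the term with the extra power of φ, the other is kept.
  set κ := s / (2 * C) with hκ
  have hκ0 : 0 < κ := by positivity
  set c := s * κ ^ 2 / 16 with hc
  have hc0 : 0 < c := by positivity
  -- Below level s' the term 2n c₁ φ is at most c. The added 1 keeps the denominator positive.
  set s' := min s (c / (2 * n * c₁ + 1)) with hs'
  have hs'0 : 0 < s' := lt_min hs (by positivity)
  set c₄ := 2 * n * (c₁ * C ^ (2 * m + 1) + c₃) with hc₄
  have hc₄0 : 0 ≤ c₄ := by positivity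
  set A := max (2 * n * c₂) c₄ / c with hA
  refine ⟨A.toNNReal, s', hs'0, fun Z hZ => h.lintegral_le_of_level fun τ' hτ' => ?_⟩
  -- 2τ ≤ τ' makes the cutoff equal to 1 on the level set considered; 2τ ≤ s makes its derivative
  -- vanish where φ ≥ s.
  set τ := min τ' s / 2 with hτdef
  have hτ : 0 < τ := by positivity
  have h2τ : 2 * τ = min τ' s := by ring
  have hτs : 2 * τ ≤ s := h2τ ▸ min_le_right _ _
  have hττ' : 2 * τ ≤ τ' := h2τ ▸ min_le_left _ _
  obtain ⟨H, hHc, hHΩ, hH⟩ := h.isCompact_support hτ hZ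
  have hYz : ∀ v, ∀ x ∈ Ω, x ∉ H → testField r φ X Z m β τ v x = 0 := by
    intro v x hx hxH
    rcases hH x hx hxH with h1 | h1
    · simp only [testField, levelCutoff_eq_zero hτ h1.le, mul_zero, zero_mul, zero_smul]
    · simp [testField, h1]
  have hdiv : ∀ v, Integrable (euclideanDiv (Ω.indicator (testField r φ X Z m β τ v))) ∧
      ∫ x, euclideanDiv (Ω.indicator (testField r φ X Z m β τ v)) x = 0 := fun v =>
    integral_euclideanDiv (contDiff_infty.1 (contDiff_indicator h.isOpen hHc.isClosed hHΩ (hYz v)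
      (h.contDiffOn_testField hZ.1 m β τ v)) 1) (hasCompactSupport_indicator hHc (hYz v))
  have hdiv0 : ∀ v x, x ∉ Ω → euclideanDiv (Ω.indicator (testField r φ X Z m β τ v)) x = 0 := by
    intro v x hx
    rw [euclideanDiv, fderiv_indicator_of_notMem hHc.isClosed (hYz v) (fun hxH => hx (hHΩ hxH))]
    simp
  have hdivΩ : ∀ v, ∀ x ∈ Ω, euclideanDiv (Ω.indicator (testField r φ X Z m β τ v)) x =
      euclideanDiv (testField r φ X Z m β τ v) x := by
    intro v x hx
    rw [euclideanDiv, euclideanDiv, fderiv_indicator_of_mem h.isOpen hx]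
  set v : Fin n → EuclideanSpace ℝ (Fin n) := fun i => κ • EuclideanSpace.single i (1 : ℝ) with hv
  -- Each perturbed direction X + κeᵢ is paired with a copy of the unperturbed X, so that the i-th
  -- component of Z can be isolated. Being a sum of divergences, G has mean zero.
  set G : EuclideanSpace ℝ (Fin n) → ℝ := fun x => ∑ i,
    (euclideanDiv (Ω.indicator (testField r φ X Z m β τ (v i))) x +
      euclideanDiv (Ω.indicator (testField r φ X Z m β τ 0)) x) with hG
  have hGi : Integrable G := integrable_finsetSum _ fun i _ => (hdiv (v i)).1.add (hdiv 0).1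
  have hG0 : ∫ x in Ω, G x = 0 := by
    rw [setIntegral_eq_integral_of_forall_compl_eq_zero (fun x hx => by
      simp only [hG, hdiv0 _ x hx]; simp), hG,
      integral_finsetSum _ fun i _ => (by exact (hdiv (v i)).1.add (hdiv 0).1)]
    refine Finset.sum_eq_zero fun i _ => ?_
    rw [integral_add (hdiv (v i)).1 (hdiv 0).1, (hdiv (v i)).2, (hdiv 0).2, add_zero]
  set Q : EuclideanSpace ℝ (Fin n) → ℝ := fun x =>
    2 * n * c₂ * (killingNormSq (fderiv ℝ Z x) * r x ^ (β + 2) * φ x ^ (2 * m + 2)) +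
      c₄ * ({x | x ∈ Ω ∧ s' ≤ φ x}.indicator (fun x => ‖Z x‖ ^ 2 * r x ^ β) x) with hQ
  have hlower : ∀ x ∈ Ω, levelCutoff τ (φ x) * (c * (‖Z x‖ ^ 2 * r x ^ β * φ x ^ (2 * m))) ≤
      G x + Q x := by
    intro x hx
    have hr := h.r_pos x hx
    have hφ := h.φ_pos x hx
    have hk0 := levelCutoff_nonneg τ (φ x)
    have hk1 := levelCutoff_le_one τ (φ x)
    have hrβ : r x ^ (β + 2) = r x ^ β * r x ^ 2 := by
      rw [Real.rpow_add hr]; norm_num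
    have hind : {x | x ∈ Ω ∧ s' ≤ φ x}.indicator (fun x => ‖Z x‖ ^ 2 * r x ^ β) x =
        r x ^ β * (if s' ≤ φ x then ‖Z x‖ ^ 2 else 0) := by
      by_cases hxs : s' ≤ φ x
      · rw [Set.indicator_of_mem (by exact ⟨hx, hxs⟩), if_pos hxs, mul_comm]
      · rw [Set.indicator_of_notMem (fun hcon => hxs hcon.2), if_neg hxs, mul_zero]
    -- With a = ⟨Z, X⟩ and b = κZᵢ: (a + b)² + a² - b²/2 = (2a + b)²/2 ≥ 0.
    have hsumsq : κ ^ 2 / 2 * ‖Z x‖ ^ 2 ≤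
        ∑ i, (inner ℝ (Z x) (X x + v i) ^ 2 + inner ℝ (Z x) (X x + 0) ^ 2) := by
      rw [EuclideanSpace.norm_sq_eq, Finset.mul_sum]
      refine Finset.sum_le_sum fun i _ => ?_
      have e : (inner ℝ (Z x) (X x + v i) : ℝ) = inner ℝ (Z x) (X x + 0) + κ * Z x i := by
        rw [hv, add_zero, inner_add_right, real_inner_smul_right, inner_single_one]
      rw [e, Real.norm_eq_abs, sq_abs]
      nlinarith [sq_nonneg (2 * inner ℝ (Z x) (X x + 0) + κ * Z x i)]
    have hGx : r x ^ β * (levelCutoff τ (φ x) * (s / 4 * φ x ^ (2 * m) *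
        (∑ i, (inner ℝ (Z x) (X x + v i) ^ 2 + inner ℝ (Z x) (X x + 0) ^ 2)) -
          2 * n * (c₁ * φ x ^ (2 * m + 1) * ‖Z x‖ ^ 2 +
          c₂ * φ x ^ (2 * m + 2) * (r x ^ 2 * killingNormSq (fderiv ℝ Z x)) +
          c₃ * (if s ≤ φ x then ‖Z x‖ ^ 2 else 0)))) ≤ G x := by
      have h0 := key Z hZ.1 τ hτ hτs 0 (by rw [norm_zero]; exact hκ0.le) x hx
      have h1 := fun i => key Z hZ.1 τ hτ hτs (v i) (by
        rw [hv, norm_smul, Real.norm_eq_abs, abs_of_pos hκ0]; simp [hκ]) x hx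
      have h2 := Finset.sum_le_sum fun i (_ : i ∈ Finset.univ) => add_le_add (h1 i) h0
      simp only [hG, hdivΩ _ x hx]
      refine le_trans (le_of_eq ?_) h2
      simp only [← mul_add, ← Finset.mul_sum]
      congr 2
      simp only [Finset.sum_add_distrib, Finset.sum_sub_distrib, Finset.sum_const,
        Finset.card_univ, Fintype.card_fin, nsmul_eq_mul, ← Finset.mul_sum]
      ring
    have hP : 0 < φ x ^ (2 * m) := by positivity
    have hc1φ : 2 * n * c₁ * φ x ^ (2 * m + 1) * ‖Z x‖ ^ 2 ≤ c * φ x ^ (2 * m) * ‖Z x‖ ^ 2 +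
        2 * n * c₁ * C ^ (2 * m + 1) * (if s' ≤ φ x then ‖Z x‖ ^ 2 else 0) := by
      by_cases hxs : s' ≤ φ x
      · rw [if_pos hxs]
        have h1 : φ x ^ (2 * m + 1) ≤ C ^ (2 * m + 1) := pow_le_pow_left₀ hφ.le (h.φ_le x hx) _
        have h2 : 2 * n * c₁ * φ x ^ (2 * m + 1) * ‖Z x‖ ^ 2 ≤
          2 * n * c₁ * C ^ (2 * m + 1) * ‖Z x‖ ^ 2 := by gcongr
        have h3 : 0 ≤ c * φ x ^ (2 * m) * ‖Z x‖ ^ 2 := by positivity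
        linarith
      · rw [if_neg hxs, mul_zero, add_zero]
        have h1 : φ x ≤ c / (2 * n * c₁ + 1) := (not_le.1 hxs).le.trans (min_le_right _ _)
        rw [le_div_iff₀ (by positivity)] at h1
        have h2 : 2 * n * c₁ * φ x ≤ c := by linarith
        calc 2 * n * c₁ * φ x ^ (2 * m + 1) * ‖Z x‖ ^ 2
            = (2 * n * c₁ * φ x) * φ x ^ (2 * m) * ‖Z x‖ ^ 2 := by ring
          _ ≤ _ := by gcongr
    have hif : (if s ≤ φ x then ‖Z x‖ ^ 2 else 0) ≤ (if s' ≤ φ x then ‖Z x‖ ^ 2 else 0) := by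
      by_cases hxs : s ≤ φ x
      · rw [if_pos hxs, if_pos ((min_le_left _ _).trans hxs)]
      · rw [if_neg hxs]; split_ifs <;> positivity
    have hI0 : 0 ≤ (if s' ≤ φ x then ‖Z x‖ ^ 2 else 0) := by split_ifs <;> positivity
    have hD0 := killingNormSq_nonneg (fderiv ℝ Z x)
    set I := (if s' ≤ φ x then ‖Z x‖ ^ 2 else 0)
    have hinner : c * (‖Z x‖ ^ 2 * φ x ^ (2 * m)) -
        (2 * n * c₂ * (r x ^ 2 * killingNormSq (fderiv ℝ Z x) * φ x ^ (2 * m + 2)) + c₄ * I) ≤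
        s / 4 * φ x ^ (2 * m) *
        (∑ i, (inner ℝ (Z x) (X x + v i) ^ 2 + inner ℝ (Z x) (X x + 0) ^ 2)) -
          2 * n * (c₁ * φ x ^ (2 * m + 1) * ‖Z x‖ ^ 2 +
          c₂ * φ x ^ (2 * m + 2) * (r x ^ 2 * killingNormSq (fderiv ℝ Z x)) +
          c₃ * (if s ≤ φ x then ‖Z x‖ ^ 2 else 0)) := by
      have h1 := mul_le_mul_of_nonneg_left hsumsq (by positivity : 0 ≤ s / 4 * φ x ^ (2 * m))
      have h2 := mul_le_mul_of_nonneg_left hif (by positivity : 0 ≤ 2 * n * c₃)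
      have e1 : s / 4 * φ x ^ (2 * m) * (κ ^ 2 / 2 * ‖Z x‖ ^ 2) =
        2 * (c * (‖Z x‖ ^ 2 * φ x ^ (2 * m))) := by rw [hc]; ring
      have e2 : c₄ * I = 2 * n * c₁ * C ^ (2 * m + 1) * I + 2 * n * c₃ * I := by rw [hc₄]; ring
      linarith
    have hE0 : 0 ≤ 2 * n * c₂ * (r x ^ 2 * killingNormSq (fderiv ℝ Z x) * φ x ^ (2 * m + 2)) +
        c₄ * I := by positivity
    have h3 := mul_le_mul_of_nonneg_left hinner
      (by positivity : 0 ≤ r x ^ β * levelCutoff τ (φ x))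
    have h4 : levelCutoff τ (φ x) * (2 * n * c₂ * (r x ^ 2 * killingNormSq (fderiv ℝ Z x) *
        φ x ^ (2 * m + 2)) + c₄ * I) ≤ 2 * n * c₂ * (r x ^ 2 * killingNormSq (fderiv ℝ Z x) *
        φ x ^ (2 * m + 2)) + c₄ * I := mul_le_of_le_one_left hE0 hk1
    have h5 := mul_le_mul_of_nonneg_left h4 (by positivity : 0 ≤ r x ^ β)
    have h6 : Q x = r x ^ β * (2 * n * c₂ * (r x ^ 2 * killingNormSq (fderiv ℝ Z x) *
        φ x ^ (2 * m + 2)) + c₄ * I) := by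
      simp only [hQ, hind, hrβ]; ring
    rw [h6]
    linarith
  have hms := h.measurableSet_level hs'0
  have hQm : AEStronglyMeasurable Q (volume.restrict Ω) := by
    have hrc : ∀ b : ℝ, ContinuousOn (fun x => r x ^ b) Ω := fun b =>
      h.r_smooth.continuousOn.rpow_const fun x hx => .inl (h.r_pos x hx).ne'
    have hdZ : ContinuousOn (fderiv ℝ Z) Ω := hZ.1.continuousOn_fderiv_of_isOpen h.isOpen (by simp)
    have q1 : ContinuousOn (fun x =>
        killingNormSq (fderiv ℝ Z x) * r x ^ (β + 2) * φ x ^ (2 * m + 2)) Ω :=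
      ((continuous_killingNormSq.comp_continuousOn hdZ).mul (hrc _)).mul
        (h.φ_smooth.continuousOn.pow _)
    have q2 : ContinuousOn (fun x => ‖Z x‖ ^ 2 * r x ^ β) Ω :=
      (hZ.1.continuousOn.norm.pow 2).mul (hrc _)
    exact ((q1.aestronglyMeasurable h.isOpen.measurableSet).const_mul _).add
      (((q2.aestronglyMeasurable h.isOpen.measurableSet).indicator hms).const_mul _)
  have hQ0 : ∀ x ∈ Ω, 0 ≤ Q x := by
    intro x hx
    have hr := h.r_pos x hx
    have hφ := h.φ_pos x hx
    have hD0 := killingNormSq_nonneg (fderiv ℝ Z x)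
    have : 0 ≤ {x | x ∈ Ω ∧ s' ≤ φ x}.indicator (fun x => ‖Z x‖ ^ 2 * r x ^ β) x :=
      Set.indicator_apply_nonneg fun _ => by positivity
    simp only [hQ]
    positivity
  have hmain := lintegral_le_of_le_add (μ := volume.restrict Ω) hGi.restrict hG0
    (P := fun x => levelCutoff τ (φ x) * (c * (‖Z x‖ ^ 2 * r x ^ β * φ x ^ (2 * m))))
    (Q := Q) (by
      filter_upwards [ae_restrict_mem h.isOpen.measurableSet] with x hx
      have hr := h.r_pos x hx
      have hφ := h.φ_pos x hx
      have hk0 := levelCutoff_nonneg τ (φ x)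
      positivity)
    (by filter_upwards [ae_restrict_mem h.isOpen.measurableSet] with x hx using hQ0 x hx) hQm
    (by filter_upwards [ae_restrict_mem h.isOpen.measurableSet] with x hx using hlower x hx)
  set ID := ∫⁻ x in Ω, ENNReal.ofReal
            (killingNormSq (fderiv ℝ Z x) * r x ^ (β + 2) * φ x ^ (2 * m + 2)) with hID
  set IZ := ∫⁻ x in {x | x ∈ Ω ∧ s' ≤ φ x}, ENNReal.ofReal (‖Z x‖ ^ 2 * r x ^ β) with hIZ
  have hQle : ∫⁻ x in Ω, ENNReal.ofReal (Q x) ≤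
      ENNReal.ofReal (2 * n * c₂) * ID + ENNReal.ofReal c₄ * IZ := by
    have hIZ' : IZ = ∫⁻ x in Ω, {x | x ∈ Ω ∧ s' ≤ φ x}.indicator
        (fun x => ENNReal.ofReal (‖Z x‖ ^ 2 * r x ^ β)) x := by
      rw [lintegral_indicator hms, Measure.restrict_restrict hms, hIZ]
      congr 2
      ext x; simp only [Set.mem_ofPred_eq, Set.mem_inter_iff]; tauto
    rw [hIZ', hID, ← lintegral_const_mul' _ _ (by finiteness),
      ← lintegral_const_mul' _ _ (by finiteness), ← lintegral_add_right']
    · refine lintegral_mono fun x => ?_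
      refine ENNReal.ofReal_add_le.trans (add_le_add ?_ ?_)
      · rw [ENNReal.ofReal_mul (by positivity)]
      · rw [ENNReal.ofReal_mul hc₄0]
        gcongr
        by_cases hx : x ∈ {x | x ∈ Ω ∧ s' ≤ φ x}
        · rw [Set.indicator_of_mem hx, Set.indicator_of_mem hx]
        · rw [Set.indicator_of_notMem hx]; simp
    · have q2 : ContinuousOn (fun x => ‖Z x‖ ^ 2 * r x ^ β) Ω :=
        (hZ.1.continuousOn.norm.pow 2).mul
          (h.r_smooth.continuousOn.rpow_const fun x hx => .inl (h.r_pos x hx).ne')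
      exact ((q2.aemeasurable h.isOpen.measurableSet).ennreal_ofReal.indicator hms).const_mul _
  have hfin : ENNReal.ofReal c * ∫⁻ x in {x | x ∈ Ω ∧ τ' ≤ φ x},
      ENNReal.ofReal (‖Z x‖ ^ 2 * r x ^ β * φ x ^ (2 * m)) ≤
      ENNReal.ofReal (max (2 * n * c₂) c₄) * (ID + IZ) := by
    calc _ = ∫⁻ x in {x | x ∈ Ω ∧ τ' ≤ φ x}, ENNReal.ofReal
          (levelCutoff τ (φ x) * (c * (‖Z x‖ ^ 2 * r x ^ β * φ x ^ (2 * m)))) := by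
          rw [← lintegral_const_mul' _ _ (by finiteness)]
          refine setLIntegral_congr_fun (h.measurableSet_level hτ') fun x hx => ?_
          rw [levelCutoff_eq_one hτ (hττ'.trans hx.2), one_mul, ENNReal.ofReal_mul hc0.le]
      _ ≤ _ := lintegral_mono_set fun x hx => hx.1
      _ ≤ _ := hmain
      _ ≤ _ := hQle
      _ ≤ ENNReal.ofReal (max (2 * n * c₂) c₄) * ID +
          ENNReal.ofReal (max (2 * n * c₂) c₄) * IZ := by
          gcongr
          · exact le_max_left _ _
          · exact le_max_right _ _
      _ = _ := by ring
  have hA' : (A.toNNReal : ENNReal) = ENNReal.ofReal (max (2 * n * c₂) c₄) / ENNReal.ofReal c := by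
    rw [← ENNReal.ofReal_div_of_pos hc0]; rfl
  rw [hA', div_eq_mul_inv, mul_right_comm, ← div_eq_mul_inv, ENNReal.le_div_iff_mul_le
    (.inl (by simpa using hc0)) (.inl (by finiteness)), mul_comm]
  exact hfin

end HasScaleBounds

end WeightedHardy

/-- Summing gives ∑ I ≤ ½ ∑ I + ∑ g, and absorbing the first term requires ∑ I finite. This holds
because I vanishes from J on and, if ∑ g is finite, finiteness propagates backwards in steps of L ≥
1. -/
lemma ENNReal.tsum_le_of_le_half_shift {I g : ℕ → ENNReal} {L J : ℕ} (hL : 1 ≤ L)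
    (hJ : ∀ j, J ≤ j → I j = 0) (h : ∀ j, I j ≤ 2⁻¹ * I (j + L) + g j) :
    ∑' j, I j ≤ 2 * ∑' j, g j := by
  by_cases hg : ∑' j, g j = ⊤
  · rw [hg, ENNReal.mul_top two_ne_zero]; exact le_top
  have hI : ∀ k j, J ≤ j + k → I j ≠ ⊤ := by
    intro k
    induction k with
    | zero => intro j hj; rw [hJ j hj]; simp
    | succ k ih =>
      intro j hj
      have h1 := ih (j + L) (by omega)
      have h2 := ENNReal.ne_top_of_tsum_ne_top hg j
      exact ne_top_of_le_ne_top (by finiteness) (h j)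
  have hsum : ∑' j, I j ≠ ⊤ := by
    rw [tsum_eq_sum (s := Finset.range J) fun j hj => hJ j (by simpa using hj)]
    exact ENNReal.sum_ne_top.2 fun j _ => hI J j (by omega)
  have h1 : ∑' j, I j ≤ 2⁻¹ * ∑' j, I j + ∑' j, g j := by
    calc ∑' j, I j ≤ ∑' j, (2⁻¹ * I (j + L) + g j) := ENNReal.tsum_le_tsum h
      _ = 2⁻¹ * ∑' j, I (j + L) + ∑' j, g j := by rw [ENNReal.tsum_add, ENNReal.tsum_mul_left]
      _ ≤ _ := by
        gcongr 2⁻¹ * ?_ + _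
        exact ENNReal.tsum_comp_le_tsum_of_injective (add_left_injective L) I
  generalize ∑' j, I j = A at *
  generalize ∑' j, g j = B at *
  have h2 : 2 * A ≤ A + 2 * B := by
    calc 2 * A ≤ 2 * (2⁻¹ * A + B) := by gcongr
      _ = _ := by rw [mul_add, ← mul_assoc, ENNReal.mul_inv_cancel two_ne_zero (by simp), one_mul]
  rw [two_mul] at h2
  exact (ENNReal.add_le_add_iff_left hsum).1 h2

/-! ### Dilations and dyadic decompositions -/

section Scaling

variable {n : ℕ}

lemma setLIntegral_comp_smul {E : Type*} [NormedAddCommGroup E] [NormedSpace ℝ E]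
    [MeasurableSpace E] [BorelSpace E] [FiniteDimensional ℝ E] (μ : Measure E) [μ.IsAddHaarMeasure]
    (G : E → ENNReal) (S : Set E) {t : ℝ} (ht : 0 < t) :
    ENNReal.ofReal t ^ Module.finrank ℝ E * ∫⁻ x in S, G (t • x) ∂μ =
      ∫⁻ x in (t • ·) '' S, G x ∂μ := by
  have hem : MeasurableEmbedding (t • · : E → E) := measurableEmbedding_const_smul₀ ht.ne'
  have h1 : ∫⁻ x in S, G (t • x) ∂μ =
      ENNReal.ofReal |(t ^ Module.finrank ℝ E)⁻¹| * ∫⁻ x in (t • ·) '' S, G x ∂μ := by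
    calc ∫⁻ x in S, G (t • x) ∂μ =
        ∫⁻ x in (t • ·) ⁻¹' ((t • ·) '' S), G (t • x) ∂μ := by
          rw [Set.preimage_image_eq _ hem.injective]
      _ = ∫⁻ x in (t • ·) '' S, G x ∂(Measure.map (t • ·) μ) := by
          rw [hem.restrict_map, hem.lintegral_map]
      _ = _ := by
          rw [Measure.map_addHaar_smul μ ht.ne', Measure.restrict_smul, lintegral_smul_measure,
            smul_eq_mul]
  rw [h1, ← mul_assoc, abs_of_pos (by positivity), ← ENNReal.ofReal_pow ht.le,
    ← ENNReal.ofReal_mul (by positivity), mul_inv_cancel₀ (by positivity), ENNReal.ofReal_one,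
    one_mul]

/-- Control of a field on `P` by its values on the dilate `t • S` and its Killing tensor; the
first constant does not depend on the dilation. -/
lemma exists_lintegral_le_comp_smul {W P S V : Set (EuclideanSpace ℝ (Fin n))} (hW : IsOpen W)
    (hc : IsConnected W) (hP : IsCompact P) (hS : IsCompact S) (hPW : P ⊆ W) (hVS : V ⊆ S)
    {C₀ : NNReal} {t : ℝ} (ht : 1 ≤ t) (htS : ∀ x ∈ S, t • x ∈ W)
    (hC₀ : ∀ (a : EuclideanSpace ℝ (Fin n))
      (B : EuclideanSpace ℝ (Fin n) →L[ℝ] EuclideanSpace ℝ (Fin n)),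
      ∫⁻ x in P, ‖a + B x‖ₑ ^ 2 ≤ C₀ * ∫⁻ x in V, ‖a + B (t • x)‖ₑ ^ 2) :
    ∃ (C : NNReal) (Q : Set (EuclideanSpace ℝ (Fin n))), IsCompact Q ∧ Q ⊆ W ∧
      ∀ Z : EuclideanSpace ℝ (Fin n) → EuclideanSpace ℝ (Fin n), ContDiffOn ℝ 1 Z W →
        ∫⁻ x in P, ‖Z x‖ₑ ^ 2 ≤ 4 * C₀ * (∫⁻ x in S, ‖Z (t • x)‖ₑ ^ 2) +
          C * ∫⁻ x in Q, ENNReal.ofReal (killingNormSq (fderiv ℝ Z x)) := by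
  have ht0 : 0 < t := by linarith
  have himg : IsCompact ((t • ·) '' S) := hS.image (continuous_const_smul t)
  have himgW : (t • ·) '' S ⊆ W := by rintro _ ⟨x, hx, rfl⟩; exact htS x hx
  -- One affine field approximates Z on both P and the dilate of S, so the values of Z on the two
  -- sets are compared through it. Only C, not C₀, depends on t.
  obtain ⟨C, Q, hQ, hQW, hC⟩ := hasAffineApprox_of_isCompact hW hc (hP.union himg)
    (Set.union_subset hPW himgW)
  refine ⟨(2 + 4 * C₀) * C, Q, hQ, hQW, fun Z hZ => ?_⟩
  obtain ⟨a, B, hab⟩ := hC Z hZ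
  set D := ∫⁻ x in Q, ENNReal.ofReal (killingNormSq (fderiv ℝ Z x))
  have hK : Continuous fun x => a + B x := by fun_prop
  have hPD : ∫⁻ x in P, ‖Z x - (a + B x)‖ₑ ^ 2 ≤ C * D :=
    (lintegral_mono_set Set.subset_union_left).trans hab
  have hSD : ∫⁻ x in S, ‖Z (t • x) - (a + B (t • x))‖ₑ ^ 2 ≤ C * D := by
    have h1 := setLIntegral_comp_smul volume (fun x => ‖Z x - (a + B x)‖ₑ ^ 2) S ht0
    -- The Jacobian is at least 1, so it may be inserted for free.
    calc _ ≤ ENNReal.ofReal t ^ Module.finrank ℝ (EuclideanSpace ℝ (Fin n)) *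
          ∫⁻ x in S, ‖Z (t • x) - (a + B (t • x))‖ₑ ^ 2 := by
          apply le_mul_of_one_le_left zero_le
          exact one_le_pow₀ (by simpa using ht)
      _ ≤ _ := by
          rw [h1]
          exact (lintegral_mono_set Set.subset_union_right).trans hab
  have hZS : ContinuousOn (fun x => Z (t • x)) S :=
    hZ.continuousOn.comp (continuous_const_smul t).continuousOn htS
  have hVK : ∫⁻ x in V, ‖a + B (t • x)‖ₑ ^ 2 ≤
      2 * (∫⁻ x in S, ‖Z (t • x)‖ₑ ^ 2) + 2 * (C * D) := by
    calc _ ≤ ∫⁻ x in S, ‖a + B (t • x)‖ₑ ^ 2 := lintegral_mono_set hVS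
      _ ≤ ∫⁻ x in S, (2 * ‖Z (t • x)‖ₑ ^ 2 + 2 * ‖Z (t • x) - (a + B (t • x))‖ₑ ^ 2) := by
          refine lintegral_mono fun x => ?_
          have := enorm_add_sq_le (Z (t • x)) (-(Z (t • x) - (a + B (t • x))))
          rw [enorm_neg] at this
          simpa using this
      _ = 2 * (∫⁻ x in S, ‖Z (t • x)‖ₑ ^ 2) +
          2 * ∫⁻ x in S, ‖Z (t • x) - (a + B (t • x))‖ₑ ^ 2 := by
          rw [lintegral_add_left', lintegral_const_mul' _ _ (by finiteness),
            lintegral_const_mul' _ _ (by finiteness)]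
          exact ((hZS.aestronglyMeasurable hS.measurableSet).enorm.pow_const 2).const_mul 2
      _ ≤ _ := by gcongr
  calc ∫⁻ x in P, ‖Z x‖ₑ ^ 2
      ≤ ∫⁻ x in P, (2 * ‖Z x - (a + B x)‖ₑ ^ 2 + 2 * ‖a + B x‖ₑ ^ 2) := by
        refine lintegral_mono fun x => ?_
        simpa using enorm_add_sq_le (Z x - (a + B x)) (a + B x)
    _ = 2 * (∫⁻ x in P, ‖Z x - (a + B x)‖ₑ ^ 2) + 2 * ∫⁻ x in P, ‖a + B x‖ₑ ^ 2 := by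
        rw [lintegral_add_right _ ((hK.measurable.enorm.pow_const 2).const_mul 2),
          lintegral_const_mul' _ _ (by finiteness), lintegral_const_mul' _ _ (by finiteness)]
    _ ≤ 2 * (C * D) + 2 * (C₀ * (2 * (∫⁻ x in S, ‖Z (t • x)‖ₑ ^ 2) + 2 * (C * D))) := by
        gcongr 2 * ?_ + 2 * ?_
        exact (hC₀ a B).trans (by gcongr)
    _ = _ := by push_cast; ring

/-- Dilates of a bounded set away from the origin overlap boundedly. -/
lemma tsum_lintegral_image_smul_le {Ω Q : Set (EuclideanSpace ℝ (Fin n))} (hΩ : MeasurableSet Ω)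
    {M : ℕ} (hQ : ∀ x ∈ Q, 1 < ‖x‖ ∧ ‖x‖ ≤ 2 ^ M) (hQΩ : ∀ x ∈ Q, ∀ j : ℕ, (2 : ℝ) ^ j • x ∈ Ω)
    (F : EuclideanSpace ℝ (Fin n) → ENNReal) :
    ∑' j : ℕ, ∫⁻ x in (fun x => (2 : ℝ) ^ j • x) '' Q, F x ≤ M * ∫⁻ x in Ω, F x := by
  set E : ℕ → Set (EuclideanSpace ℝ (Fin n)) :=
    fun j => {x | x ∈ Ω ∧ (2 : ℝ) ^ j < ‖x‖ ∧ ‖x‖ ≤ 2 ^ (j + 1)} with hE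
  have hEm : ∀ j, MeasurableSet (E j) := fun j =>
    hΩ.inter ((measurableSet_lt measurable_const measurable_norm).inter
      (measurableSet_le measurable_norm measurable_const))
  have hEd : Pairwise (Function.onFun Disjoint E) := by
    have key : ∀ i j, i < j → Disjoint (E i) (E j) := by
      intro i j hij
      rw [Set.disjoint_left]
      rintro x ⟨-, -, hx⟩ ⟨-, hx', -⟩
      have : (2 : ℝ) ^ (i + 1) ≤ 2 ^ j := pow_le_pow_right₀ one_le_two hij
      linarith
    intro i j hij
    rcases lt_or_gt_of_ne hij with h | h
    · exact key _ _ h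
    · exact (key _ _ h).symm
  have hEsum : ∑' j, ∫⁻ x in E j, F x ≤ ∫⁻ x in Ω, F x := by
    rw [← lintegral_iUnion hEm hEd]
    exact lintegral_mono_set (Set.iUnion_subset fun j x hx => hx.1)
  -- The norms in Q lie in (1, 2^M], so the j-th dilate meets only the M dyadic shells j, …, j + M -
  -- 1, and each shell is counted at most M times.
  have hcover : ∀ j : ℕ, (fun x => (2 : ℝ) ^ j • x) '' Q ⊆ ⋃ i : Fin M, E (j + i) := by
    rintro j _ ⟨x, hx, rfl⟩
    obtain ⟨h1, h2⟩ := hQ x hx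
    have hex : ∃ k : ℕ, ‖x‖ ≤ 2 ^ k := ⟨M, h2⟩
    classical
    obtain ⟨k, hk⟩ : ∃ k, Nat.find hex = k + 1 := by
      refine Nat.exists_eq_succ_of_ne_zero fun h0 => ?_
      have := Nat.find_spec hex
      rw [h0, pow_zero] at this
      linarith
    have hkM : k < M := by have := Nat.find_min' hex h2; omega
    have hk1 : ‖x‖ ≤ 2 ^ (k + 1) := hk ▸ Nat.find_spec hex
    have hk2 : (2 : ℝ) ^ k < ‖x‖ := not_le.1 (Nat.find_min hex (by omega))
    refine Set.mem_iUnion.2 ⟨⟨k, hkM⟩, hQΩ x hx j, ?_, ?_⟩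
    · rw [norm_smul, Real.norm_of_nonneg (by positivity), pow_add]; gcongr
    · rw [norm_smul, Real.norm_of_nonneg (by positivity), add_assoc, pow_add]; gcongr
  calc _ ≤ ∑' j : ℕ, ∑ i : Fin M, ∫⁻ x in E (j + i), F x := by
        refine ENNReal.tsum_le_tsum fun j => (lintegral_mono_set (hcover j)).trans ?_
        exact (lintegral_iUnion_le _ _).trans_eq (tsum_fintype _)
    _ = ∑ i : Fin M, ∑' j : ℕ, ∫⁻ x in E (j + i), F x :=
        Summable.tsum_finsetSum fun _ _ => ENNReal.summable
    _ ≤ ∑ i : Fin M, ∫⁻ x in Ω, F x := by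
        refine Finset.sum_le_sum fun i _ => le_trans ?_ hEsum
        exact ENNReal.tsum_comp_le_tsum_of_injective (add_left_injective (i : ℕ))
          fun j => ∫⁻ x in E j, F x
    _ = _ := by simp

end Scaling

/-! ### Weighted energies as sums of dyadic pieces -/

section Interior

variable {n : ℕ} {e : EuclideanSpace ℝ (Fin n)} {θ₁ θ₂ : ℝ} {Ω : Set (EuclideanSpace ℝ (Fin n))}
  {r φ : EuclideanSpace ℝ (Fin n) → ℝ}

lemma one_le_norm_two_pow_smul {x : EuclideanSpace ℝ (Fin n)} (hx : 1 ≤ ‖x‖) (j : ℕ) :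
    1 ≤ ‖(2 : ℝ) ^ j • x‖ := by
  rw [norm_smul, Real.norm_of_nonneg (by positivity)]
  exact one_le_mul_of_one_le_of_one_le (one_le_pow₀ one_le_two) hx

lemma ofReal_norm_sq_mul (v : EuclideanSpace ℝ (Fin n)) (w : ℝ) :
    ENNReal.ofReal (‖v‖ ^ 2 * w) = ‖v‖ₑ ^ 2 * ENNReal.ofReal w := by
  rw [ENNReal.ofReal_mul (by positivity), ENNReal.ofReal_pow (norm_nonneg _), ofReal_norm]

/-- The Jacobian of the dilation cancels the -n in the exponent of the radial weight. -/
lemma rpow_mul_pow_eq (q : ℝ) {t : ℝ} (ht : 0 < t) {γ : ℝ} (hγ : γ = q - n) {ρ : ℝ} (hρ : 0 < ρ) :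
    t ^ n * (t * ρ) ^ γ = t ^ q * ρ ^ γ := by
  rw [Real.mul_rpow ht.le hρ.le, ← mul_assoc, ← Real.rpow_natCast, ← Real.rpow_add ht, hγ]
  ring_nf

/-- The weighted Killing energy bounds the one on a compact subset. -/
lemma exists_lintegral_killing_le_of_isCompact (hr : ContinuousOn r Ω)
    (hr0 : ∀ x ∈ Ω, 0 < r x) (hφ : ContinuousOn φ Ω) (hφ0 : ∀ x ∈ Ω, 0 < φ x) (γ : ℝ) (k : ℕ)
    {Q : Set (EuclideanSpace ℝ (Fin n))} (hQ : IsCompact Q) (hQΩ : Q ⊆ Ω) :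
    ∃ C : NNReal, ∀ Z : EuclideanSpace ℝ (Fin n) → EuclideanSpace ℝ (Fin n),
      ∫⁻ x in Q, ENNReal.ofReal (killingNormSq (fderiv ℝ Z x)) ≤
        C * ∫⁻ x in Ω, ENNReal.ofReal (killingNormSq (fderiv ℝ Z x) * r x ^ γ * φ x ^ k) := by
  have hw : ContinuousOn (fun x => r x ^ γ * φ x ^ k) Ω :=
    (hr.rpow_const fun x hx => .inl (hr0 x hx).ne').mul (hφ.pow k)
  obtain ⟨c, hc, hcQ⟩ := hQ.exists_forall_le' (hw.mono hQΩ) (a := 0) fun x hx =>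
    mul_pos (Real.rpow_pos_of_pos (hr0 x (hQΩ hx)) _) (pow_pos (hφ0 x (hQΩ hx)) _)
  refine ⟨c⁻¹.toNNReal, fun Z => ?_⟩
  rw [← lintegral_const_mul' _ _ (by finiteness)]
  refine (setLIntegral_mono' hQ.measurableSet fun x hx => ?_).trans (lintegral_mono_set hQΩ)
  change _ ≤ ENNReal.ofReal c⁻¹ * _
  rw [← ENNReal.ofReal_mul (by positivity)]
  apply ENNReal.ofReal_le_ofReal
  rw [mul_assoc, ← mul_assoc c⁻¹, mul_comm c⁻¹, mul_assoc]
  apply le_mul_of_one_le_right (killingNormSq_nonneg _)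
  rw [← div_eq_inv_mul, one_le_div hc]
  exact hcQ x hx

lemma killingNormSq_fderiv_comp_smul
    (Z : EuclideanSpace ℝ (Fin n) → EuclideanSpace ℝ (Fin n)) (t : ℝ)
    (x : EuclideanSpace ℝ (Fin n)) :
    killingNormSq (fderiv ℝ (fun x => Z (t • x)) x) =
      t ^ 2 * killingNormSq (fderiv ℝ Z (t • x)) := by
  rw [fderiv_comp_smul, killingNormSq_smul]

/-- The Killing energies of the rescaled fields on a compact set sum up to the weighted energy. -/
lemma exists_tsum_lintegral_killing_le (hΩ : IsRegularizedCone e θ₁ θ₂ Ω) (hr : IsRadialWeight r)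
    (hφ : IsAngularWeight e θ₁ θ₂ Ω φ) (q : ℝ) (k : ℕ) {Q : Set (EuclideanSpace ℝ (Fin n))}
    (hQ : IsCompact Q) (hQΩ : Q ⊆ {x | x ∈ Ω ∧ 1 < ‖x‖}) :
    ∃ C : NNReal, ∀ Z : EuclideanSpace ℝ (Fin n) → EuclideanSpace ℝ (Fin n),
      ∑' j : ℕ, ENNReal.ofReal (((2 : ℝ) ^ j) ^ (2 * q)) *
          ∫⁻ x in Q, ENNReal.ofReal (killingNormSq (fderiv ℝ (fun x => Z ((2 : ℝ) ^ j • x)) x)) ≤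
        C * ∫⁻ x in Ω, ENNReal.ofReal
          (killingNormSq (fderiv ℝ Z x) * r x ^ (-(n : ℝ) + 2 * q + 2) * φ x ^ k) := by
  set γ := -(n : ℝ) + 2 * q + 2 with hγ
  have hφc : ContinuousOn φ Ω := fun x hx =>
    (hφ.smooth x (subset_closure hx)).continuousAt.continuousWithinAt
  have hw : ContinuousOn (fun x => r x ^ γ * φ x ^ k) Ω :=
    (hr.smooth.continuous.continuousOn.rpow_const fun x hx => .inl (hr.pos x).ne').mul (hφc.pow k)
  obtain ⟨c, hc, hcQ⟩ := hQ.exists_forall_le' (hw.mono fun x hx => (hQΩ hx).1)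
    (a := 0) fun x hx => mul_pos (Real.rpow_pos_of_pos (hr.pos x) _) (pow_pos (hφ.pos x (hQΩ hx).1) _)
  obtain ⟨R, hR⟩ := hQ.isBounded.exists_norm_le
  obtain ⟨M, hM⟩ := pow_unbounded_of_one_lt R (one_lt_two : (1 : ℝ) < 2)
  refine ⟨c⁻¹.toNNReal * M, fun Z => ?_⟩
  set F := fun x => ENNReal.ofReal (killingNormSq (fderiv ℝ Z x) * r x ^ γ * φ x ^ k) with hF
  have hterm : ∀ j : ℕ, ENNReal.ofReal (((2 : ℝ) ^ j) ^ (2 * q)) *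
      (∫⁻ x in Q, ENNReal.ofReal (killingNormSq (fderiv ℝ (fun x => Z ((2 : ℝ) ^ j • x)) x))) ≤
      ENNReal.ofReal c⁻¹ * ∫⁻ x in (fun x => (2 : ℝ) ^ j • x) '' Q, F x := by
    intro j
    have ht : (0 : ℝ) < 2 ^ j := by positivity
    rw [← setLIntegral_comp_smul volume F Q ht, finrank_euclideanSpace_fin,
      ← lintegral_const_mul' _ _ (by finiteness), ← lintegral_const_mul' _ _ (by finiteness),
      ← lintegral_const_mul' _ _ (by finiteness)]
    refine setLIntegral_mono' hQ.measurableSet fun x hx => ?_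
    rw [hF, ← ENNReal.ofReal_pow ht.le, ← ENNReal.ofReal_mul (by positivity),
      ← ENNReal.ofReal_mul (by positivity), ← ENNReal.ofReal_mul (by positivity)]
    apply ENNReal.ofReal_le_ofReal
    have hx1 : 1 ≤ ‖x‖ := (hQΩ hx).2.le
    have h1t : (1 : ℝ) ≤ 2 ^ j := one_le_pow₀ one_le_two
    rw [killingNormSq_fderiv_comp_smul, hr.smul hx1 h1t, hφ.conical x (hQΩ hx).1 hx1 _ h1t]
    set K := killingNormSq (fderiv ℝ Z ((2 : ℝ) ^ j • x))
    have hK : 0 ≤ K := killingNormSq_nonneg _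
    -- The extra two powers of the dilation factor come from the Killing tensor of the rescaled
    -- field.
    have h1 := rpow_mul_pow_eq (n := n) (2 * q + 2) ht (γ := γ) (by rw [hγ]; ring) (hr.pos x)
    have h2 : ((2 : ℝ) ^ j) ^ (2 * q) * ((2 : ℝ) ^ j) ^ 2 = ((2 : ℝ) ^ j) ^ (2 * q + 2) := by
      rw [Real.rpow_add ht, Real.rpow_two]
    calc _ = ((2 : ℝ) ^ j) ^ (2 * q) * ((2 : ℝ) ^ j) ^ 2 * K := by ring
      _ = ((2 : ℝ) ^ j) ^ (2 * q + 2) * K * 1 := by rw [h2, mul_one]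
      _ ≤ ((2 : ℝ) ^ j) ^ (2 * q + 2) * K * (c⁻¹ * (r x ^ γ * φ x ^ k)) := by
        gcongr
        rw [← div_eq_inv_mul, one_le_div hc]
        exact hcQ x hx
      _ = c⁻¹ * K * φ x ^ k * (((2 : ℝ) ^ j) ^ (2 * q + 2) * r x ^ γ) := by ring
      _ = _ := by rw [← h1]; ring
  calc _ ≤ ∑' j : ℕ, ENNReal.ofReal c⁻¹ * ∫⁻ x in (fun x => (2 : ℝ) ^ j • x) '' Q, F x :=
        ENNReal.tsum_le_tsum hterm
    _ = ENNReal.ofReal c⁻¹ * ∑' j : ℕ, ∫⁻ x in (fun x => (2 : ℝ) ^ j • x) '' Q, F x :=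
        ENNReal.tsum_mul_left
    _ ≤ ENNReal.ofReal c⁻¹ * (M * ∫⁻ x in Ω, F x) := by
        gcongr
        refine tsum_lintegral_image_smul_le hΩ.isOpen.measurableSet
          (fun x hx => ⟨(hQΩ hx).2, (hR x hx).trans hM.le⟩) (fun x hx j => ?_) F
        exact (hΩ.smul_mem (hQΩ hx).2.le (by positivity)
          (one_le_norm_two_pow_smul (hQΩ hx).2.le j)).2 (hQΩ hx).1
    _ = _ := by
        rw [← mul_assoc]; push_cast; rfl

/-- The weighted norm outside a ball is controlled by the norms of the rescaled fields. -/
lemma exists_lintegral_outer_le_tsum (hΩ : IsRegularizedCone e θ₁ θ₂ Ω) (hr : IsRadialWeight r)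
    (hφ : IsAngularWeight e θ₁ θ₂ Ω φ) (q : ℝ) {σ : ℝ}
    (hS : IsCompact {x | x ∈ Ω ∧ σ ≤ φ x ∧ 2 ≤ ‖x‖ ∧ ‖x‖ ≤ 4}) :
    ∃ C : NNReal, ∀ Z : EuclideanSpace ℝ (Fin n) → EuclideanSpace ℝ (Fin n),
      ∫⁻ x in {x | x ∈ Ω ∧ σ ≤ φ x ∧ 2 ≤ ‖x‖}, ENNReal.ofReal
          (‖Z x‖ ^ 2 * r x ^ (-(n : ℝ) + 2 * q)) ≤
        C * ∑' j : ℕ, ENNReal.ofReal (((2 : ℝ) ^ j) ^ (2 * q)) *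
          ∫⁻ x in {x | x ∈ Ω ∧ σ ≤ φ x ∧ 2 ≤ ‖x‖ ∧ ‖x‖ ≤ 4}, ‖Z ((2 : ℝ) ^ j • x)‖ₑ ^ 2 := by
  set S := {x | x ∈ Ω ∧ σ ≤ φ x ∧ 2 ≤ ‖x‖ ∧ ‖x‖ ≤ 4} with hSdef
  set γ := -(n : ℝ) + 2 * q with hγ
  have hw : Continuous fun x => r x ^ γ :=
    hr.smooth.continuous.rpow_const fun x => .inl (hr.pos x).ne'
  obtain ⟨c, hc⟩ := hS.exists_bound_of_continuousOn hw.continuousOn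
  refine ⟨c.toNNReal, fun Z => ?_⟩
  set F := fun x => ENNReal.ofReal (‖Z x‖ ^ 2 * r x ^ γ) with hF
  have hcover : {x | x ∈ Ω ∧ σ ≤ φ x ∧ 2 ≤ ‖x‖} ⊆ ⋃ j : ℕ, (fun x => (2 : ℝ) ^ j • x) '' S := by
    rintro x ⟨hxΩ, hxσ, hx2⟩
    -- 2^j ≤ ‖x‖/2 < 2^(j+1), so dividing by 2^j brings the norm into [2, 4].
    obtain ⟨j, hj1, hj2⟩ := exists_nat_pow_near (x := ‖x‖ / 2) (by linarith) (one_lt_two : (1 : ℝ) < 2)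
    have ht : (0 : ℝ) < 2 ^ j := by positivity
    have h1t : (1 : ℝ) ≤ 2 ^ j := one_le_pow₀ one_le_two
    rw [pow_succ] at hj2
    have hnorm : ‖((2 : ℝ) ^ j)⁻¹ • x‖ = ‖x‖ / 2 ^ j := by
      rw [norm_smul, Real.norm_of_nonneg (by positivity), ← div_eq_inv_mul]
    have h2 : 2 ≤ ‖x‖ / 2 ^ j := by rw [le_div_iff₀ ht]; linarith
    have h4 : ‖x‖ / 2 ^ j ≤ 4 := by rw [div_le_iff₀ ht]; linarith
    have hmem : ((2 : ℝ) ^ j)⁻¹ • x ∈ Ω := (hΩ.smul_mem (by linarith) (by positivity)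
      (by rw [hnorm]; linarith)).2 hxΩ
    have hback : (2 : ℝ) ^ j • ((2 : ℝ) ^ j)⁻¹ • x = x := smul_inv_smul₀ ht.ne' x
    have hφx := hφ.conical _ hmem (by rw [hnorm]; linarith) _ h1t
    rw [hback] at hφx
    exact Set.mem_iUnion.2 ⟨j, _, ⟨hmem, hφx ▸ hxσ, by rwa [hnorm], by rwa [hnorm]⟩, hback⟩
  have hterm : ∀ j : ℕ, ∫⁻ x in (fun x => (2 : ℝ) ^ j • x) '' S, F x ≤
      ENNReal.ofReal c * (ENNReal.ofReal (((2 : ℝ) ^ j) ^ (2 * q)) *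
        ∫⁻ x in S, ‖Z ((2 : ℝ) ^ j • x)‖ₑ ^ 2) := by
    intro j
    have ht : (0 : ℝ) < 2 ^ j := by positivity
    rw [← setLIntegral_comp_smul volume F S ht, finrank_euclideanSpace_fin,
      ← lintegral_const_mul' _ _ (by finiteness), ← lintegral_const_mul' _ _ (by finiteness),
      ← lintegral_const_mul' _ _ (by finiteness)]
    refine setLIntegral_mono' hS.measurableSet fun x hx => ?_
    have hx1 : 1 ≤ ‖x‖ := by linarith [hx.2.2.1]
    have h1 := rpow_mul_pow_eq (n := n) (2 * q) ht (γ := γ) (by rw [hγ]; ring) (hr.pos x)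
    have hc' := (le_abs_self _).trans (hc x hx)
    simp only [hF]
    rw [hr.smul hx1 (one_le_pow₀ one_le_two), ofReal_norm_sq_mul, mul_left_comm,
      ← ENNReal.ofReal_pow ht.le, ← ENNReal.ofReal_mul (by positivity), h1, mul_comm,
      ENNReal.ofReal_mul (by positivity), mul_comm (ENNReal.ofReal (((2 : ℝ) ^ j) ^ (2 * q))),
      mul_assoc]
    gcongr
  calc _ ≤ ∫⁻ x in ⋃ j : ℕ, (fun x => (2 : ℝ) ^ j • x) '' S, F x := lintegral_mono_set hcover
    _ ≤ ∑' j : ℕ, ∫⁻ x in (fun x => (2 : ℝ) ^ j • x) '' S, F x := lintegral_iUnion_le _ _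
    _ ≤ _ := (ENNReal.tsum_le_tsum hterm).trans_eq ENNReal.tsum_mul_left

end Interior

/-! ### Control of the field away from the boundary -/

section InteriorEstimate

variable {n : ℕ} {e : EuclideanSpace ℝ (Fin n)} {θ₁ θ₂ : ℝ} {Ω : Set (EuclideanSpace ℝ (Fin n))}
  {r φ : EuclideanSpace ℝ (Fin n) → ℝ}

/-- Some superlevel set of `φ` meets the shell `2 < ‖x‖ < 4`. -/
lemma exists_level_nonempty (hn : 3 ≤ n) (he : ‖e‖ = 1) (hθ₁ : 0 < θ₁) (hθ₁₂ : θ₁ < θ₂)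
    (hθ₂ : θ₂ < Real.pi) (hΩ : IsRegularizedCone e θ₁ θ₂ Ω)
    (hφ : IsAngularWeight e θ₁ θ₂ Ω φ) {σ : ℝ} (hσ : 0 < σ) :
    ∃ σ', 0 < σ' ∧ σ' ≤ σ ∧ {x | x ∈ Ω ∧ σ' < φ x ∧ 2 < ‖x‖ ∧ ‖x‖ < 4}.Nonempty := by
  obtain ⟨x, hx1, hx2⟩ := (isConnected_conicalShell hn he hθ₁ hθ₁₂ hθ₂).nonempty
  have hx0 : 0 < ‖x‖ := by linarith
  have hnorm : ‖(3 / ‖x‖) • x‖ = 3 := by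
    rw [norm_smul, Real.norm_of_nonneg (by positivity)]; field_simp
  have hy : (3 / ‖x‖) • x ∈ Ω := by
    rwa [hΩ.conical _ (by rw [hnorm]; norm_num),
      InnerProductGeometry.angle_smul_right_of_pos _ _ (by positivity)]
  have hpos := hφ.pos _ hy
  refine ⟨min σ (φ ((3 / ‖x‖) • x) / 2), by positivity, min_le_left _ _, _, hy, ?_, ?_, ?_⟩
  · exact (min_le_right _ _).trans_lt (by linarith)
  · rw [hnorm]; norm_num
  · rw [hnorm]; norm_num

/-- Away from the boundary, a field is controlled by its Killing tensor. -/
lemma exists_lintegral_level_le (hn : 3 ≤ n) (he : ‖e‖ = 1) (hθ₁ : 0 < θ₁) (hθ₁₂ : θ₁ < θ₂)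
    (hθ₂ : θ₂ < Real.pi) (hΩ : IsRegularizedCone e θ₁ θ₂ Ω) (hr : IsRadialWeight r)
    (hφ : IsAngularWeight e θ₁ θ₂ Ω φ) {σ : ℝ} (hσ : 0 < σ) {q : ℝ} (hq : 0 < q) (k : ℕ) :
    ∃ C : NNReal, ∀ Z, IsSmoothBddSupp Ω Z →
      ∫⁻ x in {x | x ∈ Ω ∧ σ ≤ φ x}, ENNReal.ofReal (‖Z x‖ ^ 2 * r x ^ (-(n : ℝ) + 2 * q)) ≤
        C * ∫⁻ x in Ω, ENNReal.ofReal
          (killingNormSq (fderiv ℝ Z x) * r x ^ (-(n : ℝ) + 2 * q + 2) * φ x ^ k) := by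
  obtain ⟨τ, hτ, hτσ, hne⟩ := exists_level_nonempty hn he hθ₁ hθ₁₂ hθ₂ hΩ hφ hσ
  set V := {x | x ∈ Ω ∧ τ < φ x ∧ 2 < ‖x‖ ∧ ‖x‖ < 4} with hVdef
  set S := {x | x ∈ Ω ∧ τ ≤ φ x ∧ 2 ≤ ‖x‖ ∧ ‖x‖ ≤ 4} with hSdef
  set H := {x | x ∈ Ω ∧ τ ≤ φ x ∧ ‖x‖ ≤ 4} with hHdef
  -- The purely conical part of Ω: connected and stable under dilations by powers of 2, so one
  -- estimate on W applies to every rescaled field.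
  set W := {x | x ∈ Ω ∧ 1 < ‖x‖} with hWdef
  have hφc : ContinuousOn φ Ω := fun x hx =>
    (hφ.smooth x (subset_closure hx)).continuousAt.continuousWithinAt
  have hV : IsOpen V := by
    have h1 : IsOpen (Ω ∩ φ ⁻¹' Set.Ioi τ) := hφc.isOpen_inter_preimage hΩ.isOpen isOpen_Ioi
    have h2 : IsOpen (norm ⁻¹' Set.Ioo 2 4 : Set (EuclideanSpace ℝ (Fin n))) :=
      isOpen_Ioo.preimage continuous_norm
    convert h1.inter h2 using 1
    ext x; simp only [hVdef, Set.mem_ofPred_eq, Set.mem_inter_iff, Set.mem_preimage, Set.mem_Ioi,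
      Set.mem_Ioo, and_assoc]
  have hVS : V ⊆ S := fun x hx => ⟨hx.1, hx.2.1.le, hx.2.2.1.le, hx.2.2.2.le⟩
  have hH : IsCompact H := isCompact_levelSet (fun x hx => (hφ.smooth x hx).continuousAt)
    hφ.eq_zero hΩ.isOpen hτ
  have hS : IsCompact S := by
    have : S = H ∩ {x | 2 ≤ ‖x‖} := by
      ext x; simp only [hSdef, hHdef, Set.mem_ofPred_eq, Set.mem_inter_iff]; tauto
    rw [this]
    exact hH.inter_right (isClosed_le continuous_const continuous_norm)
  have hWo : IsOpen W := hΩ.isOpen.inter (isOpen_lt continuous_const continuous_norm)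
  have hWeq : W = {x | 1 < ‖x‖ ∧
      θ₁ < InnerProductGeometry.angle e x ∧ InnerProductGeometry.angle e x < θ₂} := by
    ext x
    simp only [hWdef, Set.mem_ofPred_eq]
    rw [and_comm]
    exact and_congr_right fun hx => hΩ.conical x hx.le
  have hWc : IsConnected W := hWeq ▸ isConnected_conicalShell hn he hθ₁ hθ₁₂ hθ₂
  have hSW : S ⊆ W := fun x hx => ⟨hx.1, by linarith [hx.2.2.1]⟩
  have hdil : ∀ x ∈ W, ∀ j : ℕ, (2 : ℝ) ^ j • x ∈ W := by
    intro x hx j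
    refine ⟨(hΩ.smul_mem hx.2.le (by positivity) (one_le_norm_two_pow_smul hx.2.le j)).2 hx.1, ?_⟩
    rw [norm_smul, Real.norm_of_nonneg (by positivity)]
    exact one_lt_mul_of_le_of_lt (one_le_pow₀ one_le_two) hx.2
  obtain ⟨C₀, hC₀⟩ := exists_lintegral_affine_comparison hS.isBounded hV hne
  -- C₀ is fixed before L. As q > 0, the weight ratio 2^(2qL) eventually beats 8C₀, and the coupling
  -- factor 4C₀ 2^(-2qL) becomes at most 1/2.
  obtain ⟨L, hL1, hL⟩ : ∃ L : ℕ, 1 ≤ L ∧ 8 * (C₀ : ℝ) ≤ ((2 : ℝ) ^ L) ^ (2 * q) := by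
    have h1 : Tendsto (fun L : ℕ => ((2 : ℝ) ^ L) ^ (2 * q)) atTop atTop :=
      (tendsto_rpow_atTop (by positivity)).comp (tendsto_pow_atTop_atTop_of_one_lt one_lt_two)
    exact ((eventually_ge_atTop 1).and (h1.eventually_ge_atTop _)).exists
  obtain ⟨C₁, Q₁, hQ₁, hQW₁, hC₁⟩ := exists_lintegral_le_comp_smul hWo hWc hS hS hSW hVS
    (one_le_pow₀ one_le_two : (1 : ℝ) ≤ 2 ^ L) (fun x hx => hdil x (hSW hx) L)
    (hC₀ _ (one_le_pow₀ one_le_two))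
  obtain ⟨C₂, hC₂⟩ := exists_tsum_lintegral_killing_le hΩ hr hφ q k hQ₁ hQW₁
  obtain ⟨C₃, hC₃⟩ := exists_lintegral_outer_le_tsum hΩ hr hφ q hS
  -- The bounded part H, which may enter the unit ball, is compared with the shell S by the same
  -- lemma without dilation, now in the whole of Ω.
  obtain ⟨C₄, hC₄⟩ := exists_lintegral_affine_comparison hH.isBounded hV hne
  obtain ⟨C₅, Q₂, hQ₂, hQΩ₂, hC₅⟩ := exists_lintegral_le_comp_smul hΩ.isOpen hΩ.isConnected hH hS
    (fun x hx => hx.1) hVS le_rfl (fun x hx => by rw [one_smul]; exact hx.1) (hC₄ 1 le_rfl)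
  obtain ⟨C₆, hC₆⟩ := exists_lintegral_killing_le_of_isCompact
    hr.smooth.continuous.continuousOn (fun x _ => hr.pos x) hφc hφ.pos
    (-(n : ℝ) + 2 * q + 2) k hQ₂ hQΩ₂
  obtain ⟨c, hc⟩ := hH.exists_bound_of_continuousOn
    (f := fun x => r x ^ (-(n : ℝ) + 2 * q))
    (hr.smooth.continuous.rpow_const fun x => .inl (hr.pos x).ne').continuousOn
  set T : NNReal := 2 * (C₁ * C₂) with hT
  refine ⟨c.toNNReal * (4 * C₄ * T + C₅ * C₆) + C₃ * T, fun Z hZ => ?_⟩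
  set I : ℕ → ENNReal := fun j => ENNReal.ofReal (((2 : ℝ) ^ j) ^ (2 * q)) *
    ∫⁻ x in S, ‖Z ((2 : ℝ) ^ j • x)‖ₑ ^ 2 with hI
  set F := ∫⁻ x in Ω, ENNReal.ofReal
          (killingNormSq (fderiv ℝ Z x) * r x ^ (-(n : ℝ) + 2 * q + 2) * φ x ^ k) with hF
  have hZ1 : ContDiffOn ℝ 1 Z Ω := hZ.1.of_le (by exact_mod_cast le_top)
  have hsum : ∑' j, I j ≤ T * F := by
    obtain ⟨R, hR⟩ := hZ.2.exists_norm_le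
    obtain ⟨J, hJ⟩ := pow_unbounded_of_one_lt R (one_lt_two : (1 : ℝ) < 2)
    -- Points of the j-th dilate of S have norm above 2^J, beyond the support of Z.
    have hvan : ∀ j, J ≤ j → I j = 0 := by
      intro j hj
      have : ∫⁻ x in S, ‖Z ((2 : ℝ) ^ j • x)‖ₑ ^ 2 = ∫⁻ x in S, 0 := by
        refine setLIntegral_congr_fun hS.measurableSet fun x hx => ?_
        have hz : Z ((2 : ℝ) ^ j • x) = 0 := by
          by_contra hne0
          have h1 := hR _ ⟨(hdil x (hSW hx) j).1, hne0⟩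
          rw [norm_smul, Real.norm_of_nonneg (by positivity)] at h1
          have h2 : (2 : ℝ) ^ J ≤ 2 ^ j := pow_le_pow_right₀ one_le_two hj
          have h3 : (2 : ℝ) ^ j * 1 ≤ 2 ^ j * ‖x‖ := by gcongr; exact (hSW hx).2.le
          linarith
        simp [hz]
      simp only [hI, this, lintegral_zero, mul_zero]
    have hrec : ∀ j, I j ≤ 2⁻¹ * I (j + L) + C₁ * (ENNReal.ofReal (((2 : ℝ) ^ j) ^ (2 * q)) *
        ∫⁻ x in Q₁, ENNReal.ofReal
          (killingNormSq (fderiv ℝ (fun x => Z ((2 : ℝ) ^ j • x)) x))) := by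
      intro j
      have hZj : ContDiffOn ℝ 1 (fun x => Z ((2 : ℝ) ^ j • x)) W :=
        hZ1.comp (contDiff_const_smul _).contDiffOn fun x hx => (hdil x hx j).1
      have h1 := hC₁ _ hZj
      simp only [smul_smul, ← pow_add] at h1
      have h2 : ENNReal.ofReal (((2 : ℝ) ^ j) ^ (2 * q)) * (4 * C₀) ≤
          2⁻¹ * ENNReal.ofReal (((2 : ℝ) ^ (j + L)) ^ (2 * q)) := by
        have e1 : (4 * C₀ : ENNReal) = ENNReal.ofReal (4 * C₀) := by
          rw [ENNReal.ofReal_mul (by norm_num), ENNReal.ofReal_coe_nnreal, ENNReal.ofReal_ofNat]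
        have e2 : (2⁻¹ : ENNReal) = ENNReal.ofReal 2⁻¹ := by
          rw [ENNReal.ofReal_inv_of_pos two_pos, ENNReal.ofReal_ofNat]
        rw [e1, e2, ← ENNReal.ofReal_mul (by positivity), ← ENNReal.ofReal_mul (by positivity)]
        apply ENNReal.ofReal_le_ofReal
        rw [pow_add, Real.mul_rpow (by positivity) (by positivity)]
        have : 0 < ((2 : ℝ) ^ j) ^ (2 * q) := by positivity
        nlinarith
      calc I j ≤ ENNReal.ofReal (((2 : ℝ) ^ j) ^ (2 * q)) * _ := mul_le_mul_right h1 _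
        _ = ENNReal.ofReal (((2 : ℝ) ^ j) ^ (2 * q)) * (4 * C₀) *
              (∫⁻ x in S, ‖Z ((2 : ℝ) ^ (j + L) • x)‖ₑ ^ 2) +
            C₁ * (ENNReal.ofReal (((2 : ℝ) ^ j) ^ (2 * q)) * ∫⁻ x in Q₁, ENNReal.ofReal
              (killingNormSq (fderiv ℝ (fun x => Z ((2 : ℝ) ^ j • x)) x))) := by ring
        _ ≤ _ := by
          gcongr ?_ + _
          exact (mul_le_mul_left h2 _).trans_eq (mul_assoc _ _ _)
    calc _ ≤ 2 * ∑' j : ℕ, C₁ * (ENNReal.ofReal (((2 : ℝ) ^ j) ^ (2 * q)) *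
        ∫⁻ x in Q₁, ENNReal.ofReal
          (killingNormSq (fderiv ℝ (fun x => Z ((2 : ℝ) ^ j • x)) x))) :=
          ENNReal.tsum_le_of_le_half_shift hL1 hvan hrec
      _ ≤ 2 * (C₁ * (C₂ * F)) := by
          rw [ENNReal.tsum_mul_left]
          gcongr 2 * (C₁ * ?_)
          exact hC₂ Z
      _ = _ := by rw [hT]; push_cast; ring
  -- The term j = 0 bounds Z itself on the shell, which then feeds the estimate on H.
  have hI0 : ∫⁻ x in S, ‖Z x‖ₑ ^ 2 ≤ T * F := by
    have : I 0 = ∫⁻ x in S, ‖Z x‖ₑ ^ 2 := by simp [hI]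
    rw [← this]
    exact (ENNReal.le_tsum 0).trans hsum
  have hinner : ∫⁻ x in H, ENNReal.ofReal (‖Z x‖ ^ 2 * r x ^ (-(n : ℝ) + 2 * q)) ≤
      ENNReal.ofReal c * ((4 * C₄ * T + C₅ * C₆) * F) := by
    have h1 := hC₅ Z hZ1
    simp only [one_smul] at h1
    calc _ ≤ ∫⁻ x in H, ENNReal.ofReal c * ‖Z x‖ₑ ^ 2 := by
          refine setLIntegral_mono' hH.measurableSet fun x hx => ?_
          rw [ofReal_norm_sq_mul, mul_comm]
          gcongr
          exact (le_abs_self _).trans (hc x hx)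
      _ = ENNReal.ofReal c * ∫⁻ x in H, ‖Z x‖ₑ ^ 2 := lintegral_const_mul' _ _ (by finiteness)
      _ ≤ ENNReal.ofReal c * (4 * C₄ * (T * F) + C₅ * (C₆ * F)) := by
          gcongr ENNReal.ofReal c * ?_
          exact h1.trans (add_le_add (mul_le_mul_right hI0 _) (mul_le_mul_right (hC₆ Z) _))
      _ = _ := by ring
  have hout := (hC₃ Z).trans (mul_le_mul_right hsum _)
  have hsub : {x | x ∈ Ω ∧ σ ≤ φ x} ⊆ H ∪ {x | x ∈ Ω ∧ τ ≤ φ x ∧ 2 ≤ ‖x‖} := by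
    rintro x ⟨hx, hxσ⟩
    rcases le_total ‖x‖ 2 with h | h
    · exact .inl ⟨hx, hτσ.trans hxσ, by linarith⟩
    · exact .inr ⟨hx, hτσ.trans hxσ, h⟩
  refine (lintegral_mono_set hsub).trans ((lintegral_union_le _ _ _).trans
    ((add_le_add hinner hout).trans_eq ?_))
  push_cast
  rw [show (c.toNNReal : ENNReal) = ENNReal.ofReal c from rfl]
  ring

end InteriorEstimate

/-! ### Combined inequality, passage to the completion, and the theorem -/

section Main

variable {n : ℕ} {e : EuclideanSpace ℝ (Fin n)} {θ₁ θ₂ : ℝ} {Ω : Set (EuclideanSpace ℝ (Fin n))}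
  {r φ ρ : EuclideanSpace ℝ (Fin n) → ℝ}

/-- The weighted Hardy and Korn inequalities for fields with bounded support. -/
lemma exists_weighted_hardy_korn (hn : 3 ≤ n) (he : ‖e‖ = 1) (hθ₁ : 0 < θ₁) (hθ₁₂ : θ₁ < θ₂)
    (hθ₂ : θ₂ < Real.pi) (hΩ : IsRegularizedCone e θ₁ θ₂ Ω) (hr : IsRadialWeight r)
    (hφ : IsAngularWeight e θ₁ θ₂ Ω φ) {q : ℝ} (hq : 0 < q) (m : ℕ) :
    ∃ C : NNReal, ∀ Z, IsSmoothBddSupp Ω Z →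
      ∫⁻ x in Ω, ENNReal.ofReal (‖Z x‖ ^ 2 * r x ^ (-(n : ℝ) + 2 * q) * φ x ^ (2 * m + 2)) ≤
        C * (∫⁻ x in Ω, ENNReal.ofReal (killingNormSq (fderiv ℝ Z x) *
          r x ^ (-(n : ℝ) + 2 * q + 2) * φ x ^ (2 * m + 2))) ∧
      ∫⁻ x in Ω, ENNReal.ofReal (gradNormSq (fderiv ℝ Z x) *
          r x ^ (-(n : ℝ) + 2 * q + 2) * φ x ^ (2 * m + 2)) ≤
        C * ∫⁻ x in Ω, ENNReal.ofReal (killingNormSq (fderiv ℝ Z x) *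
          r x ^ (-(n : ℝ) + 2 * q + 2) * φ x ^ (2 * m + 2)) := by
  obtain ⟨X, c, s, h⟩ := exists_hasScaleBounds hΩ hr hφ
  obtain ⟨C₁, hC₁⟩ := h.exists_weighted_korn m (-(n : ℝ) + 2 * q)
  obtain ⟨C₂, s', hs', hC₂⟩ := h.exists_weighted_hardy m (-(n : ℝ) + 2 * q)
  obtain ⟨C₃, hC₃⟩ :=
    exists_lintegral_level_le hn he hθ₁ hθ₁₂ hθ₂ hΩ hr hφ hs' hq (2 * m + 2)
  set T := C₂ * (1 + C₃) with hT
  refine ⟨(c ^ 2).toNNReal * T + C₁ * (1 + T), fun Z hZ => ?_⟩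
  set K := ∫⁻ x in Ω, ENNReal.ofReal (killingNormSq (fderiv ℝ Z x) *
    r x ^ (-(n : ℝ) + 2 * q + 2) * φ x ^ (2 * m + 2)) with hK
  have hardy : ∫⁻ x in Ω, ENNReal.ofReal
      (‖Z x‖ ^ 2 * r x ^ (-(n : ℝ) + 2 * q) * φ x ^ (2 * m)) ≤ T * K := by
    calc _ ≤ _ := hC₂ Z hZ
      _ ≤ C₂ * (K + C₃ * K) := by gcongr C₂ * (K + ?_); exact hC₃ Z hZ
      _ = _ := by rw [hT]; push_cast; ring
  push_cast
  constructor
  -- The Hardy bound carries φ^(2m); since φ ≤ c, raising the power to 2m + 2 costs c².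
  · calc _ ≤ ∫⁻ x in Ω, ENNReal.ofReal (c ^ 2) * ENNReal.ofReal
          (‖Z x‖ ^ 2 * r x ^ (-(n : ℝ) + 2 * q) * φ x ^ (2 * m)) := by
          refine setLIntegral_mono' h.isOpen.measurableSet fun x hx => ?_
          rw [← ENNReal.ofReal_mul (by positivity)]
          apply ENNReal.ofReal_le_ofReal
          have h1 : φ x ^ 2 ≤ c ^ 2 := by
            gcongr
            · exact (hφ.pos x hx).le
            · exact h.φ_le x hx
          have h2 := hφ.pos x hx
          have h3 := hr.pos x
          calc _ = φ x ^ 2 * (‖Z x‖ ^ 2 * r x ^ (-(n : ℝ) + 2 * q) * φ x ^ (2 * m)) := by ring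
            _ ≤ _ := by gcongr
      _ = ENNReal.ofReal (c ^ 2) * _ := lintegral_const_mul' _ _ (by finiteness)
      _ ≤ ENNReal.ofReal (c ^ 2) * (T * K) := by gcongr
      _ = (c ^ 2).toNNReal * T * K := (mul_assoc _ _ _).symm
      _ ≤ _ := by gcongr; exact le_self_add
  · calc _ ≤ _ := hC₁ Z hZ
      _ ≤ C₁ * (K + T * K) := by gcongr
      _ = C₁ * (1 + T) * K := by ring
      _ ≤ _ := by gcongr; exact le_add_self

/-- Additivity of the lower Lebesgue integral needs measurability of one summand only, and it is
asked of F₂. -/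
lemma weightedSq_le_two_mul_add (hΩ : MeasurableSet Ω) (hr : ∀ x ∈ Ω, 0 ≤ r x)
    (hρ : ∀ x ∈ Ω, 0 ≤ ρ x) (s : ℝ) {F F₁ F₂ : EuclideanSpace ℝ (Fin n) → ℝ}
    (h₁ : ∀ x, 0 ≤ F₁ x) (h₂ : ∀ x, 0 ≤ F₂ x) (hF : ∀ x, F x ≤ 2 * F₁ x + 2 * F₂ x)
    (hm : AEMeasurable (fun x => F₂ x * r x ^ (-(n : ℝ) + 2 * s) * ρ x) (volume.restrict Ω)) :
    weightedSq Ω r ρ s F ≤ 2 * weightedSq Ω r ρ s F₁ + 2 * weightedSq Ω r ρ s F₂ := by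
  unfold weightedSq
  rw [← lintegral_const_mul' _ _ (by finiteness), ← lintegral_const_mul' 2 _ (by finiteness),
    ← lintegral_add_right' _ (hm.ennreal_ofReal.const_mul 2)]
  refine setLIntegral_mono' hΩ fun x hx => ?_
  have hw : 0 ≤ r x ^ (-(n : ℝ) + 2 * s) * ρ x :=
    mul_nonneg (Real.rpow_nonneg (hr x hx) _) (hρ x hx)
  have e1 := h₁ x
  have e2 := h₂ x
  have key : ∀ a b : ℝ, 0 ≤ a → 0 ≤ b →
      ENNReal.ofReal (2 * a + 2 * b) = 2 * ENNReal.ofReal a + 2 * ENNReal.ofReal b := by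
    intro a b ha hb
    rw [ENNReal.ofReal_add (by positivity) (by positivity), ENNReal.ofReal_mul zero_le_two,
      ENNReal.ofReal_mul zero_le_two, ENNReal.ofReal_ofNat]
  rw [← key _ _ (by rw [mul_assoc]; positivity) (by rw [mul_assoc]; positivity)]
  apply ENNReal.ofReal_le_ofReal
  have := mul_le_mul_of_nonneg_right (hF x) hw
  linarith

/-- A weighted Korn inequality for smooth fields extends to the completion. -/
lemma sobolevNorm_le_of_smooth (hΩ : IsOpen Ω) (hr : ContinuousOn r Ω) (hr0 : ∀ x ∈ Ω, 0 < r x)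
    (hρ : ContinuousOn ρ Ω) (hρ0 : ∀ x ∈ Ω, 0 ≤ ρ x) {q : ℝ} {C : NNReal}
    (h : ∀ Z, IsSmoothBddSupp Ω Z → weightedSq Ω r ρ q (fun x => ‖Z x‖ ^ 2) +
      weightedSq Ω r ρ (q + 1) (fun x => gradNormSq (fderiv ℝ Z x)) ≤
        C * weightedSq Ω r ρ (q + 1) (fun x => killingNormSq (fderiv ℝ Z x)))
    {Z : EuclideanSpace ℝ (Fin n) → EuclideanSpace ℝ (Fin n)}
    {G : EuclideanSpace ℝ (Fin n) → EuclideanSpace ℝ (Fin n) →L[ℝ] EuclideanSpace ℝ (Fin n)}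
    (hZ : MemSobolev Ω r ρ q Z G) :
    sobolevNorm Ω r ρ q Z G ≤ (4 * C : ENNReal) ^ (1 / 2 : ℝ) * killingNorm Ω r ρ (q + 1) G := by
  obtain ⟨-, hG, Zk, hZk, hlim⟩ := hZ
  have hΩm := hΩ.measurableSet
  have hr0' : ∀ x ∈ Ω, 0 ≤ r x := fun x hx => (hr0 x hx).le
  have hwm : ∀ s : ℝ, ∀ F : EuclideanSpace ℝ (Fin n) → ℝ, AEMeasurable F (volume.restrict Ω) →
      AEMeasurable (fun x => F x * r x ^ (-(n : ℝ) + 2 * s) * ρ x) (volume.restrict Ω) :=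
    fun s F hF => (hF.mul ((hr.rpow_const fun x hx => .inl (hr0 x hx).ne').aemeasurable hΩm)).mul
      (hρ.aemeasurable hΩm)
  have hfour : ∀ {a b : ℝ}, a ≤ 4 * b → ENNReal.ofReal a ≤ 4 * ENNReal.ofReal b := by
    intro a b hab
    rw [← ENNReal.ofReal_ofNat 4, ← ENNReal.ofReal_mul (by positivity)]
    exact ENNReal.ofReal_le_ofReal hab
  set S := weightedSq Ω r ρ q (fun x => ‖Z x‖ ^ 2) +
    weightedSq Ω r ρ (q + 1) (fun x => gradNormSq (G x)) with hS
  set K := weightedSq Ω r ρ (q + 1) (fun x => killingNormSq (G x)) with hK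
  set E : ℕ → ENNReal := fun k => weightedSq Ω r ρ q (fun x => ‖Zk k x - Z x‖ ^ 2) +
    weightedSq Ω r ρ (q + 1) (fun x => gradNormSq (fderiv ℝ (Zk k) x - G x)) with hE
  have hE0 : Tendsto E atTop (𝓝 0) := by
    have h1 := ENNReal.Tendsto.pow (n := 2) hlim
    rw [zero_pow two_ne_zero] at h1
    refine h1.congr fun k => ?_
    rw [sobolevNorm, ← ENNReal.rpow_mul_natCast]
    norm_num [hE]
  -- Z and G are split as approximant plus error, and so is the Killing tensor of the approximant.
  -- Each splitting costs a factor 2 and |𝒟|² ≤ 4 |∇|² on the error, so the bound is 2E + 2C(2 · 4E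
  -- + 2K).
  have hbound : ∀ k, S ≤ 4 * C * K + (2 + 16 * C) * E k := by
    intro k
    have hD : AEMeasurable (fderiv ℝ (Zk k)) (volume.restrict Ω) :=
      (measurable_fderiv ℝ (Zk k)).aemeasurable
    have h1 : weightedSq Ω r ρ q (fun x => ‖Z x‖ ^ 2) ≤
        2 * weightedSq Ω r ρ q (fun x => ‖Zk k x - Z x‖ ^ 2) +
          2 * weightedSq Ω r ρ q (fun x => ‖Zk k x‖ ^ 2) := by
      refine weightedSq_le_two_mul_add hΩm hr0' hρ0 q (fun x => by positivity)
        (fun x => by positivity) (fun x => ?_) (hwm _ _ ?_)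
      · have e1 : ‖Z x‖ ≤ ‖Zk k x - Z x‖ + ‖Zk k x‖ := by
          have := norm_sub_le (Zk k x) (Zk k x - Z x)
          rw [sub_sub_cancel] at this
          linarith
        nlinarith [sq_nonneg (‖Zk k x - Z x‖ - ‖Zk k x‖), norm_nonneg (Z x)]
      · exact ((hZk k).1.1.continuousOn.norm.pow 2).aemeasurable hΩm
    have h2 : weightedSq Ω r ρ (q + 1) (fun x => gradNormSq (G x)) ≤
        2 * weightedSq Ω r ρ (q + 1) (fun x => gradNormSq (fderiv ℝ (Zk k) x - G x)) +
          2 * weightedSq Ω r ρ (q + 1) (fun x => gradNormSq (fderiv ℝ (Zk k) x)) := by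
      refine weightedSq_le_two_mul_add hΩm hr0' hρ0 (q + 1) (fun x => gradNormSq_nonneg _)
        (fun x => gradNormSq_nonneg _) (fun x => ?_) (hwm _ _ ?_)
      · have := gradNormSq_add_le (-(fderiv ℝ (Zk k) x - G x)) (fderiv ℝ (Zk k) x)
        rwa [gradNormSq_neg, neg_sub, sub_add_cancel] at this
      · exact continuous_gradNormSq.measurable.comp_aemeasurable hD
    have h3 : weightedSq Ω r ρ (q + 1) (fun x => killingNormSq (fderiv ℝ (Zk k) x)) ≤
        2 * weightedSq Ω r ρ (q + 1) (fun x => killingNormSq (fderiv ℝ (Zk k) x - G x)) +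
          2 * K := by
      refine weightedSq_le_two_mul_add hΩm hr0' hρ0 (q + 1) (fun x => killingNormSq_nonneg _)
        (fun x => killingNormSq_nonneg _) (fun x => ?_) (hwm _ _ ?_)
      · have := killingNormSq_add_le (fderiv ℝ (Zk k) x - G x) (G x)
        rwa [sub_add_cancel] at this
      · exact continuous_killingNormSq.measurable.comp_aemeasurable hG.aemeasurable
    have h4 : weightedSq Ω r ρ (q + 1) (fun x => killingNormSq (fderiv ℝ (Zk k) x - G x)) ≤
        4 * E k := by
      calc _ ≤ 4 * weightedSq Ω r ρ (q + 1)
            (fun x => gradNormSq (fderiv ℝ (Zk k) x - G x)) := by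
            unfold weightedSq
            rw [← lintegral_const_mul' _ _ (by finiteness)]
            refine setLIntegral_mono' hΩm fun x hx => ?_
            refine hfour ?_
            have e1 := mul_le_mul_of_nonneg_right (killingNormSq_le (fderiv ℝ (Zk k) x - G x))
              (mul_nonneg (Real.rpow_nonneg (hr0' x hx) (-(n : ℝ) + 2 * (q + 1))) (hρ0 x hx))
            linarith
        _ ≤ _ := by gcongr; exact le_add_self
    calc S ≤ 2 * E k + 2 * (weightedSq Ω r ρ q (fun x => ‖Zk k x‖ ^ 2) +
          weightedSq Ω r ρ (q + 1) (fun x => gradNormSq (fderiv ℝ (Zk k) x))) :=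
          (add_le_add h1 h2).trans_eq (by ring)
      _ ≤ 2 * E k + 2 * (C * (2 * (4 * E k) + 2 * K)) := by
          gcongr 2 * E k + 2 * ?_
          refine (h _ (hZk k).1).trans ?_
          gcongr C * ?_
          exact h3.trans (by gcongr)
      _ = _ := by ring
  have hSK : S ≤ 4 * C * K := by
    have h1 : Tendsto (fun k => 4 * C * K + (2 + 16 * C) * E k) atTop
        (𝓝 (4 * C * K + (2 + 16 * C) * 0)) :=
      tendsto_const_nhds.add (ENNReal.Tendsto.const_mul hE0 (.inr (by finiteness)))
    rw [mul_zero, add_zero] at h1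
    exact ge_of_tendsto' h1 hbound
  rw [sobolevNorm, killingNorm, ← ENNReal.mul_rpow_of_nonneg _ _ (by norm_num)]
  exact ENNReal.rpow_le_rpow hSK (by norm_num)

end Main

theorem proposition4 (n : ℕ) (hn : 3 ≤ n) (e : EuclideanSpace ℝ (Fin n)) (he : ‖e‖ = 1)
    (θ₁ θ₂ : ℝ) (hθ₁ : 0 < θ₁) (hθ₁₂ : θ₁ < θ₂) (hθ₂ : θ₂ < Real.pi)
    (Ω : Set (EuclideanSpace ℝ (Fin n))) (hΩ : IsRegularizedCone e θ₁ θ₂ Ω)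
    (r : EuclideanSpace ℝ (Fin n) → ℝ) (hr : IsRadialWeight r)
    (φ : EuclideanSpace ℝ (Fin n) → ℝ) (hφ : IsAngularWeight e θ₁ θ₂ Ω φ)
    (N : ℕ) (hN : 1 ≤ N) :
    (∀ q : ℝ, 0 < q → q < ((n : ℝ) - 2) / 2 →
      ∃ C : ℝ, 0 < C ∧ ∀ Z : EuclideanSpace ℝ (Fin n) → EuclideanSpace ℝ (Fin n),
        IsSmoothBddSupp Ω Z →
          ∫⁻ x in Ω, ENNReal.ofReal
              (gradNormSq (fderiv ℝ Z x) * r x ^ (2 - (n : ℝ) + 2 * q) * φ x ^ (2 * N)) ≤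
            ENNReal.ofReal C * ∫⁻ x in Ω, ENNReal.ofReal
              (killingNormSq (fderiv ℝ Z x) * r x ^ (2 - (n : ℝ) + 2 * q) * φ x ^ (2 * N))) ∧
    (∀ p : ℝ, ((n : ℝ) - 2) / 2 < p → p < (n : ℝ) - 2 →
      ∃ C : ℝ, 0 < C ∧ ∀ (Z : EuclideanSpace ℝ (Fin n) → EuclideanSpace ℝ (Fin n))
        (G : EuclideanSpace ℝ (Fin n) → EuclideanSpace ℝ (Fin n) →L[ℝ] EuclideanSpace ℝ (Fin n)),
        MemSobolev Ω r (fun x => φ x ^ (2 * N)) ((n : ℝ) - p - 2) Z G →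
          sobolevNorm Ω r (fun x => φ x ^ (2 * N)) ((n : ℝ) - p - 2) Z G ≤
            ENNReal.ofReal C *
              killingNorm Ω r (fun x => φ x ^ (2 * N)) ((n : ℝ) - p - 1) G) := by
  -- With N = m + 1 the weight is φ^(2m+2); the Hardy inequality uses two powers less.
  obtain ⟨m, rfl⟩ := Nat.exists_eq_add_of_le' hN
  rw [mul_add, mul_one]
  refine ⟨fun q hq _ => ?_, fun p _ hp => ?_⟩
  · obtain ⟨C, hC⟩ := exists_weighted_hardy_korn hn he hθ₁ hθ₁₂ hθ₂ hΩ hr hφ hq m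
    refine ⟨C + 1, by positivity, fun Z hZ => ?_⟩
    rw [show 2 - (n : ℝ) + 2 * q = -(n : ℝ) + 2 * q + 2 by ring]
    refine (hC Z hZ).2.trans ?_
    gcongr
    rw [← ENNReal.ofReal_coe_nnreal]
    exact ENNReal.ofReal_le_ofReal (by linarith)
  · have hq : 0 < (n : ℝ) - p - 2 := by linarith
    obtain ⟨C, hC⟩ := exists_weighted_hardy_korn hn he hθ₁ hθ₁₂ hθ₂ hΩ hr hφ hq m
    have hφc : ContinuousOn φ Ω := fun x hx =>
      (hφ.smooth x (subset_closure hx)).continuousAt.continuousWithinAt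
    refine ⟨(4 * (2 * C)) ^ (1 / 2 : ℝ) + 1, by positivity, fun Z G hZ => ?_⟩
    rw [show (n : ℝ) - p - 1 = n - p - 2 + 1 by ring]
    -- The Hardy and Korn bounds are added, each with constant C.
    refine (sobolevNorm_le_of_smooth (C := 2 * C)
      (ρ := fun x => φ x ^ (2 * m + 2)) hΩ.isOpen hr.smooth.continuous.continuousOn
      (fun x _ => hr.pos x) (hφc.pow _) (fun x hx => pow_nonneg (hφ.pos x hx).le _)
      (fun Y hY => ?_) hZ).trans ?_
    · unfold weightedSq
      rw [show -(n : ℝ) + 2 * (n - p - 2 + 1) = -(n : ℝ) + 2 * (n - p - 2) + 2 by ring]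
      refine (add_le_add (hC Y hY).1 (hC Y hY).2).trans_eq ?_
      push_cast
      ring
    · gcongr
      rw [show (4 * ((2 * C : NNReal) : ENNReal)) = ((4 * (2 * C) : NNReal) : ENNReal) by
        push_cast; rfl, ← ENNReal.coe_rpow_of_nonneg _ (by norm_num), ← ENNReal.ofReal_coe_nnreal]
      apply ENNReal.ofReal_le_ofReal
      push_cast
      linarith
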